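/- Let $\nabla=\partial+\sum_{k\le 1}A_k z^{-1-k}$ with $A_k\in\mathfrak{sl}_2(\mathbb{C})$ be an $\mathfrak{sl}_2$-connection on the formal punctured disc, irregular of Poisson order $1$ with diagonalizable irregular term: for some $P\in \mathrm{GL}_2(\mathbb{C})$ and $\xi\neq 0$ we have $P^{-1}A_1P=\begin{pmatrix}\xi&0\\0&-\xi\end{pmatrix}$. Let $\varepsilon$ be the upper left entry of $P^{-1}A_0P$. (If $A_1$ itself is diagonal, take $P=1$.) Rows and columns are indexed by $+,-$. Put $C_k=\begin{pmatrix}0&-1\\1&0\end{pmatrix}A_k$, which is a symmetric matrix with entries $C_k^{ab}$ ($C_k=0$ for $k>1$), and let $(e^+,e^-)=1=-(e^-,e^+)$, $(e^\pm,e^\pm)=0$. Let $\mathcal{SF}_{\partial+A}$ be the unital associative $\mathbb{C}$-algebra with generators $\psi^a_n$ ($a\in\{+,-\}$, $n\in\mathbb{Z}$) and relations $$\psi^a_m\psi^b_n+\psi^b_n\psi^a_m=m\,(e^a,e^b)\,\delta_{m+n,0}+C^{ab}_{m+n}.$$ Let $M$ be the induced $\mathcal{SF}_{\partial+A}$-module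 generated by a vector $v$ with the defining relations $\psi^\pm_nv=0$ for $n\ge 1$, that is, the quotient of $\mathcal{SF}_{\partial+A}$ by the left ideal generated by the $\psi_n^\pm$, $n\geq 1$. Let $:\!\psi^a_i\psi^b_j\!:$ be $\psi^a_i\psi^b_j$ if $i<j$, $-\psi^b_j\psi^a_i$ if $i>j$, and $\frac12(\psi^a_i\psi^b_j-\psi^b_j\psi^a_i)$ if $i=j$, and put $$L_n=\sum_{i+j=n}:\!\psi^-_i\psi^+_j\!:\;+\;c_n,\qquad c_n=\frac12\sum_{i+j=n}\left(C_i^{-+}C_j^{+-}-C_i^{++}C_j^{--}\right).$$ **Theorem.** The module $M$ is simple, and $x\mapsto xv$ is a bijection from the subalgebra $\mathcal{SF}^{\le 0}_{\partial+A}$ generated by the $\psi_n^\pm$, $n\le 0$, onto $M$. On every vector of $M$ only finitely many summands of $L_n$ are nonzero, and the operators $L_n$, $n\in\mathbb{Z}$, define a representation of the Virasoro algebra on $M$ with central charge $-2$. As a representation of the Virasoro algebra, $M$ is the direct sum over $k\in\mathbb{Z}$ of universal Whittaker modules of central charge $-2$, the $k$-th one being generated by a Whittaker vector $w_k$ with $$L_nw_k=0\quad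 (n\ge 3),\qquad L_2w_k=\tfrac12\xi^2\,w_k,\qquad L_1w_k=\xi(k+\varepsilon)\,w_k .$$ Here the universal Whittaker module of central charge $c$ and type $(a_1,a_2)$ is the module over the Virasoro algebra induced from the one-dimensional representation of the subalgebra spanned by the central element and the $L_n$, $n\ge 1$, in which the central element, $L_1$, $L_2$ and $L_n$ ($n\ge 3$) act by $c$, $a_1$, $a_2$ and $0$. -/

import Mathlib

open scoped DirectSum

noncomputable section

/-! ### The Virasoro Lie algebra -/

/-- The underlying space of the Virasoro algebra: finite combinations of the `L n`, `n ∈ ℤ`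
(first component), plus a multiple of the central element (second component). -/
def Virasoro : Type := (ℤ →₀ ℂ) × ℂ

namespace Virasoro

instance : AddCommGroup Virasoro := inferInstanceAs (AddCommGroup ((ℤ →₀ ℂ) × ℂ))

instance : Module ℂ Virasoro := inferInstanceAs (Module ℂ ((ℤ →₀ ℂ) × ℂ))

/-- The generator `L n`. -/
def L (n : ℤ) : Virasoro := (Finsupp.single n 1, 0)

/-- The central element. -/
def central : Virasoro := (0, 1)

/-- The Witt bracket, the bilinear extension of `[L m, L n] = (m - n) L (m + n)`. -/
def wittBracket (f g : ℤ →₀ ℂ) : ℤ →₀ ℂ :=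
  f.sum fun m a => g.sum fun n b => Finsupp.single (m + n) (((m : ℂ) - n) * a * b)

/-- The Virasoro cocycle, the bilinear extension of
`(L m, L n) ↦ (m ^ 3 - m) / 12` if `m + n = 0`, and `0` otherwise. -/
def cocycle (f g : ℤ →₀ ℂ) : ℂ :=
  f.sum fun m a => g.sum fun n b =>
    if m + n = 0 then ((m : ℂ) ^ 3 - m) / 12 * a * b else 0

theorem wittBracket_add_left (f f' g : ℤ →₀ ℂ) :
    wittBracket (f + f') g = wittBracket f g + wittBracket f' g := by
  unfold wittBracket
  rw [Finsupp.sum_add_index']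
  · intro m; simp
  · intro m a b
    rw [← Finsupp.sum_add]
    refine Finsupp.sum_congr fun n _ => ?_
    rw [← Finsupp.single_add]; congr 1; ring

theorem wittBracket_add_right (f g g' : ℤ →₀ ℂ) :
    wittBracket f (g + g') = wittBracket f g + wittBracket f g' := by
  unfold wittBracket
  rw [← Finsupp.sum_add]
  refine Finsupp.sum_congr fun n _ => ?_
  rw [Finsupp.sum_add_index']
  · intro m; simp
  · intro m a b; rw [← Finsupp.single_add]; congr 1; ring

theorem cocycle_add_left (f f' g : ℤ →₀ ℂ) :
    cocycle (f + f') g = cocycle f g + cocycle f' g := by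
  unfold cocycle
  rw [Finsupp.sum_add_index']
  · intro m; simp
  · intro m a b
    rw [← Finsupp.sum_add]
    refine Finsupp.sum_congr fun n _ => ?_
    split_ifs <;> ring

theorem cocycle_add_right (f g g' : ℤ →₀ ℂ) :
    cocycle f (g + g') = cocycle f g + cocycle f g' := by
  unfold cocycle
  rw [← Finsupp.sum_add]
  refine Finsupp.sum_congr fun n _ => ?_
  rw [Finsupp.sum_add_index']
  · intro m; simp
  · intro m a b; split_ifs <;> ring

@[simp] theorem wittBracket_zero_left (g : ℤ →₀ ℂ) : wittBracket 0 g = 0 := by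
  simp [wittBracket]

@[simp] theorem wittBracket_zero_right (g : ℤ →₀ ℂ) : wittBracket g 0 = 0 := by
  simp [wittBracket]

@[simp] theorem cocycle_zero_left (g : ℤ →₀ ℂ) : cocycle 0 g = 0 := by
  simp [cocycle]

@[simp] theorem cocycle_zero_right (g : ℤ →₀ ℂ) : cocycle g 0 = 0 := by
  simp [cocycle]

@[simp] theorem wittBracket_single (m n : ℤ) (a b : ℂ) :
    wittBracket (Finsupp.single m a) (Finsupp.single n b)
      = Finsupp.single (m + n) (((m : ℂ) - n) * a * b) := by
  simp [wittBracket]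

@[simp] theorem cocycle_single (m n : ℤ) (a b : ℂ) :
    cocycle (Finsupp.single m a) (Finsupp.single n b)
      = if m + n = 0 then ((m : ℂ) ^ 3 - m) / 12 * a * b else 0 := by
  simp [cocycle]

theorem wittBracket_swap (f g : ℤ →₀ ℂ) : wittBracket f g = -wittBracket g f := by
  induction f using Finsupp.induction_linear with
  | zero => simp
  | add f f' hf hf' => rw [wittBracket_add_left, wittBracket_add_right, hf, hf']; abel
  | single m a =>
    induction g using Finsupp.induction_linear with
    | zero => simp
    | add g g' hg hg' => rw [wittBracket_add_left, wittBracket_add_right, hg, hg']; abel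
    | single n b =>
      rw [wittBracket_single, wittBracket_single, ← Finsupp.single_neg, add_comm n m]
      congr 1; ring

theorem cocycle_swap (f g : ℤ →₀ ℂ) : cocycle f g = -cocycle g f := by
  induction f using Finsupp.induction_linear with
  | zero => simp
  | add f f' hf hf' => rw [cocycle_add_left, cocycle_add_right, hf, hf']; ring
  | single m a =>
    induction g using Finsupp.induction_linear with
    | zero => simp
    | add g g' hg hg' => rw [cocycle_add_left, cocycle_add_right, hg, hg']; ring
    | single n b =>
      rw [cocycle_single, cocycle_single, add_comm n m]
      split_ifs with h
      · obtain rfl : n = -m := by omega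
        push_cast; ring
      · simp

theorem wittBracket_jacobi (f g h : ℤ →₀ ℂ) :
    wittBracket f (wittBracket g h)
      = wittBracket (wittBracket f g) h + wittBracket g (wittBracket f h) := by
  induction f using Finsupp.induction_linear with
  | zero => simp
  | add f f' hf hf' =>
    simp only [wittBracket_add_left, wittBracket_add_right, hf, hf']; abel
  | single m a =>
    induction g using Finsupp.induction_linear with
    | zero => simp
    | add g g' hg hg' =>
      simp only [wittBracket_add_left, wittBracket_add_right, hg, hg']; abel
    | single n b =>
      induction h using Finsupp.induction_linear with
      | zero => simp
      | add h h' hh hh' =>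
        simp only [wittBracket_add_right, hh, hh']; abel
      | single k c =>
        simp only [wittBracket_single]
        rw [show n + (m + k) = m + n + k by ring, show m + (n + k) = m + n + k by ring,
          ← Finsupp.single_add]
        congr 1; push_cast; ring

theorem cocycle_jacobi (f g h : ℤ →₀ ℂ) :
    cocycle f (wittBracket g h)
      = cocycle (wittBracket f g) h + cocycle g (wittBracket f h) := by
  induction f using Finsupp.induction_linear with
  | zero => simp
  | add f f' hf hf' =>
    simp only [wittBracket_add_left, cocycle_add_left, cocycle_add_right, hf, hf']; ring
  | single m a =>
    induction g using Finsupp.induction_linear with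
    | zero => simp
    | add g g' hg hg' =>
      simp only [wittBracket_add_left, wittBracket_add_right, cocycle_add_left,
        cocycle_add_right, hg, hg']; ring
    | single n b =>
      induction h using Finsupp.induction_linear with
      | zero => simp
      | add h h' hh hh' =>
        simp only [wittBracket_add_right, cocycle_add_right, hh, hh']; ring
      | single k c =>
        simp only [wittBracket_single, cocycle_single]
        rw [show n + (m + k) = m + n + k by ring, show m + (n + k) = m + n + k by ring]
        split_ifs with h
        · obtain rfl : k = -m - n := by omega
          push_cast; ring
        · simp

/-- `[L m, L n] = (m - n) L (m + n) + (m ^ 3 - m) / 12 δ_{m + n, 0} central`. -/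
instance : Bracket Virasoro Virasoro where
  bracket x y := (wittBracket x.1 y.1, cocycle x.1 y.1)

instance : LieRing Virasoro where
  add_lie x y z := Prod.ext (wittBracket_add_left x.1 y.1 z.1) (cocycle_add_left x.1 y.1 z.1)
  lie_add x y z := Prod.ext (wittBracket_add_right x.1 y.1 z.1) (cocycle_add_right x.1 y.1 z.1)
  lie_self x := Prod.ext (self_eq_neg.mp (wittBracket_swap x.1 x.1))
    (self_eq_neg.mp (cocycle_swap x.1 x.1))
  leibniz_lie x y z :=
    Prod.ext (wittBracket_jacobi x.1 y.1 z.1) (cocycle_jacobi x.1 y.1 z.1)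

theorem wittBracket_smul_right (t : ℂ) (f g : ℤ →₀ ℂ) :
    wittBracket f (t • g) = t • wittBracket f g := by
  unfold wittBracket
  rw [Finsupp.smul_sum]
  refine Finsupp.sum_congr fun m _ => ?_
  rw [Finsupp.sum_smul_index (by intro i; simp), Finsupp.smul_sum]
  refine Finsupp.sum_congr fun n _ => ?_
  rw [Finsupp.smul_single, smul_eq_mul]; congr 1; ring

theorem cocycle_smul_right (t : ℂ) (f g : ℤ →₀ ℂ) :
    cocycle f (t • g) = t • cocycle f g := by
  unfold cocycle
  rw [Finsupp.smul_sum]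
  refine Finsupp.sum_congr fun m _ => ?_
  rw [Finsupp.sum_smul_index (by intro i; simp), Finsupp.smul_sum]
  refine Finsupp.sum_congr fun n _ => ?_
  rw [smul_eq_mul]; split_ifs <;> ring

instance : LieAlgebra ℂ Virasoro where
  lie_smul t x y :=
    Prod.ext (wittBracket_smul_right t x.1 y.1) (cocycle_smul_right t x.1 y.1)

theorem L_lie_L (m n : ℤ) :
    ⁅L m, L n⁆ = ((m : ℂ) - n) • L (m + n)
      + (if m + n = 0 then ((m : ℂ) ^ 3 - m) / 12 else 0) • central := by
  refine Prod.ext ?_ ?_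
  · change wittBracket (Finsupp.single m 1) (Finsupp.single n 1)
      = ((m : ℂ) - n) • Finsupp.single (m + n) (1 : ℂ)
        + (if m + n = 0 then ((m : ℂ) ^ 3 - m) / 12 else 0) • (0 : ℤ →₀ ℂ)
    simp
  · change cocycle (Finsupp.single m 1) (Finsupp.single n 1)
      = ((m : ℂ) - n) • (0 : ℂ)
        + (if m + n = 0 then ((m : ℂ) ^ 3 - m) / 12 else 0) • (1 : ℂ)
    simp

/-- The left ideal of `U(Vir)` generated by `central - c`, `L 1 - a₁`, `L 2 - a₂` and
`L n` for `n ≥ 3`. -/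
def whittakerIdeal (c a₁ a₂ : ℂ) :
    Submodule (UniversalEnvelopingAlgebra ℂ Virasoro) (UniversalEnvelopingAlgebra ℂ Virasoro) :=
  Submodule.span (UniversalEnvelopingAlgebra ℂ Virasoro)
    ({UniversalEnvelopingAlgebra.ι ℂ central - algebraMap ℂ _ c,
      UniversalEnvelopingAlgebra.ι ℂ (L 1) - algebraMap ℂ _ a₁,
      UniversalEnvelopingAlgebra.ι ℂ (L 2) - algebraMap ℂ _ a₂} ∪
     {x | ∃ n : ℤ, 3 ≤ n ∧ x = UniversalEnvelopingAlgebra.ι ℂ (L n)})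

/-- The universal Whittaker module of central charge `c` and type `(a₁, a₂)`: the `U(Vir)`-module
induced from the one-dimensional representation of the span of `central` and the `L n`, `n ≥ 1`,
on which `central`, `L 1`, `L 2`, `L n` (`n ≥ 3`) act by `c`, `a₁`, `a₂`, `0`. -/
abbrev UniversalWhittaker (c a₁ a₂ : ℂ) : Type :=
  UniversalEnvelopingAlgebra ℂ Virasoro ⧸ whittakerIdeal c a₁ a₂

/-- The generating Whittaker vector. -/
def UniversalWhittaker.gen (c a₁ a₂ : ℂ) : UniversalWhittaker c a₁ a₂ :=
  Submodule.Quotient.mk 1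

end Virasoro

/-! ### Deformed symplectic fermions

The index set `{+, -}` is `Fin 2`, with `0` for `+` and `1` for `-`. -/

namespace SymplecticFermion

/-- The standard symplectic form: `(e⁺, e⁻) = 1 = -(e⁻, e⁺)`. -/
def sympl : Matrix (Fin 2) (Fin 2) ℂ := !![0, 1; -1, 0]

/-- The relations `{ψ^a_m, ψ^b_n} = m (e^a, e^b) δ_{m+n,0} + C_{m+n}^{ab}`. -/
inductive Rel (C : ℤ → Matrix (Fin 2) (Fin 2) ℂ) :
    FreeAlgebra ℂ (Fin 2 × ℤ) → FreeAlgebra ℂ (Fin 2 × ℤ) → Prop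
  | anticomm (a b : Fin 2) (m n : ℤ) :
      Rel C
        (FreeAlgebra.ι ℂ (a, m) * FreeAlgebra.ι ℂ (b, n)
          + FreeAlgebra.ι ℂ (b, n) * FreeAlgebra.ι ℂ (a, m))
        (algebraMap ℂ _ ((if m + n = 0 then (m : ℂ) * sympl a b else 0) + C (m + n) a b))

/-- The deformed mode algebra with generators `ψ^a_n` and Clifford parameter `C`. -/
abbrev ModeAlgebra (C : ℤ → Matrix (Fin 2) (Fin 2) ℂ) : Type := RingQuot (Rel C)

/-- The generator `ψ^a_n`. -/
def psi (C : ℤ → Matrix (Fin 2) (Fin 2) ℂ) (a : Fin 2) (n : ℤ) : ModeAlgebra C :=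
  RingQuot.mkAlgHom ℂ (Rel C) (FreeAlgebra.ι ℂ (a, n))

/-- Normally ordered product of `ψ^a_i` and `ψ^b_j`. -/
def normOrd (C : ℤ → Matrix (Fin 2) (Fin 2) ℂ) (a : Fin 2) (i : ℤ) (b : Fin 2) (j : ℤ) :
    ModeAlgebra C :=
  if i < j then psi C a i * psi C b j
  else if j < i then -(psi C b j * psi C a i)
  else (1 / 2 : ℂ) • (psi C a i * psi C b j) - (1 / 2 : ℂ) • (psi C b j * psi C a i)

/-- The subalgebra generated by the `ψ^a_n` with `n ≤ 0`. -/
def nonposSubalgebra (C : ℤ → Matrix (Fin 2) (Fin 2) ℂ) : Subalgebra ℂ (ModeAlgebra C) :=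
  Algebra.adjoin ℂ {x | ∃ (a : Fin 2) (n : ℤ), n ≤ 0 ∧ x = psi C a n}

/-- The left ideal generated by the `ψ^a_n` with `n ≥ 1`. -/
def positiveIdeal (C : ℤ → Matrix (Fin 2) (Fin 2) ℂ) :
    Submodule (ModeAlgebra C) (ModeAlgebra C) :=
  Submodule.span (ModeAlgebra C) {x | ∃ (a : Fin 2) (n : ℤ), 1 ≤ n ∧ x = psi C a n}

/-- The module induced from the module `V⁰¹` over the subalgebra generated by the `ψ^a_n`,
`n ≥ 0`, where `V⁰¹` is generated by one vector `v` with relations `ψ^a_n v = 0` for `n ≥ 1`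
(so it has basis `v, ψ⁺_0 v, ψ⁻_0 v, ψ⁺_0 ψ⁻_0 v` in the irregular case of order one).
Inducing a cyclic module `B / J` to `A ⊇ B` gives `A / A J`. -/
abbrev InducedModule (C : ℤ → Matrix (Fin 2) (Fin 2) ℂ) : Type :=
  ModeAlgebra C ⧸ positiveIdeal C

/-- The generating vector `v` of the induced module. -/
def vac (C : ℤ → Matrix (Fin 2) (Fin 2) ℂ) : InducedModule C := Submodule.Quotient.mk 1

/-- The additive constant
`c_n = 1/2 ∑_{i+j=n} (C_i^{-+} C_j^{+-} - C_i^{++} C_j^{--})` of the Sugawara operator. -/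
def sugawaraConst (C : ℤ → Matrix (Fin 2) (Fin 2) ℂ) (n : ℤ) : ℂ :=
  (1 / 2) * ∑ᶠ i : ℤ, (C i 1 0 * C (n - i) 0 1 - C i 0 0 * C (n - i) 1 1)

/-- The operator `L_n = ∑_{i+j=n} :ψ⁻_i ψ⁺_j: + c_n` on the induced module; the sum is meant where
only finitely many summands are nonzero on each vector. -/
def sugawara (C : ℤ → Matrix (Fin 2) (Fin 2) ℂ) (n : ℤ) (u : InducedModule C) :
    InducedModule C :=
  (∑ᶠ i : ℤ, normOrd C 1 i 0 (n - i) • u) + sugawaraConst C n • u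

/-- The Clifford parameter `C_k^{ab} = (A_k e^a, e^b)` of the connection
`∂ + ∑_k A_k z^{-1-k}` with `A_k ∈ sl₂`. -/
def cliffordParam (A : ℤ → LieAlgebra.SpecialLinear.sl (Fin 2) ℂ) (k : ℤ) :
    Matrix (Fin 2) (Fin 2) ℂ :=
  !![0, -1; 1, 0] * (A k : Matrix (Fin 2) (Fin 2) ℂ)

end SymplecticFermion

end

/-! The deformed fermions are traded for an undeformed fermionic ghost system, in which the Virasoro
operators become a free boson plus terms of lower energy.

Commutation with the quadratic operator `T n` acts on the mode of `z^m y` as `-z^(n+1) ∇`. Since `A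
1` has the two distinct eigenvalues `ξ` and `-ξ`, there are formal power series `f`, `g` with `∇ f =
(ξ z⁻² + ε z⁻¹) f` and `∇ g = -(ξ z⁻² + ε z⁻¹) g` (`exists_isEigenSection_pair`). The modes of `f`
are called `c`; those of `g` are integrated once, in a twisted sense, to modes `d` (`ghost`). All
anticommutators between these modes are scalars. Their top values come from the leading coefficients
of `f` and `g`, and compatibility with the derivations `[T n, ·]` forces the rest: `{d_m, c_n} =
δ_{m+n,1}` and all others vanish (`exists_bcSystem`).

Thus `M` is a fermionic Fock space, whose vacuum is unique up to scalars (`vac_unique`). This gives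
simplicity, and a Schur lemma (`schur`): an operator is determined up to a scalar by its commutators
with the modes. So the Virasoro relations hold up to scalars, and these are read off from a vacuum
expectation `τ` (`τ_T_T_vac`), whose part independent of `C` produces the central charge `-2` and
whose part quadratic in `C` is absorbed by the constants `c_n`. Likewise `L n = ξ J (n - 1) +
quadratic + scalar`, where `J` is the charge current (`eq_current_add`).

The current generates a Heisenberg algebra, and its creation monomials on the charged vacua form a
basis of `M`: they are joint eigenvectors with different characters (`linearIndependent_jmon`), and
they span by a fermionic form of Newton's identities (`span_jmon`). For the energy filtration `ξ J
(-n - 1)` is the top part of `L (-n)`, so sorted monomials in the `L (-n)`, `n ≥ 0`, on the charged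
vacua are triangular over this basis and form a basis too (`linearIndependent_and_span_lmon`). The
charged vacua are Whittaker vectors (`L_pos_cv`). A universal Whittaker module is spanned by the
same monomials, by sorting. Hence the canonical map from the direct sum sends a spanning family to a
basis and is bijective; independence of the monomials in the universal modules is a consequence, not
an input.

The bijection with the nonpositive subalgebra rests on a concrete model: the Clifford algebra of the
nonpositive modes, where positive modes act by contraction (`fockMode_anticomm`). The model also
supplies `τ`. -/

section LocallyFinite

/-! ### Locally finite sums of operators -/

variable {M : Type*} [AddCommGroup M] [Module ℂ M] {ι : Type*}

/-- A family of endomorphisms is locally finite if every vector is killed by almost all of them. -/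
def LocFin (q : ι → Module.End ℂ M) : Prop := ∀ u : M, (Function.support fun i => q i u).Finite

open Classical in
/-- The sum of a locally finite family of endomorphisms (`0` if the family is not locally
finite). -/
noncomputable def lfsum (q : ι → Module.End ℂ M) : Module.End ℂ M :=
  if hq : LocFin q then
    { toFun := fun u => ∑ᶠ i, q i u
      map_add' := fun u u' => by
        simp only [map_add]
        exact finsum_add_distrib (hq u) (hq u')
      map_smul' := fun t u => by
        simp only [map_smul, RingHom.id_apply]
        exact (smul_finsum' t (hq u)).symm }
  else 0

theorem lfsum_apply {q : ι → Module.End ℂ M} (hq : LocFin q) (u : M) :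
    lfsum q u = ∑ᶠ i, q i u := by
  rw [lfsum, dif_pos hq]; rfl

theorem lfsum_apply_eq_sum {q : ι → Module.End ℂ M} (hq : LocFin q) {u : M} {s : Finset ι}
    (h : ∀ i, i ∉ s → q i u = 0) : lfsum q u = ∑ i ∈ s, q i u := by
  rw [lfsum_apply hq]
  refine finsum_eq_sum_of_support_subset _ fun i hi => ?_
  by_contra hs
  exact hi (h i hs)

theorem locFin_of_finset {q : ι → Module.End ℂ M}
    (h : ∀ u, ∃ s : Finset ι, ∀ i, i ∉ s → q i u = 0) : LocFin q := by
  intro u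
  obtain ⟨s, hs⟩ := h u
  refine s.finite_toSet.subset fun i hi => ?_
  by_contra his
  exact hi (hs i his)

namespace LocFin

variable {q r : ι → Module.End ℂ M}

theorem exists_finset (hq : LocFin q) (u : M) : ∃ s : Finset ι, ∀ i, i ∉ s → q i u = 0 :=
  ⟨(hq u).toFinset, fun i hi => by simpa using hi⟩

theorem add (hq : LocFin q) (hr : LocFin r) : LocFin fun i => q i + r i := by
  classical
  refine locFin_of_finset fun u => ?_
  obtain ⟨s, hs⟩ := hq.exists_finset u
  obtain ⟨t, ht⟩ := hr.exists_finset u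
  refine ⟨s ∪ t, fun i hi => ?_⟩
  rw [Finset.notMem_union] at hi
  simp [hs i hi.1, ht i hi.2]

theorem smul (hq : LocFin q) (a : ι → ℂ) : LocFin fun i => a i • q i := by
  refine locFin_of_finset fun u => ?_
  obtain ⟨s, hs⟩ := hq.exists_finset u
  exact ⟨s, fun i hi => by simp [hs i hi]⟩

theorem neg (hq : LocFin q) : LocFin fun i => -q i := by
  refine locFin_of_finset fun u => ?_
  obtain ⟨s, hs⟩ := hq.exists_finset u
  exact ⟨s, fun i hi => by simp [hs i hi]⟩

theorem sub (hq : LocFin q) (hr : LocFin r) : LocFin fun i => q i - r i := by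
  simpa only [sub_eq_add_neg] using hq.add hr.neg

theorem mul_left (hq : LocFin q) (Z : Module.End ℂ M) : LocFin fun i => Z * q i := by
  refine locFin_of_finset fun u => ?_
  obtain ⟨s, hs⟩ := hq.exists_finset u
  exact ⟨s, fun i hi => by simp [hs i hi]⟩

theorem mul_right (hq : LocFin q) (Z : Module.End ℂ M) : LocFin fun i => q i * Z := by
  refine locFin_of_finset fun u => ?_
  obtain ⟨s, hs⟩ := hq.exists_finset (Z u)
  exact ⟨s, fun i hi => by simp [hs i hi]⟩

theorem comp_injective {κ : Type*} (hq : LocFin q) {e : κ → ι} (he : Function.Injective e) :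
    LocFin fun i => q (e i) := fun u => (hq u).preimage he.injOn

end LocFin

section

variable {q r : ι → Module.End ℂ M}

theorem lfsum_add (hq : LocFin q) (hr : LocFin r) :
    lfsum (fun i => q i + r i) = lfsum q + lfsum r := by
  ext u
  rw [lfsum_apply (hq.add hr), LinearMap.add_apply, lfsum_apply hq, lfsum_apply hr]
  exact finsum_add_distrib (hq u) (hr u)

theorem lfsum_neg (hq : LocFin q) : lfsum (fun i => -q i) = -lfsum q := by
  ext u
  rw [lfsum_apply hq.neg, LinearMap.neg_apply, lfsum_apply hq]
  exact finsum_neg_distrib (fun i => q i u)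

theorem lfsum_sub (hq : LocFin q) (hr : LocFin r) :
    lfsum (fun i => q i - r i) = lfsum q - lfsum r := by
  simp only [sub_eq_add_neg]
  rw [lfsum_add hq hr.neg, lfsum_neg hr]

theorem lfsum_smul (hq : LocFin q) (t : ℂ) : lfsum (fun i => t • q i) = t • lfsum q := by
  ext u
  rw [lfsum_apply (hq.smul fun _ => t), LinearMap.smul_apply, lfsum_apply hq]
  exact (smul_finsum' t (hq u)).symm

theorem lfsum_mul_left (hq : LocFin q) (Z : Module.End ℂ M) :
    lfsum (fun i => Z * q i) = Z * lfsum q := by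
  ext u
  obtain ⟨s, hs⟩ := hq.exists_finset u
  rw [lfsum_apply_eq_sum (hq.mul_left Z) (s := s) fun i hi => by simp [hs i hi],
    Module.End.mul_apply, lfsum_apply_eq_sum hq hs, map_sum]
  rfl

theorem lfsum_mul_right (hq : LocFin q) (Z : Module.End ℂ M) :
    lfsum (fun i => q i * Z) = lfsum q * Z := by
  ext u
  rw [lfsum_apply (hq.mul_right Z), Module.End.mul_apply, lfsum_apply hq]
  rfl

theorem lfsum_commutator (hq : LocFin q) (Z : Module.End ℂ M) :
    lfsum q * Z - Z * lfsum q = lfsum fun i => q i * Z - Z * q i := by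
  rw [lfsum_sub (hq.mul_right Z) (hq.mul_left Z), lfsum_mul_left hq, lfsum_mul_right hq]

theorem lfsum_anticommutator (hq : LocFin q) (Z : Module.End ℂ M) :
    lfsum q * Z + Z * lfsum q = lfsum fun i => q i * Z + Z * q i := by
  rw [lfsum_add (hq.mul_right Z) (hq.mul_left Z), lfsum_mul_left hq, lfsum_mul_right hq]

theorem lfsum_eq_single (i : ι) (h : ∀ j, j ≠ i → q j = 0) : lfsum q = q i := by
  have hq : LocFin q := locFin_of_finset fun u => ⟨{i}, fun j hj => by
    rw [h j (by simpa using hj)]; rfl⟩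
  ext u
  rw [lfsum_apply_eq_sum hq (s := {i}) fun j hj => by rw [h j (by simpa using hj)]; rfl]
  simp

theorem lfsum_eq_zero (h : ∀ i, q i = 0) : lfsum q = 0 := by
  have hq : LocFin q := locFin_of_finset fun u => ⟨∅, fun j _ => by rw [h j]; rfl⟩
  ext u
  rw [lfsum_apply_eq_sum hq (s := ∅) fun j _ => by rw [h j]; rfl]
  simp

theorem lfsum_equiv {κ : Type*} (hq : LocFin q) (e : κ ≃ ι) :
    lfsum (fun i => q (e i)) = lfsum q := by
  ext u
  rw [lfsum_apply hq, lfsum_apply (hq.comp_injective e.injective)]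
  exact finsum_comp_equiv (f := fun i => q i u) e

theorem lfsum_mem (hq : LocFin q) {S : Submodule ℂ M} {u : M} (h : ∀ i, q i u ∈ S) :
    lfsum q u ∈ S := by
  obtain ⟨s, hs⟩ := hq.exists_finset u
  rw [lfsum_apply_eq_sum hq hs]
  exact S.sum_mem fun i _ => h i

theorem lfsum_apply_eq_zero (hq : LocFin q) {u : M} (h : ∀ i, q i u = 0) : lfsum q u = 0 := by
  rw [lfsum_apply_eq_sum hq (s := ∅) fun i _ => h i]; simp

/-- Evaluating at one nonzero vector shows that only finitely many of the scalars are nonzero. This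
is how infinite sums of anticommutators are seen to be scalars before their value is known. -/
theorem lfsum_scalar (hq : LocFin q) (h : ∀ i, ∃ t : ℂ, q i = t • (1 : Module.End ℂ M)) :
    ∃ t : ℂ, lfsum q = t • (1 : Module.End ℂ M) := by
  choose t ht using h
  by_cases hM : ∃ v : M, v ≠ 0
  · obtain ⟨v, hv⟩ := hM
    have hfin : (Function.support t).Finite := by
      refine (hq v).subset fun i hi => ?_
      simp only [Function.mem_support, ht i] at hi ⊢
      simpa using ⟨hi, hv⟩
    refine ⟨∑ᶠ i, t i, ?_⟩
    ext u
    rw [lfsum_apply hq]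
    simp only [LinearMap.smul_apply, Module.End.one_apply, ht]
    exact (finsum_smul' hfin u).symm
  · push Not at hM
    exact ⟨0, by ext u; rw [hM u]; simp⟩

end

/-- A sequence of endomorphisms is smooth if every vector is killed by the ones of large index. -/
def SmoothModes (x : ℤ → Module.End ℂ M) : Prop := ∀ u : M, ∃ K : ℤ, ∀ n, K ≤ n → x n u = 0

namespace SmoothModes

variable {x y : ℤ → Module.End ℂ M}

theorem locFin (hx : SmoothModes x) (m : ℤ) : LocFin fun j : ℕ => x (m + j) := by
  refine locFin_of_finset fun u => ?_
  obtain ⟨K, hK⟩ := hx u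
  refine ⟨Finset.range (K - m).toNat, fun j hj => hK _ ?_⟩
  rw [Finset.mem_range] at hj
  omega

/-- Smooth sequences satisfying a homogeneous recursion vanish. -/
theorem eq_zero_of_recursion (hx : SmoothModes x) {a : ℤ → ℂ}
    (h : ∀ n, x n = a n • x (n + 1)) (n : ℤ) : x n = 0 := by
  ext u
  obtain ⟨K, hK⟩ := hx u
  have key : ∀ j : ℕ, ∀ n : ℤ, K ≤ n + j → x n u = 0 := by
    intro j
    induction j with
    | zero => intro n hn; exact hK n (by simpa using hn)
    | succ j ih =>
      intro n hn
      rw [h n, LinearMap.smul_apply, ih (n + 1) (by push_cast at hn; linarith), smul_zero]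
  exact key (K - n).toNat n (by omega)

end SmoothModes

end LocallyFinite

/-! ### Vacuum representations of the modes and the quadratic field -/

open SymplecticFermion

/-- The scalar `{ψ^a_m, ψ^b_n}`. -/
noncomputable def modePairing (C : ℤ → Matrix (Fin 2) (Fin 2) ℂ) (a : Fin 2) (m : ℤ) (b : Fin 2)
    (n : ℤ) : ℂ :=
  (if m + n = 0 then (m : ℂ) * sympl a b else 0) + C (m + n) a b

/-- A cyclic vacuum representation of the deformed symplectic fermions, with a functional `τ`
that vanishes on antisymmetrized products of two nonpositive modes applied to the vacuum. -/
structure FermionRep (C : ℤ → Matrix (Fin 2) (Fin 2) ℂ) (M : Type*) [AddCommGroup M]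
    [Module ℂ M] where
  cutoff : ∀ k, 1 < k → C k = 0
  symm : ∀ k a b, C k a b = C k b a
  ψ : Fin 2 → ℤ → Module.End ℂ M
  anticomm : ∀ a m b n, ψ a m * ψ b n + ψ b n * ψ a m
    = modePairing C a m b n • (1 : Module.End ℂ M)
  v : M
  vac : ∀ a n, 1 ≤ n → ψ a n v = 0
  gen : ∀ S : Submodule ℂ M, v ∈ S → (∀ a n, ∀ u ∈ S, ψ a n u ∈ S) → S = ⊤
  τ : M →ₗ[ℂ] ℂ
  τ_vac : τ v = 1
  τ_two : ∀ a m b n, m ≤ 0 → n ≤ 0 → τ (ψ a m (ψ b n v)) = 1 / 2 * modePairing C a m b n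

namespace FermionRep

variable {C : ℤ → Matrix (Fin 2) (Fin 2) ℂ} {M : Type*} [AddCommGroup M] [Module ℂ M]
  (S : FermionRep C M)

theorem modePairing_eq_zero (S : FermionRep C M) {a b : Fin 2} {m n : ℤ} (h : 1 < m + n) :
    modePairing C a m b n = 0 := by
  rw [modePairing, if_neg (by omega), S.cutoff _ h]; simp

/-- The vectors with such a bound form a subspace containing the vacuum and stable under all modes,
so cyclicity applies. -/
theorem smooth (u : M) : ∃ K : ℤ, ∀ a n, K ≤ n → S.ψ a n u = 0 := by
  let T : Submodule ℂ M :=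
    { carrier := {u | ∃ K : ℤ, ∀ a n, K ≤ n → S.ψ a n u = 0}
      zero_mem' := ⟨0, fun a n _ => map_zero _⟩
      add_mem' := by
        rintro x y ⟨K, hK⟩ ⟨K', hK'⟩
        refine ⟨max K K', fun a n hn => ?_⟩
        rw [map_add, hK a n (le_trans (le_max_left _ _) hn),
          hK' a n (le_trans (le_max_right _ _) hn), add_zero]
      smul_mem' := by
        rintro t x ⟨K, hK⟩
        exact ⟨K, fun a n hn => by rw [map_smul, hK a n hn, smul_zero]⟩ }
  have hT : T = ⊤ := by
    refine S.gen T ⟨1, fun a n hn => S.vac a n hn⟩ ?_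
    rintro b m u ⟨K, hK⟩
    -- From index `2 - m` on, the anticommutator with the mode of index `m` vanishes, because `C k =
    -- 0` for `k > 1`.
    refine ⟨max K (2 - m), fun a n hn => ?_⟩
    have h := congrArg (fun Z : Module.End ℂ M => Z u) (S.anticomm a n b m)
    simp only [LinearMap.add_apply, Module.End.mul_apply] at h
    rw [hK a n (le_trans (le_max_left _ _) hn), map_zero, add_zero,
      S.modePairing_eq_zero (by have := le_trans (le_max_right _ _) hn; omega), zero_smul] at h
    exact h
  have : u ∈ T := hT ▸ Submodule.mem_top
  exact this

/-- The linear combination of the `ψ^b_n` with coefficients `y b`. -/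
noncomputable def lin (y : Fin 2 → ℂ) (n : ℤ) : Module.End ℂ M :=
  y 0 • S.ψ 0 n + y 1 • S.ψ 1 n

theorem lin_eq_zero_of {u : M} {n : ℤ} (h : ∀ a, S.ψ a n u = 0)
    (y : Fin 2 → ℂ) : S.lin y n u = 0 := by
  simp [lin, h]

theorem lin_add (y z : Fin 2 → ℂ) (n : ℤ) : S.lin (y + z) n = S.lin y n + S.lin z n := by
  simp only [lin, Pi.add_apply, add_smul]; abel

theorem lin_smul (t : ℂ) (y : Fin 2 → ℂ) (n : ℤ) : S.lin (t • y) n = t • S.lin y n := by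
  simp only [lin, Pi.smul_apply, smul_eq_mul, mul_smul, smul_add]

theorem lin_zero (n : ℤ) : S.lin 0 n = 0 := by
  simp [lin]

theorem lin_sum {ι : Type*} (s : Finset ι) (y : ι → Fin 2 → ℂ) (n : ℤ) :
    S.lin (∑ i ∈ s, y i) n = ∑ i ∈ s, S.lin (y i) n := by
  classical
  induction s using Finset.induction_on with
  | empty => simp [S.lin_zero]
  | insert i s hi ih => rw [Finset.sum_insert hi, Finset.sum_insert hi, S.lin_add, ih]

/-- The normally ordered product of `ψ^a_i` and `ψ^b_j` as an operator. -/
noncomputable def no (a : Fin 2) (i : ℤ) (b : Fin 2) (j : ℤ) : Module.End ℂ M :=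
  if i < j then S.ψ a i * S.ψ b j
  else if j < i then -(S.ψ b j * S.ψ a i)
  else (1 / 2 : ℂ) • (S.ψ a i * S.ψ b j) - (1 / 2 : ℂ) • (S.ψ b j * S.ψ a i)

theorem no_apply_eq_zero {a b : Fin 2} {i j : ℤ} {u : M} (hi : i < j → S.ψ b j u = 0)
    (hj : j < i → S.ψ a i u = 0) (h : i = j → S.ψ a i u = 0 ∧ S.ψ b j u = 0) :
    S.no a i b j u = 0 := by
  rcases lt_trichotomy i j with h1 | h1 | h1
  · rw [no, if_pos h1, Module.End.mul_apply, hi h1, map_zero]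
  · rw [no, if_neg h1.not_lt, if_neg (by omega)]
    simp [h h1]
  · rw [no, if_neg (by omega), if_pos h1, LinearMap.neg_apply, Module.End.mul_apply, hj h1,
      map_zero, neg_zero]

/-- The normally ordered product is the antisymmetrized product up to an explicit scalar. -/
theorem no_eq (a : Fin 2) (i : ℤ) (b : Fin 2) (j : ℤ) :
    S.no a i b j = (1 / 2 : ℂ) • (S.ψ a i * S.ψ b j - S.ψ b j * S.ψ a i)
      + ((1 / 2 * (if i < j then 1 else if j < i then -1 else 0) * modePairing C a i b j : ℂ))
        • (1 : Module.End ℂ M) := by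
  have h := S.anticomm a i b j
  rcases lt_trichotomy i j with h1 | h1 | h1
  · rw [no, if_pos h1, if_pos h1, mul_one, mul_smul, ← h]
    module
  · rw [no, if_neg h1.not_lt, if_neg (by omega), if_neg h1.not_lt, if_neg (by omega)]
    module
  · rw [no, if_neg (by omega), if_pos h1, if_neg (by omega), if_pos h1,
      show (1 / 2 * -1 * modePairing C a i b j : ℂ) = (-(1 / 2)) * modePairing C a i b j by ring,
      mul_smul, ← h]
    module

/-- Moving `z` through a product costs only scalars, so a quadratic expression acts on linear ones
by commutator. The factor `1 / 2` compensates the two orders. -/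
theorem antisymm_commutator (x y z : Module.End ℂ M) (s t : ℂ)
    (hx : x * z + z * x = s • (1 : Module.End ℂ M)) (hy : y * z + z * y = t • (1 : Module.End ℂ M)) :
    ((1 / 2 : ℂ) • (x * y - y * x)) * z - z * ((1 / 2 : ℂ) • (x * y - y * x))
      = t • x - s • y := by
  have h1 : z * x = s • (1 : Module.End ℂ M) - x * z := by rw [← hx]; abel
  have h2 : z * y = t • (1 : Module.End ℂ M) - y * z := by rw [← hy]; abel
  have e1 : z * (x * y) = s • y - t • x + x * y * z := by
    rw [← mul_assoc, h1, sub_mul, mul_assoc x z y, h2, mul_sub]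
    simp only [smul_mul_assoc, mul_smul_comm, one_mul, mul_one, mul_assoc]
    abel
  have e2 : z * (y * x) = t • x - s • y + y * x * z := by
    rw [← mul_assoc, h2, sub_mul, mul_assoc y z x, h1, mul_sub]
    simp only [smul_mul_assoc, mul_smul_comm, one_mul, mul_one, mul_assoc]
    abel
  rw [smul_mul_assoc, mul_smul_comm, mul_sub, e1, e2, sub_mul]
  module

/-- Normal ordering changes a product only by a scalar, which drops out of every commutator; hence
the answer does not see the order of `i` and `j`. -/
theorem no_commutator (a : Fin 2) (i : ℤ) (b : Fin 2) (j : ℤ) (e : Fin 2) (m : ℤ) :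
    S.no a i b j * S.ψ e m - S.ψ e m * S.no a i b j
      = modePairing C b j e m • S.ψ a i - modePairing C a i e m • S.ψ b j := by
  rw [no_eq, ← antisymm_commutator (S.ψ a i) (S.ψ b j) (S.ψ e m) _ _ (S.anticomm a i e m)
    (S.anticomm b j e m), add_mul, mul_add]
  simp only [smul_mul_assoc, mul_smul_comm, one_mul, mul_one]
  abel

theorem no_support (n : ℤ) (u : M) {K : ℤ} (hK : ∀ a m, K ≤ m → S.ψ a m u = 0) {i : ℤ}
    (hi : i ∉ Finset.Icc (n - K) K) : S.no 1 i 0 (n - i) u = 0 := by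
  rw [Finset.mem_Icc, not_and_or, not_le, not_le] at hi
  refine S.no_apply_eq_zero (fun h => hK _ _ ?_) (fun h => hK _ _ ?_)
    fun h => ⟨hK _ _ ?_, hK _ _ ?_⟩ <;> omega

theorem locFin_no (n : ℤ) : LocFin fun i : ℤ => S.no 1 i 0 (n - i) :=
  locFin_of_finset fun u => by
    obtain ⟨K, hK⟩ := S.smooth u
    exact ⟨_, fun i hi => S.no_support n u hK hi⟩

/-- The quadratic part of the Sugawara operator. -/
noncomputable def T (n : ℤ) : Module.End ℂ M := lfsum fun i : ℤ => S.no 1 i 0 (n - i)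

theorem locFin_conv (b : Fin 2) (r : ℤ → ℂ) (hr : ∀ k, 1 < k → r k = 0) (p : ℤ) :
    LocFin fun i : ℤ => r (p - i) • S.ψ b i :=
  locFin_of_finset fun u => by
    obtain ⟨K, hK⟩ := S.smooth u
    refine ⟨Finset.Icc (p - 1) K, fun i hi => ?_⟩
    rw [Finset.mem_Icc, not_and_or, not_le, not_le] at hi
    rcases hi with hi | hi
    · rw [hr _ (by omega), zero_smul]; rfl
    · rw [LinearMap.smul_apply, hK b i (by omega), smul_zero]

theorem locFin_delta (b : Fin 2) (p : ℤ) (t : ℂ) :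
    LocFin fun i : ℤ => (if i = p then t else 0) • S.ψ b i :=
  locFin_of_finset fun u => ⟨{p}, fun i hi => by
    rw [if_neg (by simpa using hi), zero_smul]; rfl⟩

theorem lfsum_delta (b : Fin 2) (p : ℤ) (t : ℂ) :
    lfsum (fun i : ℤ => (if i = p then t else 0) • S.ψ b i) = t • S.ψ b p := by
  rw [lfsum_eq_single p fun j hj => by rw [if_neg hj, zero_smul], if_pos rfl]

/-- The symplectic part of the pairing contributes the derivative term, in a single summand, and the
`C` part contributes the convolution with the connection matrix. -/
theorem T_commutator (n : ℤ) (a : Fin 2) (m : ℤ) :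
    S.T n * S.ψ a m - S.ψ a m * S.T n = -(m : ℂ) • S.ψ a (n + m)
      + (lfsum (fun i : ℤ => C (n + m - i) 0 a • S.ψ 1 i)
        - lfsum (fun i : ℤ => C (n + m - i) 1 a • S.ψ 0 i)) := by
  have hc : ∀ a b k, 1 < k → C k a b = 0 := fun a b k hk => by rw [S.cutoff k hk]; rfl
  rw [T, lfsum_commutator (S.locFin_no n)]
  simp only [S.no_commutator]
  have hX : ∀ i : ℤ, modePairing C 0 (n - i) a m • S.ψ 1 i
      = (if i = n + m then -(m : ℂ) * sympl 0 a else 0) • S.ψ 1 i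
        + C (n + m - i) 0 a • S.ψ 1 i := by
    intro i
    rw [← add_smul, modePairing, show n - i + m = n + m - i by ring]
    congr 2
    by_cases h : i = n + m
    · rw [if_pos (by omega), if_pos h, h]; push_cast; ring
    · rw [if_neg (by omega), if_neg h]
  -- The second sum runs over the partner index `n - i`; reflecting it makes both sums run over the
  -- index of the remaining mode.
  have hY : ∀ i : ℤ, modePairing C 1 i a m • S.ψ 0 (n - i)
      = (fun i : ℤ => (if i = n + m then -(m : ℂ) * sympl 1 a else 0) • S.ψ 0 i
        + C (n + m - i) 1 a • S.ψ 0 i) (Equiv.subLeft n i) := by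
    intro i
    simp only [Equiv.subLeft_apply]
    rw [← add_smul, modePairing, show n + m - (n - i) = i + m by ring]
    congr 2
    by_cases h : i + m = 0
    · rw [if_pos h, if_pos (by omega), show (i : ℂ) = -m by
        rw [eq_neg_iff_add_eq_zero]; exact_mod_cast h]
    · rw [if_neg h, if_neg (by omega)]
  have l1 := (S.locFin_delta 1 (n + m) (-(m : ℂ) * sympl 0 a)).add
    (S.locFin_conv 1 (fun k => C k 0 a) (hc 0 a) (n + m))
  have l2 := (S.locFin_delta 0 (n + m) (-(m : ℂ) * sympl 1 a)).add
    (S.locFin_conv 0 (fun k => C k 1 a) (hc 1 a) (n + m))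
  simp only [hX, hY]
  rw [lfsum_sub l1 (l2.comp_injective (Equiv.subLeft n).injective), lfsum_equiv l2,
    lfsum_add (S.locFin_delta _ _ _) (S.locFin_conv 1 (fun k => C k 0 a) (hc 0 a) (n + m)),
    lfsum_add (S.locFin_delta _ _ _) (S.locFin_conv 0 (fun k => C k 1 a) (hc 1 a) (n + m)),
    S.lfsum_delta, S.lfsum_delta]
  fin_cases a <;> simp [sympl] <;> abel

end FermionRep

/-! ### Formal eigen-sections of an irregular connection -/

section Recursion

/-- Course-of-values recursion in which the step takes a total function: the history is extended by
the default value `0` from `s` on. -/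
theorem exists_strong_recursion {α : Type*} [Zero α] (Φ : ℕ → (ℕ → α) → α) :
    ∃ f : ℕ → α, ∀ s, f s = Φ s fun j => if j < s then f j else 0 := by
  refine ⟨(Nat.lt_wfRel.wf).fix fun s ih => Φ s fun j => if h : j < s then ih j h else 0,
    fun s => ?_⟩
  rw [WellFounded.fix_eq]
  congr 1

/-- Formal solutions `f = ∑ f_s z^s` of
`∑ B_l z^{l-2} f + f' = (ξ z^{-2} + ε z^{-1}) f` with diagonal leading term. -/
theorem exists_formal_solution_diag (B : ℕ → Matrix (Fin 2) (Fin 2) ℂ) (ξ η ε : ℂ) (hξ : ξ ≠ η)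
    (h0 : B 0 = !![ξ, 0; 0, η]) (h1 : B 1 0 0 = ε) :
    ∃ f : ℕ → Fin 2 → ℂ, f 0 = ![1, 0] ∧ ∀ s, ∑ p ∈ Finset.HasAntidiagonal.antidiagonal s, (B p.2).mulVec (f p.1)
      = ξ • f s + (if s = 0 then 0 else (ε - ((s - 1 : ℕ) : ℂ)) • f (s - 1)) := by
  -- The second row of the equation of order `s` has leading term `(ξ - η) f_s`, which can be
  -- divided out.
  let y : ℕ → (ℕ → Fin 2 → ℂ) → ℂ := fun s h =>
    (ξ - η)⁻¹ * ((∑ l ∈ Finset.range s, (B (l + 1)).mulVec (h (s - 1 - l)) 1)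
      - (ε - ((s - 1 : ℕ) : ℂ)) * h (s - 1) 1)
  -- In the first row of order `s` the leading terms cancel, so `f s 0` is found from order `s + 1`
  -- instead. There `B 1 0 0 = ε` turns its coefficient `ε - (ε - s)` into `s`, which is invertible
  -- for `s > 0`.
  obtain ⟨f, hf⟩ := exists_strong_recursion (α := Fin 2 → ℂ) fun s h =>
    if s = 0 then ![1, 0] else
      ![-(s : ℂ)⁻¹ * (B 1 0 1 * y s h + ∑ l ∈ Finset.range s, (B (l + 2)).mulVec (h (s - 1 - l)) 0),
        y s h]
  have hf0 : f 0 = ![1, 0] := by rw [hf 0]; simp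
  have hsum : ∀ (s : ℕ) (g : ℕ → Matrix (Fin 2) (Fin 2) ℂ) (i : Fin 2),
      ∑ l ∈ Finset.range s, (g l).mulVec (if s - 1 - l < s then f (s - 1 - l) else 0) i
        = ∑ l ∈ Finset.range s, (g l).mulVec (f (s - 1 - l)) i := by
    intro s g i
    refine Finset.sum_congr rfl fun l hl => ?_
    rw [Finset.mem_range] at hl
    rw [if_pos (by omega)]
  have hy : ∀ s, s ≠ 0 → (ξ - η) * f s 1
      = (∑ l ∈ Finset.range s, (B (l + 1)).mulVec (f (s - 1 - l)) 1)
        - (ε - ((s - 1 : ℕ) : ℂ)) * f (s - 1) 1 := by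
    intro s hs
    rw [hf s, if_neg hs]
    simp only [y, Matrix.cons_val_one, Matrix.cons_val_zero]
    rw [if_pos (by omega : s - 1 < s), hsum s (fun l => B (l + 1)) 1, mul_inv_cancel_left₀ (sub_ne_zero.mpr hξ)]
  have hx : ∀ s : ℕ, s ≠ 0 → (s : ℂ) * f s 0
      = -(B 1 0 1 * f s 1 + ∑ l ∈ Finset.range s, (B (l + 2)).mulVec (f (s - 1 - l)) 0) := by
    intro s hs
    rw [hf s, if_neg hs]
    simp only [Matrix.cons_val_one, Matrix.cons_val_zero]
    rw [hsum s (fun l => B (l + 2)) 0, neg_mul, mul_neg,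
      mul_inv_cancel_left₀ (Nat.cast_ne_zero.mpr hs)]
  have hanti : ∀ s, ∑ p ∈ Finset.HasAntidiagonal.antidiagonal s, (B p.2).mulVec (f p.1)
      = (B 0).mulVec (f s) + ∑ l ∈ Finset.range s, (B (l + 1)).mulVec (f (s - 1 - l)) := by
    intro s
    rw [← Finset.Nat.sum_antidiagonal_swap]
    simp only [Prod.fst_swap, Prod.snd_swap]
    rw [Finset.Nat.sum_antidiagonal_eq_sum_range_succ fun i j => (B i).mulVec (f j),
      Finset.sum_range_succ', add_comm]
    congr 1
    refine Finset.sum_congr rfl fun l _ => ?_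
    rw [show s - (l + 1) = s - 1 - l by omega]
  refine ⟨f, hf0, fun s => ?_⟩
  rw [hanti, h0]
  rcases Nat.eq_zero_or_pos s with rfl | hs
  · rw [hf0]; ext i; fin_cases i <;> simp [Matrix.vecHead]
  · rw [if_neg (by omega)]
    ext i
    simp only [Pi.add_apply, Pi.smul_apply, smul_eq_mul, Finset.sum_apply]
    fin_cases i
    · simp only [Fin.zero_eta, Fin.isValue]
      obtain ⟨t, rfl⟩ : ∃ t, s = t + 1 := ⟨s - 1, by omega⟩
      have hB1 : (B 1).mulVec (f t) 0 = ε * f t 0 + B 1 0 1 * f t 1 := by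
        simp [Matrix.mulVec, dotProduct, Fin.sum_univ_two, h1]
      rw [Finset.sum_range_succ']
      simp only [Nat.add_sub_cancel, Nat.sub_zero, zero_add, add_assoc, Nat.reduceAdd]
      have e : ∑ l ∈ Finset.range t, (B (l + 2)).mulVec (f (t - (l + 1))) 0
          = ∑ l ∈ Finset.range t, (B (l + 2)).mulVec (f (t - 1 - l)) 0 :=
        Finset.sum_congr rfl fun l _ => by rw [show t - (l + 1) = t - 1 - l by omega]
      rw [hB1, e]
      have hlead : (!![ξ, 0; 0, η] : Matrix (Fin 2) (Fin 2) ℂ).mulVec (f (t + 1)) 0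
          = ξ * f (t + 1) 0 := by simp [Matrix.mulVec, Matrix.vecHead]
      rw [hlead]
      -- The first row of order `1` imposes a condition on `f 0` rather than determining it: it
      -- holds because the exponent is `ε` and `f 0 = ![1, 0]`.
      rcases Nat.eq_zero_or_pos t with rfl | ht
      · simp [hf0]
      · linear_combination hx t (by omega)
    · simp only [Fin.mk_one, Fin.isValue]
      have hlead : (!![ξ, 0; 0, η] : Matrix (Fin 2) (Fin 2) ℂ).mulVec (f s) 1
          = η * f s 1 := by simp [Matrix.mulVec, Matrix.vecHead, Matrix.vecTail]
      rw [hlead]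
      linear_combination -hy s (by omega)

/-- A constant change of frame by `P` reduces to a diagonal leading term. -/
theorem exists_formal_solution (B : ℕ → Matrix (Fin 2) (Fin 2) ℂ) (P Q : Matrix (Fin 2) (Fin 2) ℂ)
    (hPQ : P * Q = 1) (ξ η ε : ℂ) (hξ : ξ ≠ η) (h0 : Q * B 0 * P = !![ξ, 0; 0, η])
    (h1 : (Q * B 1 * P) 0 0 = ε) :
    ∃ f : ℕ → Fin 2 → ℂ, f 0 = P.mulVec ![1, 0] ∧
      ∀ s, ∑ p ∈ Finset.HasAntidiagonal.antidiagonal s, (B p.2).mulVec (f p.1)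
        = ξ • f s + (if s = 0 then 0 else (ε - ((s - 1 : ℕ) : ℂ)) • f (s - 1)) := by
  obtain ⟨f, hf0, hf⟩ := exists_formal_solution_diag (fun l => Q * B l * P) ξ η ε hξ h0 h1
  refine ⟨fun s => P.mulVec (f s), congrArg _ hf0, fun s => ?_⟩
  have h := congrArg P.mulVec (hf s)
  rw [Matrix.mulVec_sum] at h
  convert h using 1
  · refine Finset.sum_congr rfl fun p _ => ?_
    rw [Matrix.mulVec_mulVec, Matrix.mulVec_mulVec, ← Matrix.mul_assoc, ← Matrix.mul_assoc, hPQ,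
      Matrix.one_mul]
  · rw [Matrix.mulVec_add, Matrix.mulVec_smul]
    split_ifs
    · simp
    · rw [Matrix.mulVec_smul]

end Recursion

/-! ### Reindexing and rearranging locally finite sums -/

section

variable {M : Type*} [AddCommGroup M] [Module ℂ M]

theorem lfsum_eq_lfsum_nat {q : ℤ → Module.End ℂ M} (hq : LocFin q) (p : ℤ)
    (h : ∀ i, i < p → q i = 0) : lfsum q = lfsum fun l : ℕ => q (p + l) := by
  classical
  have hinj : Function.Injective fun l : ℕ => p + (l : ℤ) := fun a b hab => by
    simpa using hab
  have hq' := hq.comp_injective hinj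
  ext u
  obtain ⟨s, hs⟩ := hq'.exists_finset u
  rw [lfsum_apply_eq_sum hq' hs, lfsum_apply_eq_sum hq (s := s.image fun l : ℕ => p + (l : ℤ)),
    Finset.sum_image hinj.injOn]
  intro i hi
  by_cases hip : i < p
  · rw [h i hip]; rfl
  · obtain ⟨l, rfl⟩ : ∃ l : ℕ, i = p + l := ⟨(i - p).toNat, by omega⟩
    exact hs l fun hl => hi (Finset.mem_image_of_mem _ hl)

/-- On each vector only the triangle `j + l < R` contributes, so a double series may be summed along
antidiagonals, as in a Cauchy product. -/
theorem lfsum_lfsum_nat {X : ℕ → ℕ → Module.End ℂ M}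
    (h : ∀ u, ∃ R, ∀ j l, R ≤ j + l → X j l u = 0) :
    (LocFin fun j => lfsum fun l => X j l) ∧
    (LocFin fun s => ∑ p ∈ Finset.HasAntidiagonal.antidiagonal s, X p.1 p.2) ∧
    (lfsum fun j => lfsum fun l => X j l) = lfsum fun s => ∑ p ∈ Finset.HasAntidiagonal.antidiagonal s, X p.1 p.2 := by
  have h1 : ∀ j, LocFin fun l => X j l := fun j => locFin_of_finset fun u => by
    obtain ⟨R, hR⟩ := h u
    exact ⟨Finset.range R, fun l hl => hR j l (by rw [Finset.mem_range] at hl; omega)⟩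
  have h2 : LocFin fun j => lfsum fun l => X j l := locFin_of_finset fun u => by
    obtain ⟨R, hR⟩ := h u
    exact ⟨Finset.range R, fun j hj => lfsum_apply_eq_zero (h1 j) fun l => hR j l
      (by rw [Finset.mem_range] at hj; omega)⟩
  have h3 : LocFin fun s => ∑ p ∈ Finset.HasAntidiagonal.antidiagonal s, X p.1 p.2 := locFin_of_finset fun u => by
    obtain ⟨R, hR⟩ := h u
    refine ⟨Finset.range R, fun s hs => ?_⟩
    rw [LinearMap.sum_apply]
    refine Finset.sum_eq_zero fun p hp => hR _ _ ?_
    rw [Finset.HasAntidiagonal.mem_antidiagonal] at hp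
    rw [Finset.mem_range] at hs
    omega
  refine ⟨h2, h3, ?_⟩
  ext u
  obtain ⟨R, hR⟩ := h u
  rw [lfsum_apply_eq_sum h2 (s := Finset.range R), lfsum_apply_eq_sum h3 (s := Finset.range R)]
  · have e1 : ∀ s ∈ Finset.range R, (∑ p ∈ Finset.HasAntidiagonal.antidiagonal s, X p.1 p.2) u
        = ∑ k ∈ Finset.range (s + 1), X k (s - k) u := by
      intro s _
      rw [LinearMap.sum_apply]
      exact Finset.Nat.sum_antidiagonal_eq_sum_range_succ (fun i j => X i j u) s
    rw [Finset.sum_congr rfl e1, Finset.sum_range_diag_flip R fun j l => X j l u]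
    refine Finset.sum_congr rfl fun j _ => lfsum_apply_eq_sum (h1 j) fun l hl => hR _ _ ?_
    rw [Finset.mem_range] at hl
    omega
  · intro s hs
    rw [LinearMap.sum_apply]
    refine Finset.sum_eq_zero fun p hp => hR _ _ ?_
    rw [Finset.HasAntidiagonal.mem_antidiagonal] at hp
    rw [Finset.mem_range] at hs
    omega
  · intro j hj
    exact lfsum_apply_eq_zero (h1 j) fun l => hR j l (by rw [Finset.mem_range] at hj; omega)

end

/-! ### Modes attached to formal sections -/

/-- The coefficients of the connection, indexed by the order above the leading one. -/
def connCoeff (C : ℤ → Matrix (Fin 2) (Fin 2) ℂ) (l : ℕ) : Matrix (Fin 2) (Fin 2) ℂ :=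
  !![0, 1; -1, 0] * C (1 - l)

namespace FermionRep

variable {C : ℤ → Matrix (Fin 2) (Fin 2) ℂ} {M : Type*} [AddCommGroup M] [Module ℂ M]
  (S : FermionRep C M)

theorem locFin_lin (f : ℕ → Fin 2 → ℂ) (m : ℤ) : LocFin fun j : ℕ => S.lin (f j) (m + j) := by
  refine locFin_of_finset fun u => ?_
  obtain ⟨K, hK⟩ := S.smooth u
  refine ⟨Finset.range (K - m).toNat, fun j hj => S.lin_eq_zero_of (fun a => hK a _ ?_) _⟩
  rw [Finset.mem_range] at hj
  omega

/-- In terms of vectors this says that `[T n, ·]` acts on `z^m y` as `-z^(n+1) ∇`. The matrix in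
`connCoeff` undoes the symplectic matrix hidden in `C`. -/
theorem lin_commutator (n : ℤ) (y : Fin 2 → ℂ) (m : ℤ) :
    S.T n * S.lin y m - S.lin y m * S.T n = -(m : ℂ) • S.lin y (n + m)
      - lfsum fun l : ℕ => S.lin ((connCoeff C l).mulVec y) (n + m - 1 + l) := by
  have hc : ∀ a b k, 1 < k → C k a b = 0 := fun a b k hk => by rw [S.cutoff k hk]; rfl
  have key : ∀ a b, lfsum (fun i : ℤ => C (n + m - i) b a • S.ψ (1 - b) i)
      = lfsum fun l : ℕ => C (1 - l) b a • S.ψ (1 - b) (n + m - 1 + l) := by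
    intro a b
    rw [lfsum_eq_lfsum_nat (S.locFin_conv (1 - b) (fun k => C k b a) (hc b a) (n + m)) (n + m - 1)
      fun i hi => by rw [hc b a _ (by omega), zero_smul]]
    congr 1
    funext l
    rw [show n + m - (n + m - 1 + l) = 1 - (l : ℤ) by ring]
  have hl : ∀ (r : ℕ → ℂ) b, LocFin fun l : ℕ => r l • S.ψ b (n + m - 1 + l) := by
    intro r b
    have h : SmoothModes (S.ψ b) := fun u => by
      obtain ⟨K, hK⟩ := S.smooth u
      exact ⟨K, fun n hn => hK b n hn⟩
    exact (h.locFin (n + m - 1)).smul r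
  have key0 := fun a => key a 0
  have key1 := fun a => key a 1
  simp only [sub_zero, sub_self] at key0 key1
  have hT := fun a => S.T_commutator n a m
  simp only [key0, key1] at hT
  have e : ∀ l : ℕ, S.lin ((connCoeff C l).mulVec y) (n + m - 1 + l)
      = y 0 • (C (1 - l) 1 0 • S.ψ 0 (n + m - 1 + l) - C (1 - l) 0 0 • S.ψ 1 (n + m - 1 + l))
        + y 1 • (C (1 - l) 1 1 • S.ψ 0 (n + m - 1 + l)
          - C (1 - l) 0 1 • S.ψ 1 (n + m - 1 + l)) := by
    intro l
    simp only [lin, connCoeff, Matrix.mulVec, dotProduct, Fin.sum_univ_two, Matrix.mul_apply,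
      Matrix.of_apply, Matrix.cons_val', Matrix.cons_val_zero, Matrix.cons_val_one,
      Matrix.cons_val_fin_one]
    module
  have hs : ∀ a, LocFin fun l : ℕ => C (1 - l) 1 a • S.ψ 0 (n + m - 1 + l)
      - C (1 - l) 0 a • S.ψ 1 (n + m - 1 + l) :=
    fun a => (hl (fun l => C (1 - l) 1 a) 0).sub (hl (fun l => C (1 - l) 0 a) 1)
  simp only [e]
  rw [lfsum_add ((hs 0).smul fun _ => y 0) ((hs 1).smul fun _ => y 1), lfsum_smul (hs 0),
    lfsum_smul (hs 1), lfsum_sub (hl (fun l => C (1 - l) 1 0) 0) (hl (fun l => C (1 - l) 0 0) 1),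
    lfsum_sub (hl (fun l => C (1 - l) 1 1) 0) (hl (fun l => C (1 - l) 0 1) 1)]
  have e2 : S.T n * S.lin y m - S.lin y m * S.T n
      = y 0 • (S.T n * S.ψ 0 m - S.ψ 0 m * S.T n)
        + y 1 • (S.T n * S.ψ 1 m - S.ψ 1 m * S.T n) := by
    simp only [lin, mul_add, add_mul, smul_mul_assoc, mul_smul_comm, smul_sub]
    abel
  rw [e2, hT 0, hT 1, lin]
  module

/-- The mode `∑_j f_j ψ_{m+j}` attached to `z^m f(z)`. -/
noncomputable def ser (f : ℕ → Fin 2 → ℂ) (m : ℤ) : Module.End ℂ M :=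
  lfsum fun j : ℕ => S.lin (f j) (m + j)

theorem ser_eq_zero_of {u : M} {K : ℤ} (hK : ∀ a n, K ≤ n → S.ψ a n u = 0) (f : ℕ → Fin 2 → ℂ)
    {m : ℤ} (hm : K ≤ m) : S.ser f m u = 0 :=
  lfsum_apply_eq_zero (S.locFin_lin f m) fun j => S.lin_eq_zero_of (fun a => hK a _ (by omega)) _

theorem ser_smooth (f : ℕ → Fin 2 → ℂ) : SmoothModes (S.ser f) := fun u => by
  obtain ⟨K, hK⟩ := S.smooth u
  exact ⟨K, fun n hn => S.ser_eq_zero_of hK f hn⟩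

theorem ser_add (f g : ℕ → Fin 2 → ℂ) (m : ℤ) : S.ser (f + g) m = S.ser f m + S.ser g m := by
  rw [ser, ser, ser, ← lfsum_add (S.locFin_lin f m) (S.locFin_lin g m)]
  simp only [Pi.add_apply, S.lin_add]

theorem ser_smul (t : ℂ) (f : ℕ → Fin 2 → ℂ) (m : ℤ) : S.ser (t • f) m = t • S.ser f m := by
  rw [ser, ser, ← lfsum_smul (S.locFin_lin f m)]
  simp only [Pi.smul_apply, S.lin_smul]

theorem ser_succ (f : ℕ → Fin 2 → ℂ) (m : ℤ) :
    S.ser f m = S.lin (f 0) m + S.ser (fun j => f (j + 1)) (m + 1) := by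
  ext u
  obtain ⟨s, hs⟩ := (S.locFin_lin f m).exists_finset u
  obtain ⟨K, hK⟩ := S.smooth u
  rw [LinearMap.add_apply, ser, ser,
    lfsum_apply_eq_sum (S.locFin_lin f m) (s := Finset.range ((K - m).toNat + 1)),
    lfsum_apply_eq_sum (S.locFin_lin _ _) (s := Finset.range (K - m).toNat),
    Finset.sum_range_succ', add_comm]
  · congr 1
    · simp
    · refine Finset.sum_congr rfl fun j _ => ?_
      rw [show m + ((j + 1 : ℕ) : ℤ) = m + 1 + j by push_cast; ring]
  · intro j hj
    rw [Finset.mem_range] at hj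
    exact S.lin_eq_zero_of (fun a => hK a _ (by omega)) _
  · intro j hj
    rw [Finset.mem_range] at hj
    exact S.lin_eq_zero_of (fun a => hK a _ (by omega)) _

/-- The formula `-z^(n+1) ∇` extended to power series: differentiation multiplies coefficients by
their exponents, and the connection acts by a Cauchy product. -/
theorem ser_commutator (n : ℤ) (f : ℕ → Fin 2 → ℂ) (m : ℤ) :
    S.T n * S.ser f m - S.ser f m * S.T n
      = S.ser (fun j => -((m : ℂ) + j) • f j) (n + m)
        - S.ser (fun s => ∑ p ∈ Finset.HasAntidiagonal.antidiagonal s, (connCoeff C p.2).mulVec (f p.1)) (n + m - 1) := by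
  have h := lfsum_commutator (S.locFin_lin f m) (S.T n)
  have hX : ∀ u : M, ∃ R : ℕ, ∀ j l, R ≤ j + l →
      S.lin ((connCoeff C l).mulVec (f j)) (n + m - 1 + (j + l : ℕ)) u = 0 := by
    intro u
    obtain ⟨K, hK⟩ := S.smooth u
    exact ⟨(K - (n + m - 1)).toNat, fun j l hjl => S.lin_eq_zero_of (fun a => hK a _ (by omega)) _⟩
  obtain ⟨h1, h2, h3⟩ := lfsum_lfsum_nat hX
  have e1 : ∀ j : ℕ, S.lin (f j) (m + j) * S.T n - S.T n * S.lin (f j) (m + j)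
      = -(S.lin (-((m : ℂ) + j) • f j) (n + m + j)
        - lfsum fun l : ℕ => S.lin ((connCoeff C l).mulVec (f j)) (n + m - 1 + (j + l : ℕ))) := by
    intro j
    have := S.lin_commutator n (f j) (m + j)
    rw [S.lin_smul, neg_sub, ← neg_sub (S.T n * _), this, neg_sub]
    push_cast
    simp only [show n + (m + (j : ℤ)) = n + m + j by ring,
      show ∀ l : ℕ, n + m + (j : ℤ) - 1 + l = n + m - 1 + (j + l) from fun l => by ring]
  have e2 : ∀ s : ℕ, S.lin (∑ p ∈ Finset.HasAntidiagonal.antidiagonal s, (connCoeff C p.2).mulVec (f p.1))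
      (n + m - 1 + s) = ∑ p ∈ Finset.HasAntidiagonal.antidiagonal s,
        S.lin ((connCoeff C p.2).mulVec (f p.1)) (n + m - 1 + (p.1 + p.2 : ℕ)) := by
    intro s
    rw [S.lin_sum]
    refine Finset.sum_congr rfl fun p hp => ?_
    rw [Finset.HasAntidiagonal.mem_antidiagonal.mp hp]
  have l1 := S.locFin_lin (fun j => -((m : ℂ) + j) • f j) (n + m)
  rw [← neg_sub, ser, h]
  simp only [e1]
  rw [lfsum_neg (l1.sub h1), neg_neg, lfsum_sub l1 h1, h3, ser, ser]
  simp only [e2]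

/-- `f` is a formal horizontal section of `∂ + A - ξ z⁻² - ε z⁻¹`. -/
def IsEigenSection (C : ℤ → Matrix (Fin 2) (Fin 2) ℂ) (ξ ε : ℂ) (f : ℕ → Fin 2 → ℂ) : Prop :=
  ∀ s, ∑ p ∈ Finset.HasAntidiagonal.antidiagonal s, (connCoeff C p.2).mulVec (f p.1)
    = ξ • f s + (if s = 0 then 0 else (ε - ((s - 1 : ℕ) : ℂ)) • f (s - 1))

/-- For an eigen-section `∇ (z^m f) = ((m + ε) z⁻¹ + ξ z⁻²) z^m f`, so the modes of `f` are permuted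
among themselves up to scalars: the terms with `f'` cancel. -/
theorem ser_commutator_of_isEigenSection {ξ ε : ℂ} {f : ℕ → Fin 2 → ℂ}
    (hf : IsEigenSection C ξ ε f) (n m : ℤ) :
    S.T n * S.ser f m - S.ser f m * S.T n
      = -((m : ℂ) + ε) • S.ser f (n + m) - ξ • S.ser f (n + m - 1) := by
  rw [S.ser_commutator]
  have e : (fun s => ∑ p ∈ Finset.HasAntidiagonal.antidiagonal s, (connCoeff C p.2).mulVec (f p.1))
      = ξ • f + fun s => if s = 0 then 0 else (ε - ((s - 1 : ℕ) : ℂ)) • f (s - 1) := by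
    funext s; exact hf s
  rw [e, S.ser_add, S.ser_smul, S.ser_succ (fun s => if s = 0 then 0 else _), if_pos rfl,
    S.lin_zero, zero_add, sub_add_cancel]
  have e2 : (fun j : ℕ => if j + 1 = 0 then (0 : Fin 2 → ℂ)
      else (ε - ((j + 1 - 1 : ℕ) : ℂ)) • f (j + 1 - 1))
      = ((m : ℂ) + ε) • f + fun j : ℕ => -((m : ℂ) + j) • f j := by
    funext j
    rw [if_neg (Nat.succ_ne_zero j)]
    simp only [Nat.add_sub_cancel, Pi.add_apply, Pi.smul_apply]
    module
  rw [e2, S.ser_add, S.ser_smul]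
  module

/-- The leading coefficient of the pairing of two series of modes. -/
noncomputable def leadPairing (C : ℤ → Matrix (Fin 2) (Fin 2) ℂ) (y z : Fin 2 → ℂ) : ℂ :=
  y ⬝ᵥ (C 1).mulVec z

theorem lin_anticomm (y z : Fin 2 → ℂ) (m n : ℤ) :
    S.lin y m * S.lin z n + S.lin z n * S.lin y m
      = (y 0 * z 0 * modePairing C 0 m 0 n + y 0 * z 1 * modePairing C 0 m 1 n
        + y 1 * z 0 * modePairing C 1 m 0 n + y 1 * z 1 * modePairing C 1 m 1 n)
        • (1 : Module.End ℂ M) := by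
  simp only [add_smul, mul_smul, ← S.anticomm, lin]
  simp only [add_mul, mul_add, smul_mul_assoc, mul_smul_comm]
  module

theorem lin_anticomm_of_lt (y z : Fin 2 → ℂ) {m n : ℤ} (h : 1 < m + n) :
    S.lin y m * S.lin z n + S.lin z n * S.lin y m = 0 := by
  rw [S.lin_anticomm]
  simp [S.modePairing_eq_zero h]

theorem lin_anticomm_of_eq (y z : Fin 2 → ℂ) {m n : ℤ} (h : m + n = 1) :
    S.lin y m * S.lin z n + S.lin z n * S.lin y m
      = leadPairing C y z • (1 : Module.End ℂ M) := by
  rw [S.lin_anticomm]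
  congr 1
  simp only [modePairing, h, leadPairing, Matrix.mulVec, dotProduct, Fin.sum_univ_two]
  simp
  ring

theorem lin_ser_anticomm (y : Fin 2 → ℂ) (g : ℕ → Fin 2 → ℂ) {m n : ℤ} (h : 1 ≤ m + n) :
    S.lin y m * S.ser g n + S.ser g n * S.lin y m
      = (if m + n = 1 then leadPairing C y (g 0) else 0) • (1 : Module.End ℂ M) := by
  rw [add_comm, ser, lfsum_anticommutator (S.locFin_lin g n), lfsum_eq_single 0]
  · rw [add_comm]
    simp only [Nat.cast_zero, add_zero]
    split_ifs with h1
    · exact S.lin_anticomm_of_eq y (g 0) h1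
    · rw [zero_smul]; exact S.lin_anticomm_of_lt y (g 0) (by omega)
  · intro j hj
    rw [add_comm]
    exact S.lin_anticomm_of_lt _ _ (by omega)

/-- When `m + n ≥ 1`, every pair of coefficients other than the two leading ones has index sum above
`1`, where the pairing vanishes. -/
theorem ser_anticomm (f g : ℕ → Fin 2 → ℂ) {m n : ℤ} (h : 1 ≤ m + n) :
    S.ser f m * S.ser g n + S.ser g n * S.ser f m
      = (if m + n = 1 then leadPairing C (f 0) (g 0) else 0) • (1 : Module.End ℂ M) := by
  rw [show S.ser f m = lfsum fun j : ℕ => S.lin (f j) (m + j) from rfl]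
  rw [lfsum_anticommutator (S.locFin_lin f m), lfsum_eq_single 0]
  · simp only [Nat.cast_zero, add_zero]
    exact S.lin_ser_anticomm (f 0) g h
  · intro j hj
    rw [S.lin_ser_anticomm _ _ (by omega), if_neg (by omega), zero_smul]

/-- For small `m + n` many coefficients interact and the value is not computed; only its being a
scalar is needed, because derivations determine it later. -/
theorem ser_anticomm_scalar (f g : ℕ → Fin 2 → ℂ) (m n : ℤ) :
    ∃ t : ℂ, S.ser f m * S.ser g n + S.ser g n * S.ser f m = t • (1 : Module.End ℂ M) := by
  have h1 : ∀ y p, ∃ t : ℂ, S.lin y p * S.ser g n + S.ser g n * S.lin y p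
      = t • (1 : Module.End ℂ M) := by
    intro y p
    have l := S.locFin_lin g n
    rw [add_comm, ser, lfsum_anticommutator l]
    exact lfsum_scalar ((l.mul_right _).add (l.mul_left _)) fun j => ⟨_, S.lin_anticomm _ _ _ _⟩
  have l := S.locFin_lin f m
  rw [show S.ser f m = lfsum fun j : ℕ => S.lin (f j) (m + j) from rfl]
  rw [lfsum_anticommutator l]
  exact lfsum_scalar ((l.mul_right _).add (l.mul_left _)) fun j => h1 _ _

end FermionRep

/-! ### Ghost systems: determining anticommutators, twisted integration -/

/-- A cyclic vacuum representation of the fermionic ghost algebra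
`{d_m, c_n} = δ_{m+n,1}`, `{c_m, c_n} = {d_m, d_n} = 0`. -/
structure BCSystem (M : Type*) [AddCommGroup M] [Module ℂ M] where
  c : ℤ → Module.End ℂ M
  d : ℤ → Module.End ℂ M
  cc : ∀ m n, c m * c n + c n * c m = 0
  dd : ∀ m n, d m * d n + d n * d m = 0
  dc : ∀ m n, d m * c n + c n * d m = (if m + n = 1 then (1 : ℂ) else 0) • (1 : Module.End ℂ M)
  smooth_c : SmoothModes c
  smooth_d : SmoothModes d
  v : M
  v_ne : v ≠ 0
  vac_c : ∀ n, 1 ≤ n → c n v = 0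
  vac_d : ∀ n, 1 ≤ n → d n v = 0
  gen : ∀ W : Submodule ℂ M, v ∈ W → (∀ n, ∀ u ∈ W, c n u ∈ W) → (∀ n, ∀ u ∈ W, d n u ∈ W) →
    W = ⊤

section

variable {M : Type*} [AddCommGroup M] [Module ℂ M]

theorem lfsum_nat_succ {q : ℕ → Module.End ℂ M} (hq : LocFin q) :
    lfsum q = q 0 + lfsum fun j => q (j + 1) := by
  have hq' : LocFin fun j => q (j + 1) := hq.comp_injective fun a b h => by simpa using h
  ext u
  obtain ⟨s, hs⟩ := hq.exists_finset u
  obtain ⟨R, hR⟩ : ∃ R : ℕ, ∀ j, R ≤ j → q j u = 0 := by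
    obtain ⟨R, hR⟩ := s.bddAbove
    exact ⟨R + 1, fun j hj => hs j fun h => by have := hR h; omega⟩
  rw [LinearMap.add_apply, lfsum_apply_eq_sum hq (s := Finset.range (R + 1)) fun j hj =>
    hR j (by rw [Finset.mem_range] at hj; omega), lfsum_apply_eq_sum hq' (s := Finset.range R)
    fun j hj => hR _ (by rw [Finset.mem_range] at hj; omega), Finset.sum_range_succ', add_comm]

theorem eq_zero_of_smul_one_eq_zero [Nontrivial M] {t : ℂ}
    (h : t • (1 : Module.End ℂ M) = 0) : t = 0 := by
  obtain ⟨u, hu⟩ := exists_ne (0 : M)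
  have := congrArg (fun Z : Module.End ℂ M => Z u) h
  simp only [LinearMap.smul_apply, Module.End.one_apply, LinearMap.zero_apply] at this
  exact (smul_eq_zero.mp this).resolve_right hu

/-- The derivation `[T, ·]` applied to a scalar anticommutator. -/
theorem anticomm_recursion [Nontrivial M] {x y : ℤ → Module.End ℂ M} {r : ℤ → ℤ → ℂ}
    (hr : ∀ m n, x m * y n + y n * x m = r m n • (1 : Module.End ℂ M)) {T : Module.End ℂ M}
    {m n m₁ m₂ n₁ n₂ : ℤ} {a b a' b' : ℂ}
    (hx : T * x m - x m * T = a • x m₁ + b • x m₂)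
    (hy : T * y n - y n * T = a' • y n₁ + b' • y n₂) :
    a * r m₁ n + b * r m₂ n + a' * r m n₁ + b' * r m n₂ = 0 := by
  have h0 : T * (x m * y n + y n * x m) - (x m * y n + y n * x m) * T
      = (T * x m - x m * T) * y n + x m * (T * y n - y n * T) + (T * y n - y n * T) * x m
        + y n * (T * x m - x m * T) := by noncomm_ring
  rw [hr, hx, hy] at h0
  refine eq_zero_of_smul_one_eq_zero (M := M) ?_
  simp only [add_smul, mul_smul, ← hr]
  simp only [mul_smul_comm, smul_mul_assoc, mul_one, one_mul, sub_self, mul_add, add_mul] at h0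
  rw [h0]
  module

/-- Scalar anticommutators of modes with themselves vanish if they are compatible with
derivations of nonzero leading coefficient. -/
theorem anticomm_self_eq_zero {r : ℤ → ℤ → ℂ} {ξ : ℂ} (hξ : ξ ≠ 0) {α : ℤ → ℤ → ℂ}
    (h : ∀ k m n, α k m * r (k + m) n + ξ * r (k + m - 1) n + α k n * r m (k + n)
      + ξ * r m (k + n - 1) = 0)
    (h2 : ∀ m n, 2 ≤ m + n → r m n = 0) (m n : ℤ) : r m n = 0 := by
  have key : ∀ j : ℕ, ∀ m n : ℤ, 2 ≤ m + n + j → r m n = 0 := by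
    intro j
    induction j with
    | zero => intro m n hmn; exact h2 m n (by simpa using hmn)
    | succ j ih =>
      intro m n hmn
      push_cast at hmn
      -- For `k = 1` the two terms of higher index sum vanish by induction, and the other two both
      -- equal `ξ * r m n`.
      have := h 1 m n
      rw [ih (1 + m) n (by linarith), ih m (1 + n) (by linarith),
        show 1 + m - 1 = m by ring, show 1 + n - 1 = n by ring] at this
      have h3 : ξ * r m n = 0 := by linear_combination this / 2
      exact (mul_eq_zero.mp h3).resolve_left hξ
  exact key (2 - (m + n)).toNat m n (by omega)

/-- Scalar anticommutators of the modes `d_m` and `c_n` are determined by compatibility with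
derivations of nonzero leading coefficient. -/
theorem anticomm_pair_eq {r : ℤ → ℤ → ℂ} {ξ ε : ℂ} (hξ : ξ ≠ 0)
    (h : ∀ k m n : ℤ, (ε - (k + m - 1)) * r (k + m) n + ξ * r (k + m - 1) n
      + (-(n + ε)) * r m (k + n) + (-ξ) * r m (k + n - 1) = 0)
    (h1 : ∀ m n, m + n = 1 → r m n = 1) (h2 : ∀ m n, 2 ≤ m + n → r m n = 0) (m n : ℤ) :
    r m n = if m + n = 1 then 1 else 0 := by
  -- On the line `m + n = 1 - j` the scalars are constant, with value `R` satisfying `j * R = 0`.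
  -- The recursion couples each line only to the next lower one.
  have key : ∀ j : ℕ, ∃ R : ℂ, (∀ m n : ℤ, m + n = 1 - j → r m n = R) ∧ (j : ℂ) * R = 0 := by
    intro j
    induction j with
    | zero => exact ⟨1, fun m n hmn => h1 m n (by simpa using hmn), by simp⟩
    | succ j ih =>
      obtain ⟨R, hR, hR0⟩ := ih
      have hconst : ∀ x y x' y' : ℤ, x + y = -j → x' + y' = -j → r x y = r x' y' := by
        intro x y x' y' hxy hxy'
        -- This value of `k` moves `(x', y)` to `(x, y)` in one term and to `(x', y')` in the other.
        -- The terms from the line above add up to `j * R`, which is zero.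
        have := h (x - x' + 1) x' y
        rw [hR (x - x' + 1 + x') y (by linarith), hR x' (x - x' + 1 + y) (by linarith),
          show x - x' + 1 + x' - 1 = x by ring,
          show x - x' + 1 + y - 1 = y' by linarith] at this
        push_cast at this
        have e : (x : ℂ) + y = -j := by exact_mod_cast hxy
        have h3 : ξ * (r x y - r x' y') = 0 := by
          linear_combination this - hR0 + R * e
        exact sub_eq_zero.mp ((mul_eq_zero.mp h3).resolve_left hξ)
      refine ⟨r 0 (-j), fun m n hmn => hconst _ _ _ _ (by push_cast at hmn; linarith) (by simp),
        ?_⟩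
      -- Constancy on the new line is known by now, so the terms with `ξ` cancel and those left give
      -- `(j + 1)` times the value on that line.
      have := h 1 0 (-j - 1)
      rw [hconst (1 + 0) (-j - 1) 0 (-j) (by ring) (by ring),
        show (1 : ℤ) + (-j - 1) = -j by ring, show (-j : ℤ) - 1 = -j - 1 from rfl,
        show (1 : ℤ) + 0 - 1 = 0 by ring] at this
      push_cast at this ⊢
      linear_combination this
  split_ifs with hmn
  · exact h1 m n hmn
  · rcases lt_or_ge 1 (m + n) with h3 | h3
    · exact h2 m n (by omega)
    · obtain ⟨R, hR, hR0⟩ := key (1 - (m + n)).toNat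
      rw [hR m n (by omega)]
      refine (mul_eq_zero.mp hR0).resolve_left (Nat.cast_ne_zero.mpr (by omega))

/-- The coefficients of the solution `d` of `y_n = (ε - n) d_{n+1} + ξ d_n`. -/
noncomputable def ghostCoeff (ξ ε : ℂ) (n : ℤ) (j : ℕ) : ℂ :=
  (ξ⁻¹) ^ (j + 1) * ∏ i ∈ Finset.range j, ((n : ℂ) + i - ε)

theorem ghostCoeff_succ (ξ ε : ℂ) (n : ℤ) (j : ℕ) :
    ghostCoeff ξ ε n (j + 1) = ξ⁻¹ * ((n : ℂ) - ε) * ghostCoeff ξ ε (n + 1) j := by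
  rw [ghostCoeff, ghostCoeff, Finset.prod_range_succ', pow_succ]
  have : ∀ i ∈ Finset.range j, (n : ℂ) + ((i + 1 : ℕ) : ℂ) - ε = ((n + 1 : ℤ) : ℂ) + i - ε :=
    fun i _ => by push_cast; ring
  rw [Finset.prod_congr rfl this]
  push_cast
  ring

/-- The solution `d` of `y_n = (ε - n) d_{n+1} + ξ d_n`. -/
noncomputable def ghost (ξ ε : ℂ) (y : ℤ → Module.End ℂ M) (n : ℤ) : Module.End ℂ M :=
  lfsum fun j : ℕ => ghostCoeff ξ ε n j • y (n + j)

/-- The equation is solved for `ghost ξ ε y n` by dividing by `ξ` and iterating upwards. The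
resulting infinite series is meaningful because `y` is smooth. -/
theorem ghost_recursion {ξ ε : ℂ} (hξ : ξ ≠ 0) {y : ℤ → Module.End ℂ M} (hy : SmoothModes y)
    (n : ℤ) : y n = (ε - n) • ghost ξ ε y (n + 1) + ξ • ghost ξ ε y n := by
  have l := (hy.locFin n).smul (ghostCoeff ξ ε n)
  have l' := (hy.locFin (n + 1)).smul (ghostCoeff ξ ε (n + 1))
  have e : ghost ξ ε y n
      = ξ⁻¹ • y n + (ξ⁻¹ * ((n : ℂ) - ε)) • ghost ξ ε y (n + 1) := by
    rw [ghost, lfsum_nat_succ l, ghost, ← lfsum_smul l']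
    congr 1
    · simp [ghostCoeff]
    · congr 1
      funext j
      rw [ghostCoeff_succ, mul_smul, show n + ((j + 1 : ℕ) : ℤ) = n + 1 + j by push_cast; ring]
  rw [e, smul_add, smul_smul, smul_smul, mul_inv_cancel₀ hξ, mul_inv_cancel_left₀ hξ]
  module

theorem ghost_apply_eq_zero {ξ ε : ℂ} {y : ℤ → Module.End ℂ M} (hy : SmoothModes y) {u : M}
    {K : ℤ} (hK : ∀ n, K ≤ n → y n u = 0) {n : ℤ} (hn : K ≤ n) : ghost ξ ε y n u = 0 :=
  lfsum_apply_eq_zero ((hy.locFin n).smul _) fun j => by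
    rw [LinearMap.smul_apply, hK _ (by omega), smul_zero]

theorem ghost_smooth {ξ ε : ℂ} {y : ℤ → Module.End ℂ M} (hy : SmoothModes y) :
    SmoothModes (ghost ξ ε y) := fun u => by
  obtain ⟨K, hK⟩ := hy u
  exact ⟨K, fun n hn => ghost_apply_eq_zero hy hK hn⟩

/-- The difference of the two sides is smooth and satisfies a homogeneous first order recursion in
`n`, hence vanishes. So the derivation returns the modes that were integrated. -/
theorem ghost_commutator {ξ ε : ℂ} (hξ : ξ ≠ 0) {y : ℤ → Module.End ℂ M} (hy : SmoothModes y)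
    {T : Module.End ℂ M} {k : ℤ}
    (hT : ∀ n, T * y n - y n * T = (ε - n) • y (k + n) + ξ • y (k + n - 1)) (n : ℤ) :
    T * ghost ξ ε y n - ghost ξ ε y n * T = y (k + n - 1) := by
  rw [← sub_eq_zero]
  refine SmoothModes.eq_zero_of_recursion
    (x := fun n => T * ghost ξ ε y n - ghost ξ ε y n * T - y (k + n - 1))
    (a := fun n => -ξ⁻¹ * (ε - n)) ?_ ?_ n
  · intro u
    obtain ⟨K₁, h₁⟩ := ghost_smooth (ξ := ξ) (ε := ε) hy u
    obtain ⟨K₂, h₂⟩ := ghost_smooth (ξ := ξ) (ε := ε) hy (T u)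
    obtain ⟨K₃, h₃⟩ := hy u
    refine ⟨max K₁ (max K₂ (K₃ - k + 1)), fun n hn => ?_⟩
    simp only [max_le_iff] at hn
    simp only [LinearMap.sub_apply, Module.End.mul_apply]
    rw [h₁ n hn.1, h₂ n hn.2.1, h₃ _ (by omega)]
    simp
  · intro n
    have h := hT n
    have e := ghost_recursion (ε := ε) hξ hy n
    have e' : T * y n - y n * T
        = (ε - n) • (T * ghost ξ ε y (n + 1) - ghost ξ ε y (n + 1) * T)
          + ξ • (T * ghost ξ ε y n - ghost ξ ε y n * T) := by
      rw [e, mul_add, add_mul, mul_smul_comm, mul_smul_comm, smul_mul_assoc, smul_mul_assoc]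
      module
    rw [e'] at h
    set G := T * ghost ξ ε y n - ghost ξ ε y n * T
    set G' := T * ghost ξ ε y (n + 1) - ghost ξ ε y (n + 1) * T
    have h2 : G = ξ⁻¹ • (ξ • G) := by rw [smul_smul, inv_mul_cancel₀ hξ, one_smul]
    have h3 : y (k + n - 1) = ξ⁻¹ • (ξ • y (k + n - 1)) := by
      rw [smul_smul, inv_mul_cancel₀ hξ, one_smul]
    have h4 : ξ • G = (ε - n) • y (k + n) + ξ • y (k + n - 1) - (ε - n) • G' := by
      rw [← h]; abel
    rw [h2, h4, show k + (n + 1) - 1 = k + n by ring]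
    nth_rewrite 2 [h3]
    module

end

/-! ### From symplectic fermions to the ghost system -/

namespace FermionRep

variable {C : ℤ → Matrix (Fin 2) (Fin 2) ℂ} {M : Type*} [AddCommGroup M] [Module ℂ M]
  (S : FermionRep C M)

theorem v_ne : S.v ≠ 0 := fun h => by
  have := S.τ_vac
  rw [h, map_zero] at this
  exact zero_ne_one this

theorem lin_mem {W : Submodule ℂ M} {u : M} {n : ℤ} (h : ∀ a, S.ψ a n u ∈ W) (y : Fin 2 → ℂ) :
    S.lin y n u ∈ W :=
  W.add_mem (W.smul_mem _ (h 0)) (W.smul_mem _ (h 1))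

theorem lin_single (a : Fin 2) (n : ℤ) : S.lin (Pi.single a 1) n = S.ψ a n := by
  fin_cases a <;> simp [lin]

theorem ser_mem {W : Submodule ℂ M} {u : M} {m : ℤ} (h : ∀ a n, m ≤ n → S.ψ a n u ∈ W)
    (f : ℕ → Fin 2 → ℂ) : S.ser f m u ∈ W :=
  lfsum_mem (S.locFin_lin f m) fun j => S.lin_mem (fun a => h a _ (by omega)) _

/-- Formal horizontal sections diagonalizing the connection turn the deformed symplectic fermions
into a ghost system. -/
theorem exists_bcSystem {ξ ε : ℂ} (hξ : ξ ≠ 0) {f g : ℕ → Fin 2 → ℂ}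
    (hf : IsEigenSection C ξ ε f) (hg : IsEigenSection C (-ξ) (-ε) g)
    (hlead : leadPairing C (g 0) (f 0) = ξ)
    (hbasis : ∀ y : Fin 2 → ℂ, ∃ s t : ℂ, y = s • f 0 + t • g 0) :
    ∃ B : BCSystem M, B.v = S.v ∧
      (∀ k m, S.T k * B.c m - B.c m * S.T k
        = -((m : ℂ) + ε) • B.c (k + m) - ξ • B.c (k + m - 1)) ∧
      (∀ k m, S.T k * B.d m - B.d m * S.T k
        = (ε - (k + m - 1)) • B.d (k + m) + ξ • B.d (k + m - 1)) ∧
      (∀ u, (∀ a n, 1 ≤ n → S.ψ a n u = 0) → ∀ n, 1 ≤ n → B.c n u = 0 ∧ B.d n u = 0) := by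
  have : Nontrivial M := ⟨S.v, 0, S.v_ne⟩
  have hys := S.ser_smooth g
  have hc := S.ser_commutator_of_isEigenSection hf
  have hy : ∀ k n : ℤ, S.T k * S.ser g n - S.ser g n * S.T k
      = (ε - n) • S.ser g (k + n) + ξ • S.ser g (k + n - 1) := by
    intro k n
    rw [S.ser_commutator_of_isEigenSection hg]
    module
  have hrec := ghost_recursion (ε := ε) hξ hys
  have hd : ∀ k m : ℤ, S.T k * ghost ξ ε (S.ser g) m - ghost ξ ε (S.ser g) m * S.T k
      = (ε - (k + m - 1)) • ghost ξ ε (S.ser g) (k + m)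
        + ξ • ghost ξ ε (S.ser g) (k + m - 1) := by
    intro k m
    rw [ghost_commutator hξ hys (hy k), hrec (k + m - 1), sub_add_cancel]
    push_cast
    rfl
  have hl : ∀ m, LocFin fun j : ℕ => ghostCoeff ξ ε m j • S.ser g (m + j) :=
    fun m => (hys.locFin m).smul _
  -- anticommutators of `d` with a series of modes
  have hds : ∀ (h : ℕ → Fin 2 → ℂ) (m n : ℤ), 1 ≤ m + n →
      ghost ξ ε (S.ser g) m * S.ser h n + S.ser h n * ghost ξ ε (S.ser g) m
        = (if m + n = 1 then ξ⁻¹ * leadPairing C (g 0) (h 0) else 0) • (1 : Module.End ℂ M) := by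
    intro h m n hmn
    rw [ghost, lfsum_anticommutator (hl m), lfsum_eq_single 0]
    · rw [smul_mul_assoc, mul_smul_comm, ← smul_add, Nat.cast_zero, add_zero,
        S.ser_anticomm g h hmn, smul_smul]
      congr 1
      split_ifs <;> simp [ghostCoeff]
    · intro j hj
      rw [smul_mul_assoc, mul_smul_comm, ← smul_add, S.ser_anticomm g h (by omega),
        if_neg (by omega), zero_smul, smul_zero]
  have hds' : ∀ (h : ℕ → Fin 2 → ℂ) (m n : ℤ), ∃ t : ℂ,
      ghost ξ ε (S.ser g) m * S.ser h n + S.ser h n * ghost ξ ε (S.ser g) m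
        = t • (1 : Module.End ℂ M) := by
    intro h m n
    rw [ghost, lfsum_anticommutator (hl m)]
    refine lfsum_scalar (((hl m).mul_right _).add ((hl m).mul_left _)) fun j => ?_
    obtain ⟨t, ht⟩ := S.ser_anticomm_scalar g h (m + j) n
    exact ⟨ghostCoeff ξ ε m j * t, by
      rw [smul_mul_assoc, mul_smul_comm, ← smul_add, ht, smul_smul]⟩
  have hdd : ∀ m n : ℤ, 2 ≤ m + n →
      ghost ξ ε (S.ser g) m * ghost ξ ε (S.ser g) n
        + ghost ξ ε (S.ser g) n * ghost ξ ε (S.ser g) m = 0 := by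
    intro m n hmn
    rw [show ghost ξ ε (S.ser g) m = lfsum fun j : ℕ => ghostCoeff ξ ε m j • S.ser g (m + j)
      from rfl, lfsum_anticommutator (hl m)]
    refine lfsum_eq_zero fun j => ?_
    rw [smul_mul_assoc, mul_smul_comm, ← smul_add, add_comm, hds g n (m + j) (by omega),
      if_neg (by omega), zero_smul, smul_zero]
  have hdd' : ∀ m n : ℤ, ∃ t : ℂ, ghost ξ ε (S.ser g) m * ghost ξ ε (S.ser g) n
        + ghost ξ ε (S.ser g) n * ghost ξ ε (S.ser g) m = t • (1 : Module.End ℂ M) := by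
    intro m n
    rw [show ghost ξ ε (S.ser g) m = lfsum fun j : ℕ => ghostCoeff ξ ε m j • S.ser g (m + j)
      from rfl, lfsum_anticommutator (hl m)]
    refine lfsum_scalar (((hl m).mul_right _).add ((hl m).mul_left _)) fun j => ?_
    obtain ⟨t, ht⟩ := hds' g n (m + j)
    exact ⟨ghostCoeff ξ ε m j * t, by
      rw [smul_mul_assoc, mul_smul_comm, ← smul_add, add_comm, ht, smul_smul]⟩
  have vac : ∀ u, (∀ a n, 1 ≤ n → S.ψ a n u = 0) →
      ∀ n, 1 ≤ n → S.ser f n u = 0 ∧ ghost ξ ε (S.ser g) n u = 0 := fun u hu n hn =>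
    ⟨S.ser_eq_zero_of hu f hn,
      ghost_apply_eq_zero hys (fun p hp => S.ser_eq_zero_of hu g hp) hn⟩
  refine ⟨{ c := S.ser f, d := ghost ξ ε (S.ser g), cc := ?_, dd := ?_, dc := ?_,
            smooth_c := S.ser_smooth f, smooth_d := ghost_smooth hys, v := S.v, v_ne := S.v_ne,
            vac_c := fun n hn => (vac _ S.vac n hn).1,
            vac_d := fun n hn => (vac _ S.vac n hn).2, gen := ?_ }, rfl, fun k m => hc k m,
            fun k m => hd k m, vac⟩
  -- In each of the three cases the anticommutators are scalars `r m n`, known for `m + n` large;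
  -- applying `[T k, ·]` to the scalar identity gives the recursion that fixes the others.
  · choose r hr using S.ser_anticomm_scalar f f
    intro m n
    rw [hr, anticomm_self_eq_zero (r := r) (α := fun _ m => -((m : ℂ) + ε)) (neg_ne_zero.mpr hξ)
      (fun k m n => ?_) (fun m n hmn => ?_) m n, zero_smul]
    · exact anticomm_recursion hr (T := S.T k) (by rw [hc, sub_eq_add_neg, neg_smul ξ])
        (by rw [hc, sub_eq_add_neg, neg_smul ξ])
    · refine eq_zero_of_smul_one_eq_zero (M := M) ?_
      rw [← hr, S.ser_anticomm f f (by omega), if_neg (by omega), zero_smul]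
  · choose r hr using hdd'
    intro m n
    rw [hr, anticomm_self_eq_zero (r := r) (α := fun k m => ε - (k + m - 1)) hξ
      (fun k m n => ?_) (fun m n hmn => ?_) m n, zero_smul]
    · exact anticomm_recursion hr (T := S.T k) (hd k m) (hd k n)
    · refine eq_zero_of_smul_one_eq_zero (M := M) ?_
      rw [← hr, hdd m n hmn]
  · choose r hr using hds' f
    intro m n
    rw [hr, anticomm_pair_eq (r := r) (ε := ε) hξ (fun k m n => ?_) (fun m n hmn => ?_)
      (fun m n hmn => ?_) m n]
    · exact anticomm_recursion hr (T := S.T k) (hd k m)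
        (by rw [hc, sub_eq_add_neg, neg_smul ξ])
    · rw [← sub_eq_zero]
      refine eq_zero_of_smul_one_eq_zero (M := M) ?_
      rw [sub_smul, ← hr, hds f m n hmn.ge, if_pos hmn, hlead, inv_mul_cancel₀ hξ, sub_self]
    · refine eq_zero_of_smul_one_eq_zero (M := M) ?_
      rw [← hr, hds f m n (by omega), if_neg (by omega), zero_smul]
  · intro W hv hWc hWd
    refine S.gen W hv fun a n u hu => ?_
    obtain ⟨K, hK⟩ := S.smooth u
    -- The original modes are recovered from high index downwards: modulo modes of higher index, the
    -- series of `f` and `g` reduce to `f 0` and `g 0`, which span.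
    have key : ∀ j : ℕ, ∀ n : ℤ, K ≤ n + j → ∀ a, S.ψ a n u ∈ W := by
      intro j
      induction j with
      | zero =>
        intro n hn a
        rw [hK a n (by simpa using hn)]
        exact W.zero_mem
      | succ j ih =>
        intro n hn a
        push_cast at hn
        have hrest : ∀ h : ℕ → Fin 2 → ℂ, S.ser h (n + 1) u ∈ W := fun h =>
          S.ser_mem (fun a p hp => ih p (by omega) a) h
        have hlin : ∀ h : ℕ → Fin 2 → ℂ, S.ser h n u ∈ W → S.lin (h 0) n u ∈ W := by
          intro h hh
          rw [S.ser_succ, LinearMap.add_apply] at hh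
          exact (W.add_mem_iff_left (hrest _)).mp hh
        have hfm := hlin f (hWc n u hu)
        have hgm := hlin g (by
          rw [hrec n]
          exact W.add_mem (W.smul_mem _ (hWd _ u hu)) (W.smul_mem _ (hWd _ u hu)))
        obtain ⟨s, t, hst⟩ := hbasis (Pi.single a 1)
        rw [← S.lin_single, hst, S.lin_add, S.lin_smul, S.lin_smul]
        exact W.add_mem (W.smul_mem _ hfm) (W.smul_mem _ hgm)
    exact key (K - n).toNat n (by omega) a

end FermionRep

/-! ### The Fock space of the ghost system -/

theorem eq_zero_of_eq_neg {M : Type*} [AddCommGroup M] [Module ℂ M] {x : M} (h : x = -x) :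
    x = 0 := by
  have h2 : (2 : ℂ) • x = 0 := by rw [two_smul]; nth_rewrite 1 [h]; exact neg_add_cancel x
  exact (smul_eq_zero.mp h2).resolve_left two_ne_zero

namespace BCSystem

variable {M : Type*} [AddCommGroup M] [Module ℂ M] (B : BCSystem M)

theorem dc_apply (m n : ℤ) (u : M) :
    B.d m (B.c n u) = (if m + n = 1 then u else 0) - B.c n (B.d m u) := by
  have h := congrArg (fun Z : Module.End ℂ M => Z u) (B.dc m n)
  simp only [LinearMap.add_apply, Module.End.mul_apply, LinearMap.smul_apply,
    Module.End.one_apply] at h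
  rw [eq_sub_iff_add_eq, h]
  split_ifs <;> simp

theorem cc_apply (m n : ℤ) (u : M) : B.c m (B.c n u) = -B.c n (B.c m u) := by
  have h := congrArg (fun Z : Module.End ℂ M => Z u) (B.cc m n)
  simp only [LinearMap.add_apply, Module.End.mul_apply, LinearMap.zero_apply] at h
  exact eq_neg_of_add_eq_zero_left h

theorem dd_apply (m n : ℤ) (u : M) : B.d m (B.d n u) = -B.d n (B.d m u) := by
  have h := congrArg (fun Z : Module.End ℂ M => Z u) (B.dd m n)
  simp only [LinearMap.add_apply, Module.End.mul_apply, LinearMap.zero_apply] at h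
  exact eq_neg_of_add_eq_zero_left h

/-- The ghost system with the roles of `c` and `d` exchanged. -/
def swap : BCSystem M where
  c := B.d
  d := B.c
  cc := B.dd
  dd := B.cc
  dc m n := by rw [add_comm, B.dc, add_comm]
  smooth_c := B.smooth_d
  smooth_d := B.smooth_c
  v := B.v
  v_ne := B.v_ne
  vac_c := B.vac_d
  vac_d := B.vac_c
  gen W hv h1 h2 := B.gen W hv h2 h1

/-- The vacuum generates everything under the creation operators. -/
theorem gen_creation (W : Submodule ℂ M) (hv : B.v ∈ W)
    (hc : ∀ n ≤ 0, ∀ u ∈ W, B.c n u ∈ W) (hd : ∀ n ≤ 0, ∀ u ∈ W, B.d n u ∈ W) : W = ⊤ := by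
  let P : Submodule ℂ M → Prop := fun W => B.v ∈ W ∧ (∀ n ≤ 0, ∀ u ∈ W, B.c n u ∈ W) ∧
    ∀ n ≤ 0, ∀ u ∈ W, B.d n u ∈ W
  let V : Submodule ℂ M := sInf {W | P W}
  have hle : ∀ W, P W → V ≤ W := fun W hW => sInf_le hW
  have hV : P V := by
    refine ⟨?_, fun n hn u hu => ?_, fun n hn u hu => ?_⟩ <;> rw [Submodule.mem_sInf]
    · exact fun W hW => hW.1
    · exact fun W hW => hW.2.1 n hn u (hle W hW hu)
    · exact fun W hW => hW.2.2 n hn u (hle W hW hu)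
  -- `V` is the smallest creation-stable subspace containing the vacuum. The vectors of `V` that
  -- annihilation operators keep in `V` form another such subspace, so by minimality `V` is stable
  -- under all modes.
  let V' : Submodule ℂ M := V ⊓ ((⨅ n : {n : ℤ // 1 ≤ n}, V.comap (B.c n)) ⊓
    ⨅ n : {n : ℤ // 1 ≤ n}, V.comap (B.d n))
  have hmem : ∀ u, u ∈ V' ↔ u ∈ V ∧ (∀ n, 1 ≤ n → B.c n u ∈ V) ∧ ∀ n, 1 ≤ n → B.d n u ∈ V := by
    intro u
    simp [V', Submodule.mem_iInf]
  have hV' : P V' := by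
    refine ⟨?_, fun n hn u hu => ?_, fun n hn u hu => ?_⟩ <;> rw [hmem]
    · exact ⟨hV.1, fun n hn => by rw [B.vac_c n hn]; exact V.zero_mem,
        fun n hn => by rw [B.vac_d n hn]; exact V.zero_mem⟩
    · obtain ⟨h1, h2, h3⟩ := (hmem u).mp hu
      refine ⟨hV.2.1 n hn u h1, fun m hm => ?_, fun m hm => ?_⟩
      · rw [B.cc_apply]
        exact V.neg_mem (hV.2.1 n hn _ (h2 m hm))
      · rw [B.dc_apply]
        exact V.sub_mem (by split_ifs; exacts [h1, V.zero_mem]) (hV.2.1 n hn _ (h3 m hm))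
    · obtain ⟨h1, h2, h3⟩ := (hmem u).mp hu
      refine ⟨hV.2.2 n hn u h1, fun m hm => ?_, fun m hm => ?_⟩
      · have := B.swap.dc_apply m n u
        simp only [swap] at this
        rw [this]
        exact V.sub_mem (by split_ifs; exacts [h1, V.zero_mem]) (hV.2.2 n hn _ (h2 m hm))
      · rw [B.dd_apply]
        exact V.neg_mem (hV.2.2 n hn _ (h3 m hm))
  have hle' := hle V' hV'
  have htop : V = ⊤ := by
    refine B.gen V hV.1 (fun n u hu => ?_) fun n u hu => ?_
    · rcases le_or_gt n 0 with hn | hn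
      · exact hV.2.1 n hn u hu
      · exact ((hmem u).mp (hle' hu)).2.1 n hn
    · rcases le_or_gt n 0 with hn | hn
      · exact hV.2.2 n hn u hu
      · exact ((hmem u).mp (hle' hu)).2.2 n hn
  exact top_le_iff.mp (htop ▸ hle W ⟨hv, hc, hd⟩)

/-- Creation operators. -/
def cr (i : Bool × ℕ) : Module.End ℂ M := if i.1 then B.c (-i.2) else B.d (-i.2)

/-- Annihilation operators. -/
def an (i : Bool × ℕ) : Module.End ℂ M := if i.1 then B.d (1 + i.2) else B.c (1 + i.2)

theorem cr_cr (i j : Bool × ℕ) (u : M) : B.cr i (B.cr j u) = -B.cr j (B.cr i u) := by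
  obtain ⟨a, m⟩ := i
  obtain ⟨b, n⟩ := j
  cases a <;> cases b <;> simp only [cr, if_true, Bool.false_eq_true, if_false]
  · exact B.dd_apply _ _ _
  · rw [B.dc_apply, if_neg (by omega), zero_sub]
  · rw [B.dc_apply, if_neg (by omega), zero_sub, neg_neg]
  · exact B.cc_apply _ _ _

/-- The indexing pairs each creation operator with its conjugate, `c (-m)` with `d (1 + m)` and `d
(-m)` with `c (1 + m)`; these are canonical anticommutation relations. -/
theorem an_cr (i j : Bool × ℕ) (u : M) :
    B.an i (B.cr j u) = (if i = j then u else 0) - B.cr j (B.an i u) := by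
  obtain ⟨a, m⟩ := i
  obtain ⟨b, n⟩ := j
  cases a <;> cases b <;> simp only [cr, an, if_true, Bool.false_eq_true, if_false, Prod.mk.injEq,
    true_and, false_and, reduceCtorEq]
  · have := B.swap.dc_apply (1 + m) (-n) u
    simp only [swap] at this
    rw [this]
    congr 2
    exact propext ⟨fun h => by omega, fun h => by omega⟩
  · rw [B.cc_apply, zero_sub]
  · rw [B.dd_apply, zero_sub]
  · rw [B.dc_apply]
    congr 2
    exact propext ⟨fun h => by omega, fun h => by omega⟩

theorem exists_vac_add_sum_creation (u : M) : ∃ (t : ℂ) (s : Finset (Bool × ℕ))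
    (x : Bool × ℕ → M), u = t • B.v + ∑ i ∈ s, B.cr i (x i) := by
  classical
  let W : Submodule ℂ M := Submodule.span ℂ {B.v} ⊔ ⨆ i, LinearMap.range (B.cr i)
  have hcr : ∀ i u, B.cr i u ∈ W := fun i u =>
    Submodule.mem_sup_right (Submodule.mem_iSup_of_mem i ⟨u, rfl⟩)
  have hW : W = ⊤ := by
    refine B.gen_creation W (Submodule.mem_sup_left (Submodule.mem_span_singleton_self _))
      (fun n hn u _ => ?_) fun n hn u _ => ?_
    · have := hcr (true, (-n).toNat) u
      rwa [cr, if_pos rfl, show -(((-n).toNat : ℕ) : ℤ) = n by omega] at this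
    · have := hcr (false, (-n).toNat) u
      rwa [cr, if_neg (by simp), show -(((-n).toNat : ℕ) : ℤ) = n by omega] at this
  have hu : u ∈ W := hW ▸ Submodule.mem_top
  obtain ⟨y, hy, z, hz, rfl⟩ := Submodule.mem_sup.mp hu
  obtain ⟨t, rfl⟩ := Submodule.mem_span_singleton.mp hy
  obtain ⟨g, hg, hgz⟩ := (Submodule.mem_iSup_iff_exists_finsupp _ _).mp hz
  choose x hx using hg
  exact ⟨t, g.support, x, by rw [← hgz, Finsupp.sum]; simp only [hx]⟩

/-- A vector killed by all annihilation operators is a multiple of the vacuum. -/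
theorem vac_unique {u : M} (hc : ∀ n, 1 ≤ n → B.c n u = 0) (hd : ∀ n, 1 ≤ n → B.d n u = 0) :
    ∃ t : ℂ, u = t • B.v := by
  classical
  have han : ∀ i, B.an i u = 0 := by
    rintro ⟨a, m⟩
    cases a <;> simp only [an, if_true, Bool.false_eq_true, if_false]
    · exact hc _ (by omega)
    · exact hd _ (by omega)
  have hanv : ∀ i, B.an i B.v = 0 := by
    rintro ⟨a, m⟩
    cases a <;> simp only [an, if_true, Bool.false_eq_true, if_false]
    · exact B.vac_c _ (by omega)
    · exact B.vac_d _ (by omega)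
  obtain ⟨t, s, x, hx⟩ := B.exists_vac_add_sum_creation u
  refine ⟨t, ?_⟩
  clear hc hd
  induction s using Finset.induction_on generalizing x with
  | empty => simpa using hx
  | insert j s hj ih =>
    -- The projection `an j ∘ cr j` fixes `u` and the vacuum, both killed by `an j`, and removes the
    -- `j`-th summand because `cr j` squares to zero. The other summands keep their form.
    refine ih (fun i => B.an j (B.cr j (x i))) ?_
    have h1 : u = B.an j (B.cr j u) := by rw [B.an_cr, if_pos rfl, han, map_zero, sub_zero]
    have hjj : ∀ y, B.cr j (B.cr j y) = 0 := fun y => eq_zero_of_eq_neg (B.cr_cr j j y)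
    rw [h1, hx, Finset.sum_insert hj]
    simp only [map_add, map_smul, map_sum]
    rw [B.an_cr j j B.v, if_pos rfl, hanv, map_zero, sub_zero, hjj, map_zero, zero_add]
    congr 1
    refine Finset.sum_congr rfl fun i hi => ?_
    rw [B.cr_cr j i, map_neg, B.an_cr j i, if_neg (by rintro rfl; exact hj hi), zero_sub, neg_neg]

/-- An operator commuting with all modes is a scalar. -/
theorem schur {X : Module.End ℂ M} (hc : ∀ n, X * B.c n - B.c n * X = 0)
    (hd : ∀ n, X * B.d n - B.d n * X = 0) : ∃ t : ℂ, X = t • (1 : Module.End ℂ M) := by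
  have hc' : ∀ n u, X (B.c n u) = B.c n (X u) := fun n u =>
    congrArg (fun Z : Module.End ℂ M => Z u) (sub_eq_zero.mp (hc n))
  have hd' : ∀ n u, X (B.d n u) = B.d n (X u) := fun n u =>
    congrArg (fun Z : Module.End ℂ M => Z u) (sub_eq_zero.mp (hd n))
  obtain ⟨t, ht⟩ := B.vac_unique (u := X B.v)
    (fun n hn => by rw [← hc', B.vac_c n hn, map_zero])
    (fun n hn => by rw [← hd', B.vac_d n hn, map_zero])
  refine ⟨t, ?_⟩
  have h : LinearMap.ker (X - t • (1 : Module.End ℂ M)) = ⊤ := by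
    refine B.gen _ ?_ (fun n u hu => ?_) fun n u hu => ?_
    · simp [ht]
    · simp only [LinearMap.mem_ker, LinearMap.sub_apply, LinearMap.smul_apply,
        Module.End.one_apply, sub_eq_zero] at hu ⊢
      rw [hc', hu, map_smul]
    · simp only [LinearMap.mem_ker, LinearMap.sub_apply, LinearMap.smul_apply,
        Module.End.one_apply, sub_eq_zero] at hu ⊢
      rw [hd', hu, map_smul]
  exact sub_eq_zero.mp (LinearMap.ker_eq_top.mp h)

/-! ### Quadratic operators -/

/-- The normally ordered product of `d_{n+1-j}` and `c_j`. -/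
def pairNO (n j : ℤ) : Module.End ℂ M :=
  if 1 ≤ j then B.d (n + 1 - j) * B.c j else -(B.c j * B.d (n + 1 - j))

theorem pairNO_apply_eq_zero {n j : ℤ} {u : M} (h1 : 1 ≤ j → B.c j u = 0)
    (h2 : j ≤ 0 → B.d (n + 1 - j) u = 0) : B.pairNO n j u = 0 := by
  rw [pairNO]
  split_ifs with h
  · rw [Module.End.mul_apply, h1 h, map_zero]
  · rw [LinearMap.neg_apply, Module.End.mul_apply, h2 (by omega), map_zero, neg_zero]

theorem locFin_pairNO (n : ℤ) (f : ℤ → ℂ) : LocFin fun j : ℤ => f j • B.pairNO n j := by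
  refine LocFin.smul (locFin_of_finset fun u => ?_) f
  obtain ⟨K, hK⟩ := B.smooth_c u
  obtain ⟨K', hK'⟩ := B.smooth_d u
  refine ⟨Finset.Icc (min 1 (n + 1 - K')) (max 0 K), fun j hj =>
    B.pairNO_apply_eq_zero (fun h => hK j ?_) fun h => hK' _ ?_⟩ <;>
  · rw [Finset.mem_Icc] at hj
    omega

/-- The quadratic operator `∑_j f(j) :d_{n+1-j} c_j:`. -/
noncomputable def quad (f : ℤ → ℂ) (n : ℤ) : Module.End ℂ M := lfsum fun j : ℤ => f j • B.pairNO n j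

theorem pairNO_commutator_c (n j m : ℤ) :
    B.pairNO n j * B.c m - B.c m * B.pairNO n j
      = (if j = n + m then (-1 : ℂ) else 0) • B.c j := by
  have e : (if n + 1 - j + m = 1 then (1 : ℂ) else 0) = if j = n + m then 1 else 0 := by
    congr 1; exact propext ⟨fun h => by omega, fun h => by omega⟩
  have h1 := B.dc (n + 1 - j) m
  have h2 := B.cc j m
  rw [e] at h1
  have h : B.pairNO n j * B.c m - B.c m * B.pairNO n j
      = -((if j = n + m then (1 : ℂ) else 0) • B.c j) := by
    rw [pairNO]
    split_ifs with hj h' h'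
    · rw [show B.d (n + 1 - j) * B.c j * B.c m - B.c m * (B.d (n + 1 - j) * B.c j)
        = B.d (n + 1 - j) * (B.c j * B.c m + B.c m * B.c j)
          - (B.d (n + 1 - j) * B.c m + B.c m * B.d (n + 1 - j)) * B.c j by noncomm_ring, h1, h2,
        if_pos h']
      simp
    · rw [show B.d (n + 1 - j) * B.c j * B.c m - B.c m * (B.d (n + 1 - j) * B.c j)
        = B.d (n + 1 - j) * (B.c j * B.c m + B.c m * B.c j)
          - (B.d (n + 1 - j) * B.c m + B.c m * B.d (n + 1 - j)) * B.c j by noncomm_ring, h1, h2,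
        if_neg h']
      simp
    · rw [show -(B.c j * B.d (n + 1 - j)) * B.c m - B.c m * -(B.c j * B.d (n + 1 - j))
        = (B.c j * B.c m + B.c m * B.c j) * B.d (n + 1 - j)
          - B.c j * (B.d (n + 1 - j) * B.c m + B.c m * B.d (n + 1 - j)) by noncomm_ring, h1, h2,
        if_pos h']
      simp
    · rw [show -(B.c j * B.d (n + 1 - j)) * B.c m - B.c m * -(B.c j * B.d (n + 1 - j))
        = (B.c j * B.c m + B.c m * B.c j) * B.d (n + 1 - j)
          - B.c j * (B.d (n + 1 - j) * B.c m + B.c m * B.d (n + 1 - j)) by noncomm_ring, h1, h2,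
        if_neg h']
      simp
  rw [h]
  split_ifs <;> simp

theorem pairNO_commutator_d (n j m : ℤ) :
    B.pairNO n j * B.d m - B.d m * B.pairNO n j
      = (if j = 1 - m then (1 : ℂ) else 0) • B.d (n + 1 - j) := by
  have e : (if m + j = 1 then (1 : ℂ) else 0) = if j = 1 - m then 1 else 0 := by
    congr 1; exact propext ⟨fun h => by omega, fun h => by omega⟩
  have h1 := B.dc m j
  have h2 := B.dd (n + 1 - j) m
  rw [e] at h1
  rw [← mul_one (B.d (n + 1 - j)), ← mul_smul_comm, ← h1, pairNO]
  split_ifs with hj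
  · rw [← sub_eq_zero, show B.d (n + 1 - j) * B.c j * B.d m - B.d m * (B.d (n + 1 - j) * B.c j)
      - B.d (n + 1 - j) * (B.d m * B.c j + B.c j * B.d m)
      = -((B.d (n + 1 - j) * B.d m + B.d m * B.d (n + 1 - j)) * B.c j) by noncomm_ring, h2]
    simp
  · have h3 : B.d (n + 1 - j) * (B.d m * B.c j + B.c j * B.d m)
        = (B.d m * B.c j + B.c j * B.d m) * B.d (n + 1 - j) := by rw [h1]; simp
    rw [← sub_eq_zero, h3, show -(B.c j * B.d (n + 1 - j)) * B.d m
      - B.d m * -(B.c j * B.d (n + 1 - j))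
      - (B.d m * B.c j + B.c j * B.d m) * B.d (n + 1 - j)
      = -(B.c j * (B.d (n + 1 - j) * B.d m + B.d m * B.d (n + 1 - j))) by noncomm_ring, h2]
    simp

theorem quad_commutator_c (f : ℤ → ℂ) (n m : ℤ) :
    B.quad f n * B.c m - B.c m * B.quad f n = -f (n + m) • B.c (n + m) := by
  rw [quad, lfsum_commutator (B.locFin_pairNO n f), lfsum_eq_single (n + m)]
  · rw [smul_mul_assoc, mul_smul_comm, ← smul_sub, pairNO_commutator_c, if_pos rfl]
    module
  · intro j hj
    rw [smul_mul_assoc, mul_smul_comm, ← smul_sub, pairNO_commutator_c, if_neg hj, zero_smul,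
      smul_zero]

theorem quad_commutator_d (f : ℤ → ℂ) (n m : ℤ) :
    B.quad f n * B.d m - B.d m * B.quad f n = f (1 - m) • B.d (n + m) := by
  rw [quad, lfsum_commutator (B.locFin_pairNO n f), lfsum_eq_single (1 - m)]
  · rw [smul_mul_assoc, mul_smul_comm, ← smul_sub, pairNO_commutator_d, if_pos rfl, one_smul,
      show n + 1 - (1 - m) = n + m by ring]
  · intro j hj
    rw [smul_mul_assoc, mul_smul_comm, ← smul_sub, pairNO_commutator_d, if_neg hj, zero_smul,
      smul_zero]

theorem quad_c_apply (f : ℤ → ℂ) (n m : ℤ) (u : M) :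
    B.quad f n (B.c m u) = B.c m (B.quad f n u) - f (n + m) • B.c (n + m) u := by
  have h := congrArg (fun Z : Module.End ℂ M => Z u) (B.quad_commutator_c f n m)
  simp only [LinearMap.sub_apply, Module.End.mul_apply, LinearMap.smul_apply] at h
  rw [sub_eq_iff_eq_add] at h
  rw [h]
  module

theorem quad_d_apply (f : ℤ → ℂ) (n m : ℤ) (u : M) :
    B.quad f n (B.d m u) = B.d m (B.quad f n u) + f (1 - m) • B.d (n + m) u := by
  have h := congrArg (fun Z : Module.End ℂ M => Z u) (B.quad_commutator_d f n m)
  simp only [LinearMap.sub_apply, Module.End.mul_apply, LinearMap.smul_apply] at h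
  rw [sub_eq_iff_eq_add] at h
  rw [h]
  module

theorem quad_vac (f : ℤ → ℂ) {n : ℤ} (hn : 0 ≤ n) : B.quad f n B.v = 0 :=
  lfsum_apply_eq_zero (B.locFin_pairNO n f) fun j => by
    rw [LinearMap.smul_apply, B.pairNO_apply_eq_zero (B.vac_c j) fun h => B.vac_d _ (by omega),
      smul_zero]

theorem commutator_commutator (X Y z : Module.End ℂ M) :
    (X * Y - Y * X) * z - z * (X * Y - Y * X)
      = (X * (Y * z - z * Y) - (Y * z - z * Y) * X)
        - (Y * (X * z - z * X) - (X * z - z * X) * Y) := by noncomm_ring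

/-- An operator with the same commutators with the modes as a quadratic operator differs from it
by a scalar. -/
theorem eq_quad_add_scalar {X : Module.End ℂ M} {f : ℤ → ℂ} {n : ℤ}
    (hc : ∀ m, X * B.c m - B.c m * X = -f (n + m) • B.c (n + m))
    (hd : ∀ m, X * B.d m - B.d m * X = f (1 - m) • B.d (n + m)) :
    ∃ t : ℂ, X = B.quad f n + t • (1 : Module.End ℂ M) := by
  obtain ⟨t, ht⟩ := B.schur (X := X - B.quad f n)
    (fun m => by
      rw [show (X - B.quad f n) * B.c m - B.c m * (X - B.quad f n) = (X * B.c m - B.c m * X)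
        - (B.quad f n * B.c m - B.c m * B.quad f n) by noncomm_ring, hc, quad_commutator_c,
        sub_self])
    (fun m => by
      rw [show (X - B.quad f n) * B.d m - B.d m * (X - B.quad f n) = (X * B.d m - B.d m * X)
        - (B.quad f n * B.d m - B.d m * B.quad f n) by noncomm_ring, hd, quad_commutator_d,
        sub_self])
  exact ⟨t, by rw [← ht]; abel⟩

/-- The energy operator, normalized so that `c_m` and `d_m` have energy `1 - 2 m`. -/
noncomputable def energy : Module.End ℂ M := B.quad (fun j => 2 * j - 1) 0

theorem energy_c (m : ℤ) (u : M) :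
    B.energy (B.c m u) = B.c m (B.energy u) + (1 - 2 * (m : ℂ)) • B.c m u := by
  rw [energy, quad_c_apply, zero_add]; module

theorem energy_d (m : ℤ) (u : M) :
    B.energy (B.d m u) = B.d m (B.energy u) + (1 - 2 * (m : ℂ)) • B.d m u := by
  rw [energy, quad_d_apply, zero_add]; push_cast; module

theorem energy_vac : B.energy B.v = 0 := B.quad_vac _ le_rfl

theorem energy_quad_vac (f : ℤ → ℂ) (n : ℤ) :
    B.energy (B.quad f n B.v) = (-2 * (n : ℂ)) • B.quad f n B.v := by
  have h : B.quad f n B.v ∈ LinearMap.ker (B.energy - (-2 * (n : ℂ)) • (1 : Module.End ℂ M)) := by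
    refine lfsum_mem (B.locFin_pairNO n f) fun j => ?_
    rw [LinearMap.smul_apply]
    refine Submodule.smul_mem _ _ ?_
    rw [LinearMap.mem_ker, LinearMap.sub_apply, LinearMap.smul_apply, Module.End.one_apply,
      sub_eq_zero, pairNO]
    split_ifs with hj
    · rw [Module.End.mul_apply, B.vac_c j hj]; simp
    · simp only [LinearMap.neg_apply, Module.End.mul_apply, map_neg, B.energy_c, B.energy_d,
        B.energy_vac, map_zero, map_smul, zero_add]
      push_cast
      module
  rw [LinearMap.mem_ker, LinearMap.sub_apply, sub_eq_zero] at h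
  exact h

/-- The two sides have equal commutators with all modes, so they differ by a scalar, and this scalar
is seen to be zero on the vacuum. -/
theorem energy_commutator_quad (f : ℤ → ℂ) (n : ℤ) :
    B.energy * B.quad f n - B.quad f n * B.energy = (-2 * (n : ℂ)) • B.quad f n := by
  have hz : ∀ z : Module.End ℂ M,
      (B.energy * B.quad f n - B.quad f n * B.energy - (-2 * (n : ℂ)) • B.quad f n) * z
      - z * (B.energy * B.quad f n - B.quad f n * B.energy - (-2 * (n : ℂ)) • B.quad f n)
      = (B.energy * (B.quad f n * z - z * B.quad f n) - (B.quad f n * z - z * B.quad f n) * B.energy)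
        - (B.quad f n * (B.energy * z - z * B.energy) - (B.energy * z - z * B.energy) * B.quad f n)
        - (-2 * (n : ℂ)) • (B.quad f n * z - z * B.quad f n) := by
    intro z
    rw [← commutator_commutator, sub_mul, mul_sub z, smul_mul_assoc, mul_smul_comm, smul_sub]
    abel
  obtain ⟨t, ht⟩ := B.schur
    (X := B.energy * B.quad f n - B.quad f n * B.energy - (-2 * (n : ℂ)) • B.quad f n)
    (fun m => by
      rw [hz]
      simp only [quad_commutator_c, energy, mul_smul_comm, smul_mul_assoc, ← smul_sub, smul_smul,
        ← sub_smul, zero_add]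
      rw [show ∀ t : ℂ, t = 0 → t • B.c (n + m) = 0 from fun t ht => by rw [ht, zero_smul]]
      push_cast
      ring)
    (fun m => by
      rw [hz]
      simp only [quad_commutator_d, energy, mul_smul_comm, smul_mul_assoc, ← smul_sub, smul_smul,
        ← sub_smul, zero_add]
      rw [show ∀ t : ℂ, t = 0 → t • B.d (n + m) = 0 from fun t ht => by rw [ht, zero_smul]]
      push_cast
      ring)
  have hv := congrArg (fun Z : Module.End ℂ M => Z B.v) ht
  simp only [LinearMap.sub_apply, Module.End.mul_apply, LinearMap.smul_apply,
    Module.End.one_apply, energy_quad_vac, energy_vac, map_zero, sub_zero, sub_self] at hv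
  rw [(smul_eq_zero.mp hv.symm).resolve_right B.v_ne, zero_smul] at ht
  exact sub_eq_zero.mp ht

theorem energy_quad (f : ℤ → ℂ) (n : ℤ) (u : M) :
    B.energy (B.quad f n u) = B.quad f n (B.energy u) + (-2 * (n : ℂ)) • B.quad f n u := by
  have h := congrArg (fun Z : Module.End ℂ M => Z u) (B.energy_commutator_quad f n)
  simp only [LinearMap.sub_apply, Module.End.mul_apply, LinearMap.smul_apply] at h
  rw [← h]; abel

/-! ### The Heisenberg algebra -/

/-- The charge current. -/
noncomputable def J (n : ℤ) : Module.End ℂ M := B.quad (fun _ => 1) n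

theorem J_c (n m : ℤ) (u : M) : B.J n (B.c m u) = B.c m (B.J n u) - B.c (n + m) u := by
  rw [J, quad_c_apply, one_smul]

theorem J_d (n m : ℤ) (u : M) : B.J n (B.d m u) = B.d m (B.J n u) + B.d (n + m) u := by
  rw [J, quad_d_apply, one_smul]

theorem J_vac {n : ℤ} (hn : 0 ≤ n) : B.J n B.v = 0 := B.quad_vac _ hn

theorem energy_J (n : ℤ) (u : M) :
    B.energy (B.J n u) = B.J n (B.energy u) + (-2 * (n : ℂ)) • B.J n u := B.energy_quad _ n u

/-- Both currents shift the indices of the modes, with the same signs, and shifts commute; `schur`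
does the rest. -/
theorem J_commutator_scalar (m n : ℤ) :
    ∃ t : ℂ, B.J m * B.J n - B.J n * B.J m = t • (1 : Module.End ℂ M) := by
  refine B.schur (fun p => ?_) fun p => ?_
  · rw [commutator_commutator]
    simp only [J, quad_commutator_c, mul_smul_comm, smul_mul_assoc, ← smul_sub]
    rw [show m + (n + p) = n + (m + p) by ring, sub_self, smul_zero, smul_zero]
  · rw [commutator_commutator]
    simp only [J, quad_commutator_d, mul_smul_comm, smul_mul_assoc, ← smul_sub]
    rw [show m + (n + p) = n + (m + p) by ring, sub_self, smul_zero, smul_zero]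

/-- A scalar preserves the energy of the vacuum, whereas the commutator changes it by `-2 * (m +
n)`. -/
theorem J_commutator_of_ne {m n : ℤ} (h : m + n ≠ 0) : B.J m * B.J n - B.J n * B.J m = 0 := by
  obtain ⟨t, ht⟩ := B.J_commutator_scalar m n
  have key := congrArg (fun Z : Module.End ℂ M => B.energy (Z B.v)) ht
  have key' := congrArg (fun Z : Module.End ℂ M => Z B.v) ht
  simp only [LinearMap.sub_apply, Module.End.mul_apply, LinearMap.smul_apply,
    Module.End.one_apply, map_sub, map_smul, energy_vac, energy_J, map_zero, zero_add,
    smul_zero] at key key'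
  have h0 : (-2 * ((m : ℂ) + n) * t) • B.v = 0 := by
    rw [mul_smul, ← key', ← key]
    module
  have h1 : (-2 * ((m : ℂ) + n) * t) = 0 := (smul_eq_zero.mp h0).resolve_right B.v_ne
  have h2 : (-2 * ((m : ℂ) + n)) ≠ 0 := by
    refine mul_ne_zero (by norm_num) ?_
    exact_mod_cast h
  rw [ht, (mul_eq_zero.mp h1).resolve_left h2, zero_smul]

theorem J_comm_apply {m n : ℤ} (h : m + n ≠ 0) (u : M) : B.J m (B.J n u) = B.J n (B.J m u) := by
  have := congrArg (fun Z : Module.End ℂ M => Z u) (B.J_commutator_of_ne h)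
  exact sub_eq_zero.mp this

theorem J_vac_neg (n : ℕ) :
    B.J (-n) B.v = -∑ i ∈ Finset.range n, B.c (-i) (B.d (1 + i - n) B.v) := by
  have hinj : Function.Injective fun i : ℕ => -(i : ℤ) := fun a b h => by simpa using h
  rw [J, quad, lfsum_apply_eq_sum (B.locFin_pairNO _ _)
    (s := (Finset.range n).image fun i : ℕ => -(i : ℤ)), Finset.sum_image hinj.injOn,
    ← Finset.sum_neg_distrib]
  · refine Finset.sum_congr rfl fun i _ => ?_
    rw [one_smul, pairNO, if_neg (by omega), LinearMap.neg_apply, Module.End.mul_apply,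
      show -(n : ℤ) + 1 - -(i : ℤ) = 1 + i - n by ring]
  · intro j hj
    rw [one_smul]
    refine B.pairNO_apply_eq_zero (B.vac_c j) fun h => B.vac_d _ ?_
    by_contra hlt
    exact hj (Finset.mem_image.mpr ⟨(-j).toNat, Finset.mem_range.mpr (by omega), by omega⟩)

/-- Evaluated on the vacuum: `J (-n)` creates `n` pairs there, and `J n` annihilates each of them
with the same coefficient. -/
theorem J_commutator_neg (n : ℕ) :
    B.J n * B.J (-n) - B.J (-n) * B.J n = (n : ℂ) • (1 : Module.End ℂ M) := by
  obtain ⟨t, ht⟩ := B.J_commutator_scalar n (-n)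
  have hv := congrArg (fun Z : Module.End ℂ M => Z B.v) ht
  simp only [LinearMap.sub_apply, Module.End.mul_apply, LinearMap.smul_apply,
    Module.End.one_apply] at hv
  rw [B.J_vac (Int.natCast_nonneg n), map_zero, sub_zero, J_vac_neg, map_neg, map_sum] at hv
  have e : ∀ i ∈ Finset.range n, B.J n (B.c (-i) (B.d (1 + i - n) B.v)) = -B.v := by
    intro i hi
    rw [Finset.mem_range] at hi
    rw [J_c, J_d, B.J_vac (Int.natCast_nonneg n), B.vac_d _ (by omega)]
    have := B.swap.dc_apply (n + -i) (1 + i - n) B.v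
    simp only [swap] at this
    rw [this, if_pos (by ring), B.vac_c _ (by omega)]
    simp
  rw [Finset.sum_congr rfl e, Finset.sum_const, Finset.card_range, smul_neg, neg_neg,
    ← Nat.cast_smul_eq_nsmul ℂ] at hv
  have h : ((n : ℂ) - t) • B.v = 0 := by rw [sub_smul, hv, sub_self]
  rw [ht, sub_eq_zero.mp ((smul_eq_zero.mp h).resolve_right B.v_ne)]

/-- Commutators of creation and annihilation operators of the Heisenberg algebra. -/
theorem J_pos_neg (m n : ℕ) (u : M) :
    B.J (m + 1) (B.J (-(n + 1)) u)
      = B.J (-(n + 1)) (B.J (m + 1) u) + (if m = n then ((m : ℂ) + 1) else 0) • u := by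
  split_ifs with h
  · subst h
    have := congrArg (fun Z : Module.End ℂ M => Z u) (B.J_commutator_neg (m + 1))
    simp only [LinearMap.sub_apply, Module.End.mul_apply, LinearMap.smul_apply,
      Module.End.one_apply] at this
    push_cast at this
    rw [← this]; abel
  · rw [B.J_comm_apply (by omega), zero_smul, add_zero]

end BCSystem

namespace BCSystem

variable {M : Type*} [AddCommGroup M] [Module ℂ M] (B : BCSystem M)

theorem cd_apply (m n : ℤ) (u : M) :
    B.c m (B.d n u) = (if m + n = 1 then u else 0) - B.d n (B.c m u) :=
  B.swap.dc_apply m n u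

/-! ### Charged vacua -/

/-- The vacuum of charge `k`. -/
def cv : ℤ → M
  | (k : ℕ) => Nat.rec B.v (fun k u => B.c (-k) u) k
  | Int.negSucc k => B.d (-k) (Nat.rec B.v (fun k u => B.d (-k) u) k)

theorem cv_nat_succ (k : ℕ) : B.cv (k + 1) = B.c (-k) (B.cv k) := rfl

theorem cv_neg_succ (k : ℕ) : B.cv (-(k + 1)) = B.d (-k) (B.cv (-k)) := by
  rw [show (-((k : ℤ) + 1)) = Int.negSucc k from rfl]
  cases k with
  | zero => rfl
  | succ k => rfl

/-- Adding `c (-k)` to the vacuum of charge `k` moves the Fermi level by one: `c (-k)` becomes an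
annihilator and its conjugate `d (1 + k)` stops being one. -/
theorem ann_cv_nat (k : ℕ) :
    (∀ n : ℤ, 1 - k ≤ n → B.c n (B.cv k) = 0) ∧ ∀ n : ℤ, 1 + k ≤ n → B.d n (B.cv k) = 0 := by
  induction k with
  | zero => exact ⟨fun n hn => B.vac_c n (by simpa using hn), fun n hn => B.vac_d n (by simpa using hn)⟩
  | succ k ih =>
    push_cast
    rw [cv_nat_succ]
    refine ⟨fun n hn => ?_, fun n hn => ?_⟩
    · rw [cc_apply]
      rcases eq_or_ne n (-k) with rfl | h
      · exact eq_zero_of_eq_neg (by rw [neg_neg]; exact (B.cc_apply _ _ _).symm)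
      · rw [ih.1 n (by omega), map_zero, neg_zero]
    · rw [dc_apply, if_neg (by omega), ih.2 n (by omega), map_zero, sub_zero]

theorem ann_cv_neg (k : ℕ) :
    (∀ n : ℤ, 1 + k ≤ n → B.c n (B.cv (-k)) = 0) ∧ ∀ n : ℤ, 1 - k ≤ n → B.d n (B.cv (-k)) = 0 := by
  induction k with
  | zero => exact ⟨fun n hn => B.vac_c n (by simpa using hn), fun n hn => B.vac_d n (by simpa using hn)⟩
  | succ k ih =>
    push_cast
    rw [cv_neg_succ]
    refine ⟨fun n hn => ?_, fun n hn => ?_⟩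
    · rw [cd_apply, if_neg (by omega), ih.1 n (by omega), map_zero, sub_zero]
    · rw [dd_apply]
      rcases eq_or_ne n (-k) with rfl | h
      · exact eq_zero_of_eq_neg (by rw [neg_neg]; exact (B.dd_apply _ _ _).symm)
      · rw [ih.2 n (by omega), map_zero, neg_zero]

theorem c_cv_eq_zero (k : ℤ) {n : ℤ} (h : 1 - k ≤ n) : B.c n (B.cv k) = 0 := by
  rcases Int.eq_nat_or_neg k with ⟨k, rfl | rfl⟩
  · exact (B.ann_cv_nat k).1 n h
  · exact (B.ann_cv_neg k).1 n (by omega)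

theorem d_cv_eq_zero (k : ℤ) {n : ℤ} (h : 1 + k ≤ n) : B.d n (B.cv k) = 0 := by
  rcases Int.eq_nat_or_neg k with ⟨k, rfl | rfl⟩
  · exact (B.ann_cv_nat k).2 n h
  · exact (B.ann_cv_neg k).2 n (by omega)

theorem c_cv (k : ℤ) : B.c (-k) (B.cv k) = B.cv (k + 1) := by
  rcases Int.eq_nat_or_neg k with ⟨k, rfl | rfl⟩
  · exact (B.cv_nat_succ k).symm
  · cases k with
    | zero => exact (B.cv_nat_succ 0).symm
    | succ k =>
      push_cast
      rw [cv_neg_succ, cd_apply, if_pos (by ring), B.c_cv_eq_zero _ (by omega), map_zero, sub_zero,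
        show -((k : ℤ) + 1) + 1 = -k by ring]

theorem d_cv (k : ℤ) : B.d (k + 1) (B.cv (k + 1)) = B.cv k := by
  rw [← c_cv, dc_apply, if_pos (by ring), B.d_cv_eq_zero k (by omega), map_zero, sub_zero]

theorem cv_ne_zero (k : ℤ) : B.cv k ≠ 0 := by
  induction k using Int.induction_on with
  | zero => exact B.v_ne
  | succ k ih => exact fun h => ih (by rw [← d_cv, h, map_zero])
  | pred k ih => exact fun h => ih (by rw [← sub_add_cancel (-(k : ℤ)) 1, ← c_cv, h, map_zero])

/-- An operator whose commutators with the modes raise the charged vacua acts on all of them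
diagonally once it does so on the vacuum. -/
theorem eigen_cv {X : Module.End ℂ M} {χ : ℤ → ℂ}
    (hc : ∀ k, X (B.cv k) = χ k • B.cv k →
      X (B.c (-k) (B.cv k)) = χ (k + 1) • B.c (-k) (B.cv k))
    (hd : ∀ k, X (B.cv (k + 1)) = χ (k + 1) • B.cv (k + 1) →
      X (B.d (k + 1) (B.cv (k + 1))) = χ k • B.d (k + 1) (B.cv (k + 1)))
    (h0 : X B.v = χ 0 • B.v) (k : ℤ) : X (B.cv k) = χ k • B.cv k := by
  induction k using Int.induction_on with
  | zero => exact h0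
  | succ k ih => rw [← c_cv]; exact hc k ih
  | pred k ih =>
    rw [← d_cv]
    refine hd _ ?_
    rw [sub_add_cancel]
    exact ih

/-- The modes added have energies `1, 3, 5, …`, whose partial sums are squares. -/
theorem energy_cv (k : ℤ) : B.energy (B.cv k) = ((k : ℂ) ^ 2) • B.cv k := by
  refine B.eigen_cv (χ := fun k => (k : ℂ) ^ 2) (fun k hk => ?_) (fun k hk => ?_) ?_ k
  · rw [energy_c, hk, map_smul, ← add_smul]
    congr 1
    push_cast
    ring
  · rw [energy_d, hk, map_smul, ← add_smul]
    congr 1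
    push_cast
    ring
  · rw [energy_vac]; simp

theorem J_zero_cv (k : ℤ) : B.J 0 (B.cv k) = (-(k : ℂ)) • B.cv k := by
  refine B.eigen_cv (χ := fun k => -(k : ℂ)) (fun k hk => ?_) (fun k hk => ?_) ?_ k
  · rw [J_c, hk, map_smul, zero_add]
    push_cast
    module
  · rw [J_d, hk, map_smul, zero_add]
    push_cast
    module
  · rw [B.J_vac le_rfl]; simp

theorem J_pos_cv {n : ℤ} (hn : 1 ≤ n) (k : ℤ) : B.J n (B.cv k) = 0 := by
  have := B.eigen_cv (X := B.J n) (χ := fun _ => 0) (fun k hk => ?_) (fun k hk => ?_) ?_ k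
  · simpa using this
  · rw [J_c, hk, B.c_cv_eq_zero k (by omega)]; simp
  · rw [J_d, hk, B.d_cv_eq_zero _ (by omega)]; simp
  · rw [B.J_vac (by omega), zero_smul]

/-! ### The boson-fermion correspondence -/

/-- Heisenberg creation operators. -/
noncomputable def Jcr (n : ℕ) (u : M) : M := B.J (-((n : ℤ) + 1)) u

instance : LeftCommutative B.Jcr :=
  ⟨fun m n u => B.J_comm_apply (by omega) u⟩

/-- Monomials in the Heisenberg creation operators applied to the charged vacua. -/
noncomputable def jmon (i : ℤ × Multiset ℕ) : M :=
  i.2.foldr B.Jcr (B.cv i.1)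

theorem jmon_zero (k : ℤ) : B.jmon (k, 0) = B.cv k := rfl

theorem jmon_cons (k : ℤ) (n : ℕ) (μ : Multiset ℕ) :
    B.jmon (k, n ::ₘ μ) = B.J (-(n + 1)) (B.jmon (k, μ)) :=
  Multiset.foldr_cons _ _ _ _

/-- The energy of a monomial. -/
def deg (i : ℤ × Multiset ℕ) : ℕ := i.1.natAbs ^ 2 + 2 * (i.2.map (· + 1)).sum

theorem deg_cons (k : ℤ) (n : ℕ) (μ : Multiset ℕ) :
    deg (k, n ::ₘ μ) = deg (k, μ) + (2 * n + 2) := by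
  simp only [deg, Multiset.map_cons, Multiset.sum_cons]; ring

theorem energy_jmon (i : ℤ × Multiset ℕ) : B.energy (B.jmon i) = (deg i : ℂ) • B.jmon i := by
  obtain ⟨k, μ⟩ := i
  induction μ using Multiset.induction_on with
  | empty =>
    rw [jmon_zero, energy_cv]
    congr 1
    simp only [deg, Multiset.map_zero, Multiset.sum_zero, mul_zero, add_zero]
    rw [← Int.cast_natCast, Nat.cast_pow, Int.natAbs_sq]
    push_cast
    rfl
  | cons n μ ih =>
    rw [jmon_cons, energy_J, ih, map_smul, ← add_smul, deg_cons]
    congr 1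
    push_cast
    ring

theorem J_zero_jmon (i : ℤ × Multiset ℕ) : B.J 0 (B.jmon i) = (-(i.1 : ℂ)) • B.jmon i := by
  obtain ⟨k, μ⟩ := i
  induction μ using Multiset.induction_on with
  | empty => exact B.J_zero_cv k
  | cons n μ ih => rw [jmon_cons, B.J_comm_apply (by omega), ih, map_smul]

/-- `J (n + 1)` kills the charged vacua and acts as `n + 1` times the partial derivative in the
variable `J (-(n + 1))`. -/
theorem J_pos_jmon (n : ℕ) (k : ℤ) (μ : Multiset ℕ) :
    B.J (n + 1) (B.jmon (k, μ))
      = (((n : ℂ) + 1) * μ.count n) • B.jmon (k, μ.erase n) := by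
  induction μ using Multiset.induction_on with
  | empty => rw [jmon_zero, B.J_pos_cv (by omega)]; simp
  | cons a μ ih =>
    rw [jmon_cons, J_pos_neg, ih, map_smul, Multiset.count_cons]
    rcases eq_or_ne n a with rfl | h
    · rw [if_pos rfl, if_pos rfl, Multiset.erase_cons_head]
      by_cases hn : n ∈ μ
      · rw [← jmon_cons, Multiset.cons_erase hn, ← add_smul]
        congr 1
        push_cast
        ring
      · rw [Multiset.count_eq_zero_of_notMem hn]
        simp
    · rw [if_neg h, if_neg h, Multiset.erase_cons_tail _ (Ne.symm h), zero_smul, add_zero, add_zero,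
        jmon_cons]

/-- Number operators: their eigenvalues recover the multiplicities of a monomial, which is what
separates monomials of equal charge. -/
theorem J_number_jmon (n : ℕ) (i : ℤ × Multiset ℕ) :
    (B.J (-(n + 1)) * B.J (n + 1)) (B.jmon i) = (((n : ℂ) + 1) * i.2.count n) • B.jmon i := by
  obtain ⟨k, μ⟩ := i
  rw [Module.End.mul_apply, J_pos_jmon, map_smul, ← jmon_cons]
  by_cases hn : n ∈ μ
  · rw [Multiset.cons_erase hn]
  · simp [Multiset.count_eq_zero_of_notMem hn]

theorem jmon_ne_zero (i : ℤ × Multiset ℕ) : B.jmon i ≠ 0 := by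
  obtain ⟨k, μ⟩ := i
  induction μ using Multiset.induction_on with
  | empty => exact B.cv_ne_zero k
  | cons n μ ih =>
    intro h
    have := B.J_pos_jmon n k (n ::ₘ μ)
    rw [h, map_zero, Multiset.erase_cons_head, Multiset.count_cons_self] at this
    exact smul_ne_zero (mul_ne_zero (Nat.cast_add_one_ne_zero n)
      (Nat.cast_ne_zero.mpr (Nat.succ_ne_zero _))) ih this.symm

end BCSystem

/-! ### Independence of joint eigenvectors and fermionic Newton identities -/

/-- Nonzero joint eigenvectors with pairwise different characters are linearly independent. -/
theorem linearIndependent_of_joint_eigenvectors {M ι κ : Type*} [AddCommGroup M] [Module ℂ M]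
    {x : ι → M} (hx : ∀ i, x i ≠ 0) (X : κ → Module.End ℂ M) (χ : κ → ι → ℂ)
    (hX : ∀ a i, X a (x i) = χ a i • x i) (hχ : ∀ i j, i ≠ j → ∃ a, χ a i ≠ χ a j) :
    LinearIndependent ℂ x := by
  classical
  have key : ∀ (j : ι) (s : Finset ι), j ∉ s → ∀ g : ι → ℂ,
      g j • x j + ∑ i ∈ s, g i • x i = 0 → g j = 0 := by
    intro j s
    induction s using Finset.induction_on with
    | empty =>
      intro _ g h
      rw [Finset.sum_empty, add_zero] at h
      exact (smul_eq_zero.mp h).resolve_right (hx j)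
    | insert b s hb ih =>
      intro hj g h
      rw [Finset.mem_insert, not_or] at hj
      obtain ⟨a, ha⟩ := hχ j b hj.1
      -- This operator removes the term of `b` and multiplies the coefficient of `j` by a nonzero
      -- number, leaving a shorter relation.
      have h1 := congrArg (fun u => X a u - χ a b • u) h
      simp only [Finset.sum_insert hb, map_add, map_smul, map_sum, hX, map_zero, smul_zero,
        sub_zero] at h1
      have h2 : (g j * (χ a j - χ a b)) • x j
          + ∑ i ∈ s, (g i * (χ a i - χ a b)) • x i = 0 := by
        rw [← h1]
        have : ∀ i, (g i * (χ a i - χ a b)) • x i = g i • χ a i • x i - χ a b • g i • x i := by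
          intro i; module
        simp only [this, Finset.sum_sub_distrib, smul_add, Finset.smul_sum]
        rw [smul_comm (χ a b) (g b)]
        abel
      exact (mul_eq_zero.mp (ih hj.2 (fun i => g i * (χ a i - χ a b)) h2)).resolve_right
        (sub_ne_zero.mpr ha)
  rw [linearIndependent_iff']
  intro s g hg j hj
  refine key j (s.erase j) (Finset.notMem_erase j s) g ?_
  rw [Finset.add_sum_erase s (fun i => g i • x i) hj, hg]

/-- Newton's identities for fermions. -/
theorem newton_identity {M : Type*} [AddCommGroup M] [Module ℂ M] {x : ℤ → Module.End ℂ M}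
    (hxx : ∀ m n u, x m (x n u) = -x n (x m u)) {J : ℕ → Module.End ℂ M} {σ : ℂ}
    (hJ : ∀ j m u, J j (x m u) = x m (J j u) + σ • x (m - j) u) {N : ℤ} {w : M} {y : ℕ → M}
    (hw : ∀ j, 1 ≤ j → J j w = ∑ i ∈ Finset.range j, x (N - i) (y (j - i))) (n : ℕ) :
    ∑ a ∈ Finset.range n, J (n - a) (x (N - a) w) = (n * σ) • x (N - n) w := by
  have e : ∀ a ∈ Finset.range n, J (n - a) (x (N - a) w)
      = ∑ i ∈ Finset.range (n - a), x (N - a) (x (N - i) (y (n - (a + i)))) + σ • x (N - n) w := by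
    intro a ha
    rw [Finset.mem_range] at ha
    rw [hJ, hw _ (by omega), map_sum, show N - a - ((n - a : ℕ) : ℤ) = N - n by omega]
    congr 1
    refine Finset.sum_congr rfl fun i _ => ?_
    rw [Nat.sub_sub]
  rw [Finset.sum_congr rfl e, Finset.sum_add_distrib, Finset.sum_const, Finset.card_range,
    ← Nat.cast_smul_eq_nsmul ℂ, smul_smul,
    ← Finset.sum_range_diag_flip n fun a i => x (N - a) (x (N - i) (y (n - (a + i))))]
  -- On each antidiagonal the terms quadratic in `x` cancel in pairs, since exchanging `a` and `i`
  -- changes only their sign.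
  rw [Finset.sum_eq_zero, zero_add]
  intro s _
  refine eq_zero_of_eq_neg ?_
  rw [← Finset.Nat.sum_antidiagonal_eq_sum_range_succ
    (fun a i => x (N - a) (x (N - i) (y (n - (a + i)))))]
  nth_rewrite 1 [← Finset.Nat.sum_antidiagonal_swap]
  rw [← Finset.sum_neg_distrib]
  refine Finset.sum_congr rfl fun p _ => ?_
  simp only [Prod.fst_swap, Prod.snd_swap]
  rw [hxx, add_comm p.2]

/-- The identity expresses `(n * σ) • x (N - n) w` through `J` applied to the vectors `x (N - a) w`
with `a < n`. So a subspace stable under the `J j` and containing the first vector contains all of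
them. -/
theorem newton_mem {M : Type*} [AddCommGroup M] [Module ℂ M] {x : ℤ → Module.End ℂ M}
    (hxx : ∀ m n u, x m (x n u) = -x n (x m u)) {J : ℕ → Module.End ℂ M} {σ : ℂ} (hσ : σ ≠ 0)
    (hJ : ∀ j m u, J j (x m u) = x m (J j u) + σ • x (m - j) u) {N : ℤ} {w : M} {y : ℕ → M}
    (hw : ∀ j, 1 ≤ j → J j w = ∑ i ∈ Finset.range j, x (N - i) (y (j - i)))
    {W : Submodule ℂ M} (hW : ∀ j, 1 ≤ j → ∀ u ∈ W, J j u ∈ W) (h0 : x N w ∈ W) (n : ℕ) :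
    x (N - n) w ∈ W := by
  induction n using Nat.strong_induction_on with
  | _ n ih =>
    rcases Nat.eq_zero_or_pos n with rfl | hn
    · simpa using h0
    · have h := newton_identity hxx hJ hw n
      have hne : ((n : ℂ) * σ) ≠ 0 := mul_ne_zero (Nat.cast_ne_zero.mpr (by omega)) hσ
      rw [← W.smul_mem_iff hne, ← h]
      refine W.sum_mem fun a ha => ?_
      rw [Finset.mem_range] at ha
      exact hW _ (by omega) _ (ih a ha)

/-! ### The bosonic basis of the fermionic Fock space -/

namespace BCSystem

variable {M : Type*} [AddCommGroup M] [Module ℂ M] (B : BCSystem M)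

/-- For `n ≠ 0` the two factors anticommute, so either can be placed on the left. This yields
expansions of `J (-n)` on charged vacua with `c` in front or with `d` in front, as Newton's
identities require for each kind of mode. -/
theorem pairNO_apply {n : ℤ} (hn : n ≠ 0) (j : ℤ) (u : M) :
    B.pairNO n j u = B.d (n + 1 - j) (B.c j u) ∧
      B.pairNO n j u = -B.c j (B.d (n + 1 - j) u) := by
  have h := B.dc_apply (n + 1 - j) j u
  rw [if_neg (by omega), zero_sub] at h
  rw [pairNO]
  split_ifs
  · exact ⟨rfl, h⟩
  · exact ⟨h.symm, rfl⟩

theorem J_neg_cv {n : ℕ} (hn : 1 ≤ n) (k : ℤ) :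
    B.J (-n) (B.cv k) = ∑ i ∈ Finset.range n, B.pairNO (-n) (-k - i) (B.cv k) := by
  have hinj : Function.Injective fun i : ℕ => -k - (i : ℤ) := fun a b h => by simpa using h
  rw [J, quad, lfsum_apply_eq_sum (B.locFin_pairNO _ _)
    (s := (Finset.range n).image fun i : ℕ => -k - (i : ℤ)), Finset.sum_image hinj.injOn]
  · simp only [one_smul]
  · intro j hj
    rw [one_smul]
    have hj' : 1 - k ≤ j ∨ 1 + k ≤ -(n : ℤ) + 1 - j := by
      by_contra! hlt
      exact hj (Finset.mem_image.mpr ⟨(-k - j).toNat, Finset.mem_range.mpr (by omega), by omega⟩)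
    obtain ⟨h1, h2⟩ := B.pairNO_apply (n := -n) (by omega) j (B.cv k)
    rcases hj' with h | h
    · rw [h1, B.c_cv_eq_zero k h, map_zero]
    · rw [h2, B.d_cv_eq_zero k h, map_zero, neg_zero]

theorem J_neg_cv_c {n : ℕ} (hn : 1 ≤ n) (k : ℤ) :
    B.J (-n) (B.cv k)
      = ∑ i ∈ Finset.range n, B.c (-k - i) (-B.d (1 + k - (n - i : ℕ)) (B.cv k)) := by
  rw [B.J_neg_cv hn]
  refine Finset.sum_congr rfl fun i hi => ?_
  rw [Finset.mem_range] at hi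
  rw [(B.pairNO_apply (by omega) _ _).2, map_neg, Nat.cast_sub hi.le]
  congr 4
  ring

theorem J_neg_cv_d {n : ℕ} (hn : 1 ≤ n) (k : ℤ) :
    B.J (-n) (B.cv k)
      = ∑ i ∈ Finset.range n, B.d (k - i) (B.c (1 - k - (n - i : ℕ)) (B.cv k)) := by
  rw [B.J_neg_cv hn, ← Finset.sum_range_reflect]
  refine Finset.sum_congr rfl fun i hi => ?_
  rw [Finset.mem_range] at hi
  rw [(B.pairNO_apply (by omega) _ _).1, Nat.cast_sub hi.le]
  have e : ((n - 1 - i : ℕ) : ℤ) = n - 1 - i := by omega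
  rw [e, show -(n : ℤ) + 1 - (-k - (n - 1 - i)) = k - i by ring,
    show -k - ((n : ℤ) - 1 - i) = 1 - k - (n - i) by ring]

theorem c_cv_mem {W : Submodule ℂ M} (hW : ∀ n : ℕ, 1 ≤ n → ∀ u ∈ W, B.J (-n) u ∈ W)
    (hcv : ∀ k, B.cv k ∈ W) (k n : ℤ) : B.c n (B.cv k) ∈ W := by
  rcases le_or_gt (1 - k) n with h | h
  · rw [B.c_cv_eq_zero k h]; exact W.zero_mem
  · have := newton_mem (x := B.c) B.cc_apply (J := fun n : ℕ => B.J (-n)) (σ := -1) (N := -k) (w := B.cv k)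
      (y := fun s : ℕ => -B.d (1 + k - s) (B.cv k)) (by simp)
      (fun j m u => by rw [J_c, neg_one_smul, ← sub_eq_add_neg, neg_add_eq_sub])
      (fun j hj => B.J_neg_cv_c hj k) hW (by rw [c_cv]; exact hcv _) (-k - n).toNat
    rwa [show -k - (((-k - n).toNat : ℕ) : ℤ) = n by omega] at this

theorem d_cv_mem {W : Submodule ℂ M} (hW : ∀ n : ℕ, 1 ≤ n → ∀ u ∈ W, B.J (-n) u ∈ W)
    (hcv : ∀ k, B.cv k ∈ W) (k n : ℤ) : B.d n (B.cv k) ∈ W := by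
  rcases le_or_gt (1 + k) n with h | h
  · rw [B.d_cv_eq_zero k h]; exact W.zero_mem
  · have h0 : B.d k (B.cv k) ∈ W := by
      have := B.d_cv (k - 1)
      rw [sub_add_cancel] at this
      rw [this]
      exact hcv _
    have := newton_mem (x := B.d) B.dd_apply (J := fun n : ℕ => B.J (-n)) (σ := 1) (N := k) (w := B.cv k)
      (y := fun s : ℕ => B.c (1 - k - s) (B.cv k)) (by simp)
      (fun j m u => by rw [J_d, one_smul, neg_add_eq_sub])
      (fun j hj => B.J_neg_cv_d hj k) hW h0 (k - n).toNat
    rwa [show k - (((k - n).toNat : ℕ) : ℤ) = n by omega] at this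

/-- The bosonic monomials span the fermionic Fock space. -/
theorem span_jmon : Submodule.span ℂ (Set.range B.jmon) = ⊤ := by
  set W := Submodule.span ℂ (Set.range B.jmon) with hWdef
  have hmon : ∀ i, B.jmon i ∈ W := fun i => Submodule.subset_span ⟨i, rfl⟩
  have hJ : ∀ n : ℕ, ∀ u ∈ W, B.J (-(n + 1)) u ∈ W := by
    intro n u hu
    induction hu using Submodule.span_induction with
    | mem u hu =>
      obtain ⟨⟨k, μ⟩, rfl⟩ := hu
      rw [← jmon_cons]
      exact hmon _
    | zero => rw [map_zero]; exact W.zero_mem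
    | add x y _ _ hx hy => rw [map_add]; exact W.add_mem hx hy
    | smul t x _ hx => rw [map_smul]; exact W.smul_mem _ hx
  have hJ' : ∀ n : ℕ, 1 ≤ n → ∀ u ∈ W, B.J (-n) u ∈ W := by
    intro n hn u hu
    obtain ⟨m, rfl⟩ : ∃ m, n = m + 1 := ⟨n - 1, by omega⟩
    have := hJ m u hu
    rwa [← Nat.cast_succ] at this
  have hcv : ∀ k, B.cv k ∈ W := fun k => hmon (k, 0)
  -- A mode moves past a Heisenberg creation operator at the cost of another mode of the same kind,
  -- so stability of `W` reduces to the charged vacua.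
  have step : ∀ x : ℤ → Module.End ℂ M, (∀ k n, x n (B.cv k) ∈ W) →
      (∀ (m : ℕ) n u, ∃ t : ℂ, x n (B.J (-(m + 1)) u)
        = B.J (-(m + 1)) (x n u) + t • x (n - (m + 1)) u) → ∀ n, ∀ u ∈ W, x n u ∈ W := by
    intro x hx hxJ n u hu
    induction hu using Submodule.span_induction with
    | mem u hu =>
      obtain ⟨⟨k, μ⟩, rfl⟩ := hu
      induction μ using Multiset.induction_on generalizing n with
      | empty => exact hx k n
      | cons m μ ih =>
        rw [jmon_cons]
        obtain ⟨t, ht⟩ := hxJ m n (B.jmon (k, μ))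
        rw [ht]
        exact W.add_mem (hJ m _ (ih n)) (W.smul_mem _ (ih _))
    | zero => rw [map_zero]; exact W.zero_mem
    | add x y _ _ hx hy => rw [map_add]; exact W.add_mem hx hy
    | smul t x _ hx => rw [map_smul]; exact W.smul_mem _ hx
  refine B.gen W (hcv 0) (step B.c (B.c_cv_mem hJ' hcv) fun m n u => ⟨1, ?_⟩)
    (step B.d (B.d_cv_mem hJ' hcv) fun m n u => ⟨-1, ?_⟩)
  · rw [J_c, one_smul, show -((m : ℤ) + 1) + n = n - (m + 1) by ring]; abel
  · rw [J_d, neg_one_smul, show -((m : ℤ) + 1) + n = n - (m + 1) by ring]; abel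

/-- The commuting observables are the charge `J 0` (index `none`) and the number operators (index
`some n`); together they recover the charge and the multiset. -/
theorem linearIndependent_jmon : LinearIndependent ℂ B.jmon := by
  refine linearIndependent_of_joint_eigenvectors B.jmon_ne_zero
    (X := fun a : Option ℕ => a.elim (B.J 0) fun n => B.J (-(n + 1)) * B.J (n + 1))
    (χ := fun a i => a.elim (-(i.1 : ℂ)) fun n => ((n : ℂ) + 1) * i.2.count n) ?_ ?_
  · rintro (_ | n) i
    · exact B.J_zero_jmon i
    · exact B.J_number_jmon n i
  · rintro ⟨k, μ⟩ ⟨l, ν⟩ hne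
    by_contra! h
    refine hne (Prod.ext ?_ (Multiset.ext.mpr fun n => ?_))
    · have := h none
      simpa using this
    · have := h (some n)
      simp only [Option.elim_some] at this
      have hn : ((n : ℂ) + 1) ≠ 0 := by exact_mod_cast Nat.succ_ne_zero n
      exact_mod_cast mul_left_cancel₀ hn this

/-- The bosonic basis of the fermionic Fock space. -/
noncomputable def jbasis : Module.Basis (ℤ × Multiset ℕ) ℂ M :=
  Module.Basis.mk B.linearIndependent_jmon B.span_jmon.ge

theorem jbasis_apply (i : ℤ × Multiset ℕ) : B.jbasis i = B.jmon i := Module.Basis.mk_apply _ _ i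

end BCSystem

/-! ### Virasoro monomials are triangular over the bosonic basis -/

/-- A family which is unitriangular with respect to a basis, up to nonzero scalars, is a basis. -/
theorem linearIndependent_and_span_of_triangular {M ι : Type*} [AddCommGroup M] [Module ℂ M]
    (b : Module.Basis ι ℂ M) (deg : ι → ℕ) {x : ι → M} {a : ι → ℂ} (ha : ∀ i, a i ≠ 0)
    (hx : ∀ i, x i - a i • b i ∈ Submodule.span ℂ (b '' {j | deg j < deg i})) :
    LinearIndependent ℂ x ∧ Submodule.span ℂ (Set.range x) = ⊤ := by
  classical
  constructor
  · rw [linearIndependent_iff']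
    intro s g hg
    by_contra! hne
    obtain ⟨i₁, hi₁, hgi₁⟩ := hne
    -- In a relation, look at the coordinate of an index of maximal degree: corrections have
    -- strictly smaller degree, so only that index contributes, even if the degree is attained
    -- several times.
    obtain ⟨i₀, hi₀, hmax⟩ := Finset.exists_max_image (s.filter fun i => g i ≠ 0) deg
      ⟨i₁, Finset.mem_filter.mpr ⟨hi₁, hgi₁⟩⟩
    rw [Finset.mem_filter] at hi₀
    have hrepr : ∀ i, deg i ≤ deg i₀ → b.repr (x i) i₀ = if i = i₀ then a i else 0 := by
      intro i hi
      have h := (Module.Basis.mem_span_image b).mp (hx i)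
      have h0 : b.repr (x i - a i • b i) i₀ = 0 := by
        by_contra hne
        have := h (Finsupp.mem_support_iff.mpr hne)
        simp only [Set.mem_ofPred_eq] at this
        omega
      rw [map_sub, map_smul, Finsupp.sub_apply, Finsupp.smul_apply, b.repr_self,
        sub_eq_zero] at h0
      rw [h0, Finsupp.single_apply, smul_eq_mul]
      split_ifs <;> simp
    have h := congrArg (fun u => b.repr u i₀) hg
    simp only [map_sum, map_smul, map_zero, Finsupp.coe_zero, Pi.zero_apply,
      Finsupp.finsetSum_apply, Finsupp.smul_apply, smul_eq_mul] at h
    rw [Finset.sum_eq_single i₀] at h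
    · rw [hrepr i₀ le_rfl, if_pos rfl] at h
      exact (mul_ne_zero hi₀.2 (ha i₀)) h
    · intro i hi hne
      by_cases hgi : g i = 0
      · rw [hgi, zero_mul]
      · rw [hrepr i (hmax i (Finset.mem_filter.mpr ⟨hi, hgi⟩)), if_neg hne, mul_zero]
    · exact fun h => absurd hi₀.1 h
  · set W := Submodule.span ℂ (Set.range x) with hW
    have key : ∀ (n : ℕ) (i : ι), deg i = n → b i ∈ W := by
      intro n
      induction n using Nat.strong_induction_on with
      | _ n ih =>
        intro i hi
        have hlow : Submodule.span ℂ (b '' {j | deg j < deg i}) ≤ W := by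
          rw [Submodule.span_le]
          rintro _ ⟨j, hj, rfl⟩
          exact ih (deg j) (hi ▸ hj) j rfl
        rw [← W.smul_mem_iff (ha i), ← W.sub_mem_iff_right (Submodule.subset_span ⟨i, rfl⟩)]
        exact hlow (hx i)
    rw [eq_top_iff, ← b.span_eq, Submodule.span_le]
    rintro _ ⟨i, rfl⟩
    exact key _ i rfl

namespace BCSystem

variable {M : Type*} [AddCommGroup M] [Module ℂ M] (B : BCSystem M)

/-- The span of the bosonic monomials of energy less than `D`. -/
def flt (D : ℕ) : Submodule ℂ M := Submodule.span ℂ (B.jbasis '' {i | deg i < D})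

theorem flt_mono {D E : ℕ} (h : D ≤ E) : B.flt D ≤ B.flt E :=
  Submodule.span_mono (Set.image_mono fun _ hi => lt_of_lt_of_le hi h)

theorem jmon_mem_flt {i : ℤ × Multiset ℕ} {D : ℕ} (h : deg i < D) : B.jmon i ∈ B.flt D :=
  Submodule.subset_span ⟨i, h, B.jbasis_apply i⟩

theorem repr_energy (u : M) (i : ℤ × Multiset ℕ) :
    B.jbasis.repr (B.energy u) i = (deg i : ℂ) * B.jbasis.repr u i := by
  have h : (Finsupp.lapply i).comp (B.jbasis.repr.toLinearMap.comp B.energy)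
      = (deg i : ℂ) • (Finsupp.lapply i).comp B.jbasis.repr.toLinearMap := by
    refine B.jbasis.ext fun j => ?_
    simp only [LinearMap.comp_apply, LinearEquiv.coe_coe, Finsupp.lapply_apply,
      LinearMap.smul_apply, smul_eq_mul]
    rw [jbasis_apply, energy_jmon, ← jbasis_apply, map_smul, Module.Basis.repr_self,
      Finsupp.smul_apply, smul_eq_mul]
    rcases eq_or_ne j i with rfl | h
    · rfl
    · rw [Finsupp.single_eq_of_ne h.symm, mul_zero, mul_zero]
  exact congrArg (fun f => f u) h

/-- The bosonic basis diagonalizes the energy, so an eigenvector involves only basis vectors with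
its own eigenvalue. -/
theorem mem_flt_of_energy {u : M} {d D : ℕ} (h : B.energy u = (d : ℂ) • u) (hD : d < D) :
    u ∈ B.flt D := by
  rw [flt, Module.Basis.mem_span_image]
  intro i hi
  have h1 := B.repr_energy u i
  rw [h, map_smul, Finsupp.smul_apply, smul_eq_mul] at h1
  have h2 := mul_right_cancel₀ (Finsupp.mem_support_iff.mp hi) h1
  have h3 : d = deg i := by exact_mod_cast h2
  simp only [Set.mem_ofPred_eq]
  omega

theorem map_flt {X : Module.End ℂ M} {D e : ℕ}
    (h : ∀ i, deg i < D → X (B.jmon i) ∈ B.flt e) {u : M} (hu : u ∈ B.flt D) : X u ∈ B.flt e := by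
  induction hu using Submodule.span_induction with
  | mem u hu =>
    obtain ⟨i, hi, rfl⟩ := hu
    rw [jbasis_apply]
    exact h i hi
  | zero => rw [map_zero]; exact Submodule.zero_mem _
  | add x y _ _ hx hy => rw [map_add]; exact Submodule.add_mem _ hx hy
  | smul t x _ hx => rw [map_smul]; exact Submodule.smul_mem _ _ hx

/-- A quadratic operator of index `-n` raises energy by `2 * n`, while the current in `L (-n)` has
index `-n - 1` and raises it by `2 * n + 2`. This gap makes the current the leading term. -/
theorem quad_mem_flt (f : ℤ → ℂ) (n : ℕ) {D : ℕ} {u : M} (hu : u ∈ B.flt D) :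
    B.quad f (-n) u ∈ B.flt (D + 2 * n) := by
  refine B.map_flt (fun i hi => B.mem_flt_of_energy (d := deg i + 2 * n) ?_ (by omega)) hu
  rw [energy_quad, energy_jmon, map_smul, ← add_smul]
  congr 1
  push_cast
  ring

theorem J_mem_flt (n : ℕ) {D : ℕ} {u : M} (hu : u ∈ B.flt D) :
    B.J (-(n + 1)) u ∈ B.flt (D + (2 * n + 2)) := by
  refine B.map_flt (fun i hi => ?_) hu
  rw [← jmon_cons]
  refine B.jmon_mem_flt ?_
  rw [deg_cons]
  have : deg (i.1, i.2) = deg i := rfl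
  omega

variable {L : ℤ → Module.End ℂ M} {ξ ε : ℂ}

/-- The commutators of `L n` with the modes contain a shift by `n` and a shift by `n - 1`. The
second is that of `ξ • J (n - 1)`; what remains is that of a quadratic operator, and the modes
determine an operator up to a scalar. -/
theorem eq_current_add (hc : ∀ n m, L n * B.c m - B.c m * L n
      = -((m : ℂ) + ε) • B.c (n + m) - ξ • B.c (n + m - 1))
    (hd : ∀ n m, L n * B.d m - B.d m * L n
      = (ε - (n + m - 1)) • B.d (n + m) + ξ • B.d (n + m - 1)) (n : ℤ) :
    ∃ t : ℂ, L n = ξ • B.J (n - 1) + B.quad (fun j => j - n + ε) n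
      + t • (1 : Module.End ℂ M) := by
  have hJc : ∀ m, B.J (n - 1) * B.c m - B.c m * B.J (n - 1) = -B.c (n + m - 1) := by
    intro m
    rw [J, quad_commutator_c, neg_one_smul, show n - 1 + m = n + m - 1 by ring]
  have hJd : ∀ m, B.J (n - 1) * B.d m - B.d m * B.J (n - 1) = B.d (n + m - 1) := by
    intro m
    rw [J, quad_commutator_d, one_smul, show n - 1 + m = n + m - 1 by ring]
  have e : ∀ z, (L n - ξ • B.J (n - 1)) * z - z * (L n - ξ • B.J (n - 1))
      = (L n * z - z * L n) - ξ • (B.J (n - 1) * z - z * B.J (n - 1)) := by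
    intro z
    rw [sub_mul, mul_sub, smul_mul_assoc, mul_smul_comm, smul_sub]
    abel
  obtain ⟨t, ht⟩ := B.eq_quad_add_scalar (X := L n - ξ • B.J (n - 1)) (n := n)
    (f := fun j => j - n + ε)
    (fun m => by rw [e, hc, hJc]; push_cast; module)
    (fun m => by rw [e, hd, hJd]; push_cast; module)
  exact ⟨t, by rw [sub_eq_iff_eq_add] at ht; rw [ht]; abel⟩

/-- Monomials in the operators `L_{-n}`, `n ≥ 0`, applied to a charged vacuum. -/
def lmon (L : ℤ → Module.End ℂ M) (k : ℤ) (l : List ℕ) : M :=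
  l.foldr (fun (n : ℕ) u => L (-n) u) (B.cv k)

/-- Each factor `L (-n)` may be replaced by `ξ • J (-(n + 1))` modulo lower energy: its quadratic
and scalar parts raise energy less, and by induction so does the error already present. -/
theorem lmon_sub_mem (hL : ∀ n, ∃ t : ℂ, L n = ξ • B.J (n - 1) + B.quad (fun j => j - n + ε) n
      + t • (1 : Module.End ℂ M)) (k : ℤ) (l : List ℕ) :
    B.lmon L k l - ξ ^ l.length • B.jmon (k, l) ∈ B.flt (deg (k, (l : Multiset ℕ))) := by
  induction l with
  | nil =>
    rw [lmon, List.foldr_nil, List.length_nil, pow_zero, one_smul, Multiset.coe_nil, jmon_zero,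
      sub_self]
    exact Submodule.zero_mem _
  | cons n l ih =>
    set d := deg (k, (l : Multiset ℕ)) with hd
    set ρ := B.lmon L k l - ξ ^ l.length • B.jmon (k, l) with hρ
    have hx : B.lmon L k l = ξ ^ l.length • B.jmon (k, l) + ρ := by rw [hρ]; abel
    have hxm : B.lmon L k l ∈ B.flt (d + 1) := by
      rw [hx]
      exact Submodule.add_mem _ (Submodule.smul_mem _ _ (B.jmon_mem_flt (Nat.lt_succ_self _)))
        (B.flt_mono (Nat.le_succ _) ih)
    obtain ⟨t, ht⟩ := hL (-n)
    rw [← Multiset.cons_coe, deg_cons, jmon_cons, List.length_cons]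
    have e : B.lmon L k (n :: l) - ξ ^ (l.length + 1) • B.J (-(n + 1)) (B.jmon (k, l))
        = ξ • B.J (-(n + 1)) ρ + B.quad (fun j => j - (-n : ℤ) + ε) (-n) (B.lmon L k l)
          + t • B.lmon L k l := by
      rw [show B.lmon L k (n :: l) = L (-n) (B.lmon L k l) from rfl, ht]
      simp only [LinearMap.add_apply, LinearMap.smul_apply, Module.End.one_apply]
      rw [show -(n : ℤ) - 1 = -(n + 1) by ring]
      nth_rewrite 1 [hx]
      rw [map_add, map_smul]
      module
    rw [e]
    refine Submodule.add_mem _ (Submodule.add_mem _ (Submodule.smul_mem _ _ (B.J_mem_flt n ih)) ?_)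
      (Submodule.smul_mem _ _ (B.flt_mono (by omega) hxm))
    exact B.flt_mono (by omega) (B.quad_mem_flt _ n hxm)

/-- Sorted monomials in the Virasoro operators form a basis. -/
theorem linearIndependent_and_span_lmon (hξ : ξ ≠ 0) (hL : ∀ n, ∃ t : ℂ,
      L n = ξ • B.J (n - 1) + B.quad (fun j => j - n + ε) n + t • (1 : Module.End ℂ M)) :
    LinearIndependent ℂ (fun i : ℤ × Multiset ℕ => B.lmon L i.1 (i.2.sort (· ≤ ·))) ∧
      Submodule.span ℂ (Set.range fun i : ℤ × Multiset ℕ => B.lmon L i.1 (i.2.sort (· ≤ ·))) = ⊤ := by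
  refine linearIndependent_and_span_of_triangular B.jbasis deg
    (a := fun i => ξ ^ (i.2.sort (· ≤ ·)).length) (fun i => pow_ne_zero _ hξ) fun i => ?_
  have h := B.lmon_sub_mem hL i.1 (i.2.sort (· ≤ ·))
  rw [Multiset.sort_eq] at h
  rw [jbasis_apply]
  exact h

/-- Most terms of the commutators vanish on charged vacua. For `n = 1` the term with `ξ` survives:
it gives back the next vacuum and lowers the eigenvalue by `ξ` for each unit of charge. -/
theorem L_pos_cv (hc : ∀ n m, L n * B.c m - B.c m * L n
      = -((m : ℂ) + ε) • B.c (n + m) - ξ • B.c (n + m - 1))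
    (hd : ∀ n m, L n * B.d m - B.d m * L n
      = (ε - (n + m - 1)) • B.d (n + m) + ξ • B.d (n + m - 1)) {n : ℤ} (hn : 1 ≤ n) {t : ℂ}
    (ht : L n B.v = t • B.v) (k : ℤ) :
    L n (B.cv k) = (t - if n = 1 then ξ * k else 0) • B.cv k := by
  refine B.eigen_cv (χ := fun k => t - if n = 1 then ξ * k else 0) (fun k hk => ?_)
    (fun k hk => ?_) ?_ k
  · have h := congrArg (fun Z : Module.End ℂ M => Z (B.cv k)) (hc n (-k))
    simp only [LinearMap.sub_apply, Module.End.mul_apply, LinearMap.smul_apply] at h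
    rw [sub_eq_iff_eq_add] at h
    rw [h, hk, map_smul, B.c_cv_eq_zero k (n := n + -k) (by omega)]
    split_ifs with h1
    · rw [h1, show 1 + -k - 1 = -k by ring]; push_cast; module
    · rw [B.c_cv_eq_zero k (by omega)]; simp
  · have h := congrArg (fun Z : Module.End ℂ M => Z (B.cv (k + 1))) (hd n (k + 1))
    simp only [LinearMap.sub_apply, LinearMap.add_apply, Module.End.mul_apply,
      LinearMap.smul_apply] at h
    rw [sub_eq_iff_eq_add] at h
    rw [h, hk, map_smul, B.d_cv_eq_zero (k + 1) (n := n + (k + 1)) (by omega)]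
    split_ifs with h1
    · rw [h1, show 1 + (k + 1) - 1 = k + 1 by ring]; push_cast; module
    · rw [B.d_cv_eq_zero (k + 1) (by omega)]; simp
  · rw [ht]; simp

end BCSystem

/-! ### Finite sums -/

theorem sum_Icc_reflect {β : Type*} [AddCommMonoid β] (a b : ℤ) (F : ℤ → β) :
    ∑ i ∈ Finset.Icc a b, F (a + b - i) = ∑ i ∈ Finset.Icc a b, F i := by
  refine Finset.sum_nbij' (fun i => a + b - i) (fun i => a + b - i) ?_ ?_ ?_ ?_ ?_
  · intro i hi; rw [Finset.mem_Icc] at hi ⊢; omega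
  · intro i hi; rw [Finset.mem_Icc] at hi ⊢; omega
  · intro i _; ring
  · intro i _; ring
  · intro i _; rfl

/-- For `a = N` the value is `-(N ^ 3 - N) / 6`, that is `-2` times the normalized Virasoro cocycle.
-/
theorem sum_Icc_mul_add (N : ℕ) (a : ℂ) :
    ∑ i ∈ Finset.Icc (-(N : ℤ)) 0, (i : ℂ) * (a + i)
      = -a * (N * (N + 1) / 2) + N * (N + 1) * (2 * N + 1) / 6 := by
  induction N with
  | zero => simp
  | succ N ih =>
    have e : Finset.Icc (-((N + 1 : ℕ) : ℤ)) 0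
        = insert (-((N + 1 : ℕ) : ℤ)) (Finset.Icc (-(N : ℤ)) 0) := by
      ext i
      simp only [Finset.mem_Icc, Finset.mem_insert]
      omega
    rw [e, Finset.sum_insert (by simp), ih]
    push_cast
    ring

/-- The double sum in the evaluation of the Virasoro cocycle. -/
theorem sum_sum_reflect {F : ℤ → ℂ} {m n : ℤ} (hm : 1 ≤ m) (hF : ∀ k, F (m + n - k) = F k)
    (hF1 : ∀ k, 1 < k → F k = 0) :
    ∑ i ∈ Finset.Icc n 0, ∑ p ∈ Finset.Icc 1 (1 - n + i), F (m + i - p)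
      = ((m : ℂ) - n) / 2 * ∑ k ∈ Finset.Icc (m + n - 1) 1, F k := by
  -- The new variable is `k = m + i - p`. The upper bound of `U` covers both the values that occur,
  -- at most `m - 1`, and the support bound `1` of `F`.
  set U := Finset.Icc (m + n - 1) (max 1 (m - 1)) with hU
  have e1 : ∀ i ∈ Finset.Icc n 0, ∑ p ∈ Finset.Icc 1 (1 - n + i), F (m + i - p)
      = ∑ k ∈ U, if k ≤ m + i - 1 then F k else 0 := by
    intro i hi
    rw [Finset.mem_Icc] at hi
    rw [← Finset.sum_filter]
    refine Finset.sum_nbij' (fun p => m + i - p) (fun k => m + i - k) ?_ ?_ ?_ ?_ ?_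
    · intro p hp
      rw [Finset.mem_Icc] at hp
      rw [Finset.mem_filter, hU, Finset.mem_Icc]
      omega
    · intro k hk
      rw [Finset.mem_filter, hU, Finset.mem_Icc] at hk
      rw [Finset.mem_Icc]
      omega
    · intro p _; ring
    · intro p _; ring
    · intro p _; rfl
  -- After exchanging the sums, `F k` is counted once for each admissible `i`, and there are `m - k`
  -- of these.
  have e2 : ∀ k ∈ U, (∑ i ∈ Finset.Icc n 0, if k ≤ m + i - 1 then F k else 0)
      = ((m : ℂ) - k) * F k := by
    intro k hk
    rw [hU, Finset.mem_Icc] at hk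
    rw [← Finset.sum_filter, Finset.sum_const, nsmul_eq_mul]
    have : (Finset.Icc n 0).filter (fun i => k ≤ m + i - 1) = Finset.Icc (k - m + 1) 0 := by
      ext i
      simp only [Finset.mem_filter, Finset.mem_Icc]
      omega
    rw [this, Int.card_Icc]
    congr 1
    have h2 : ((0 + 1 - (k - m + 1)).toNat : ℤ) = m - k := by omega
    have h3 : (((0 + 1 - (k - m + 1)).toNat : ℤ) : ℂ) = ((m - k : ℤ) : ℂ) := by rw [h2]
    push_cast at h3 ⊢
    exact h3
  rw [Finset.sum_congr rfl e1, Finset.sum_comm, Finset.sum_congr rfl e2,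
    ← Finset.sum_subset (s₁ := Finset.Icc (m + n - 1) 1)]
  -- The symmetry `k ↦ m + n - k` of `F` replaces the weight `m - k` by its average `(m - n) / 2`.
  · have h := sum_Icc_reflect (m + n - 1) 1 fun k : ℤ => ((m : ℂ) - k) * F k
    have e3 : ∀ k ∈ Finset.Icc (m + n - 1) 1,
        ((m : ℂ) - ((m + n - 1 + 1 - k : ℤ) : ℂ)) * F (m + n - 1 + 1 - k)
          = ((m : ℂ) - n) * F k - ((m : ℂ) - k) * F k := by
      intro k _
      rw [show m + n - 1 + 1 - k = m + n - k by ring, hF]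
      push_cast
      ring
    rw [Finset.sum_congr rfl e3, Finset.sum_sub_distrib, ← Finset.mul_sum] at h
    linear_combination -h / 2
  · intro k hk
    rw [Finset.mem_Icc] at hk
    rw [hU, Finset.mem_Icc]
    omega
  · intro k hk hk'
    rw [hU, Finset.mem_Icc] at hk
    rw [Finset.mem_Icc] at hk'
    rw [hF1 k (by omega), mul_zero]

/-! ### The Virasoro relations of the Sugawara operators -/

namespace FermionRep

variable {C : ℤ → Matrix (Fin 2) (Fin 2) ℂ} {M : Type*} [AddCommGroup M] [Module ℂ M]
  (S : FermionRep C M)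

theorem ψψ_apply (a : Fin 2) (m : ℤ) (b : Fin 2) (n : ℤ) (u : M) :
    S.ψ a m (S.ψ b n u) = modePairing C a m b n • u - S.ψ b n (S.ψ a m u) := by
  have h := congrArg (fun Z : Module.End ℂ M => Z u) (S.anticomm a m b n)
  simp only [LinearMap.add_apply, Module.End.mul_apply, LinearMap.smul_apply,
    Module.End.one_apply] at h
  rw [← h, add_sub_cancel_right]

theorem modePairing_comm (S : FermionRep C M) (a : Fin 2) (m : ℤ) (b : Fin 2) (n : ℤ) :
    modePairing C a m b n = modePairing C b n a m := by
  rw [modePairing, modePairing, S.symm (m + n) a b, add_comm n m]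
  congr 1
  split_ifs with h
  · obtain rfl : m = -n := by omega
    fin_cases a <;> fin_cases b <;> simp [sympl]
  · rfl

theorem T_vac_of_pos {n : ℤ} (hn : 1 ≤ n) : S.T n S.v = 0 :=
  lfsum_apply_eq_zero (S.locFin_no n) fun i =>
    S.no_apply_eq_zero (fun _ => S.vac _ _ (by omega)) (fun _ => S.vac _ _ (by omega))
      fun _ => ⟨S.vac _ _ (by omega), S.vac _ _ (by omega)⟩

/-- The antisymmetrized product of two operators. -/
noncomputable def anti (X Y : Module.End ℂ M) : Module.End ℂ M := (1 / 2 : ℂ) • (X * Y - Y * X)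

theorem anti_swap (X Y : Module.End ℂ M) : anti X Y = -anti Y X := by
  rw [anti, anti, ← smul_neg, neg_sub]

theorem anti_commutator (T X Y : Module.End ℂ M) :
    T * anti X Y - anti X Y * T = anti (T * X - X * T) Y + anti X (T * Y - Y * T) := by
  rw [anti, anti, anti, mul_smul_comm, smul_mul_assoc, ← smul_sub, ← smul_add]
  congr 1
  noncomm_ring

/-- On the vacuum, `T_n` with `n ≤ 0` is a finite sum of antisymmetrized products. -/
theorem T_vac_of_nonpos {n : ℤ} (hn : n ≤ 0) :
    S.T n S.v = ∑ i ∈ Finset.Icc n 0, anti (S.ψ 1 i) (S.ψ 0 (n - i)) S.v := by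
  rw [T, lfsum_apply_eq_sum (S.locFin_no n) (s := Finset.Icc n 0)]
  · simp only [S.no_eq, LinearMap.add_apply]
    rw [Finset.sum_add_distrib]
    -- The ordering sign is odd under `i ↦ n - i` and, for `n ≠ 0`, the pairing is even, so the
    -- scalar corrections cancel. For `n = 0` the only summand has sign zero.
    have h0 : ∑ i ∈ Finset.Icc n 0, (((1 / 2 * (if i < n - i then 1 else if n - i < i then -1 else 0)
        * modePairing C 1 i 0 (n - i) : ℂ)) • (1 : Module.End ℂ M)) S.v = 0 := by
      refine eq_zero_of_eq_neg ?_
      nth_rewrite 1 [← sum_Icc_reflect]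
      rw [← Finset.sum_neg_distrib]
      refine Finset.sum_congr rfl fun i hi => ?_
      rw [Finset.mem_Icc] at hi
      rw [← LinearMap.neg_apply, ← neg_smul]
      congr 2
      rw [add_zero, sub_sub_cancel]
      rcases eq_or_ne n 0 with rfl | hn0
      · obtain rfl : i = 0 := by omega
        simp
      · simp only [modePairing]
        rw [if_neg (by omega : ¬ n - i + i = 0), if_neg (by omega : ¬ i + (n - i) = 0),
          sub_add_cancel, add_sub_cancel]
        rcases lt_trichotomy i (n - i) with h | h | h
        · rw [if_neg h.not_gt, if_pos h, if_pos h]; ring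
        · rw [if_neg (by omega), if_neg (by omega), if_neg (by omega), if_neg (by omega)]; ring
        · rw [if_pos h, if_neg h.not_gt, if_pos h]; ring
    rw [h0, add_zero]
    rfl
  · intro i hi
    rw [Finset.mem_Icc] at hi
    exact S.no_apply_eq_zero (fun _ => S.vac _ _ (by omega)) (fun _ => S.vac _ _ (by omega))
      fun _ => ⟨S.vac _ _ (by omega), S.vac _ _ (by omega)⟩

/-- Two nonpositive modes contribute zero by the choice of `τ`. A positive mode on the left kills
the vacuum after being moved to it, leaving half the pairing. -/
theorem τ_anti (a : Fin 2) (p : ℤ) (b : Fin 2) {j : ℤ} (hj : j ≤ 0) :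
    S.τ (anti (S.ψ a p) (S.ψ b j) S.v) = if 1 ≤ p then 1 / 2 * modePairing C a p b j else 0 := by
  rw [anti, LinearMap.smul_apply, LinearMap.sub_apply, Module.End.mul_apply, Module.End.mul_apply,
    map_smul, map_sub, smul_eq_mul]
  split_ifs with hp
  · rw [S.vac a p hp, map_zero, ψψ_apply, S.vac a p hp, map_zero, sub_zero, map_smul, S.τ_vac,
      map_zero, sub_zero, smul_eq_mul, mul_one]
  · rw [S.τ_two a p b j (by omega) hj, S.τ_two b j a p hj (by omega), S.modePairing_comm b j]
    ring

theorem τ_T_vac (n : ℤ) : S.τ (S.T n S.v) = 0 := by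
  rcases le_or_gt n 0 with hn | hn
  · rw [S.T_vac_of_nonpos hn, map_sum]
    refine Finset.sum_eq_zero fun i hi => ?_
    rw [Finset.mem_Icc] at hi
    rw [S.τ_anti _ _ _ (by omega), if_neg (by omega)]
  · rw [S.T_vac_of_pos hn, map_zero]

theorem τ_anti_lfsum (b' : Fin 2) (r : ℤ → ℂ) (hr : LocFin fun p : ℤ => r p • S.ψ b' p)
    (b : Fin 2) {j : ℤ} (hj : j ≤ 0) :
    S.τ (anti (lfsum fun p : ℤ => r p • S.ψ b' p) (S.ψ b j) S.v)
      = ∑ p ∈ Finset.Icc 1 (1 - j), r p * (1 / 2 * modePairing C b' p b j) := by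
  classical
  obtain ⟨s, hs⟩ := hr.exists_finset S.v
  obtain ⟨t, ht⟩ := hr.exists_finset (S.ψ b j S.v)
  set U := s ∪ t ∪ Finset.Icc 1 (1 - j) with hU
  have hsU : ∀ i, i ∉ U → (r i • S.ψ b' i) S.v = 0 := fun i hi => hs i fun h => hi (by simp [hU, h])
  have htU : ∀ i, i ∉ U → (r i • S.ψ b' i) (S.ψ b j S.v) = 0 :=
    fun i hi => ht i fun h => hi (by simp [hU, h])
  have e : S.τ (anti (lfsum fun p : ℤ => r p • S.ψ b' p) (S.ψ b j) S.v)
      = ∑ p ∈ U, r p * S.τ (anti (S.ψ b' p) (S.ψ b j) S.v) := by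
    simp only [anti, LinearMap.smul_apply, LinearMap.sub_apply, Module.End.mul_apply]
    rw [lfsum_apply_eq_sum hr hsU, lfsum_apply_eq_sum hr htU]
    simp only [LinearMap.smul_apply, map_smul, map_sub, map_sum, smul_eq_mul]
    rw [← Finset.sum_sub_distrib, Finset.mul_sum]
    refine Finset.sum_congr rfl fun p _ => ?_
    ring
  rw [e, ← Finset.sum_subset (s₁ := Finset.Icc 1 (1 - j)) (by rw [hU]; exact Finset.subset_union_right)]
  · refine Finset.sum_congr rfl fun p hp => ?_
    rw [Finset.mem_Icc] at hp
    rw [S.τ_anti _ _ _ hj, if_pos hp.1]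
  · intro p _ hp
    rw [Finset.mem_Icc] at hp
    rw [S.τ_anti _ _ _ hj]
    split_ifs with h1
    · rw [S.modePairing_eq_zero (by omega)]; ring
    · ring

theorem τ_anti_commutator (m : ℤ) (a : Fin 2) (i : ℤ) (b : Fin 2) {j : ℤ} (hj : j ≤ 0) :
    S.τ (anti (S.T m * S.ψ a i - S.ψ a i * S.T m) (S.ψ b j) S.v)
      = -(i : ℂ) * (if 1 ≤ m + i then 1 / 2 * modePairing C a (m + i) b j else 0)
        + ∑ p ∈ Finset.Icc 1 (1 - j), 1 / 2 * (C (m + i - p) 0 a * modePairing C 1 p b j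
          - C (m + i - p) 1 a * modePairing C 0 p b j) := by
  have hc : ∀ a b k, 1 < k → C k a b = 0 := fun a b k hk => by rw [S.cutoff k hk]; rfl
  have hadd : ∀ X Y Z : Module.End ℂ M, anti (X + Y) Z = anti X Z + anti Y Z := by
    intro X Y Z
    simp only [anti, ← smul_add]
    congr 1
    noncomm_ring
  have hneg : ∀ X Y Z : Module.End ℂ M, anti (X - Y) Z = anti X Z - anti Y Z := by
    intro X Y Z
    simp only [anti, ← smul_sub]
    congr 1
    noncomm_ring
  have hsmul : ∀ (t : ℂ) (X Z : Module.End ℂ M), anti (t • X) Z = t • anti X Z := by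
    intro t X Z
    rw [anti, anti, smul_mul_assoc, mul_smul_comm, ← smul_sub, smul_comm]
  rw [S.T_commutator, hadd, hneg, hsmul]
  simp only [LinearMap.add_apply, LinearMap.sub_apply, LinearMap.smul_apply, map_add, map_sub,
    map_smul, smul_eq_mul]
  rw [S.τ_anti _ _ _ hj, S.τ_anti_lfsum 1 (fun p => C (m + i - p) 0 a)
    (S.locFin_conv 1 (fun k => C k 0 a) (hc 0 a) (m + i)) b hj,
    S.τ_anti_lfsum 0 (fun p => C (m + i - p) 1 a)
    (S.locFin_conv 0 (fun k => C k 1 a) (hc 1 a) (m + i)) b hj, ← Finset.sum_sub_distrib]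
  congr 1
  refine Finset.sum_congr rfl fun p _ => ?_
  ring

/-- The cutoff makes the sum finite, and averaging over `k ↦ N - k` gives it the symmetric form that
appears in the vacuum expectation. -/
theorem sugawaraConst_eq (S : FermionRep C M) (N : ℤ) :
    sugawaraConst C N = 1 / 4 * ∑ k ∈ Finset.Icc (N - 1) 1, (2 * (C k 0 1 * C (N - k) 0 1)
      - C k 1 1 * C (N - k) 0 0 - C k 0 0 * C (N - k) 1 1) := by
  have h : (∑ᶠ i : ℤ, (C i 1 0 * C (N - i) 0 1 - C i 0 0 * C (N - i) 1 1))
      = ∑ i ∈ Finset.Icc (N - 1) 1, (C i 1 0 * C (N - i) 0 1 - C i 0 0 * C (N - i) 1 1) := by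
    refine finsum_eq_sum_of_support_subset _ fun i hi => ?_
    by_contra hi'
    rw [Finset.mem_coe, Finset.mem_Icc, not_and_or, not_le, not_le] at hi'
    refine hi ?_
    rcases hi' with h | h
    · simp [S.cutoff (N - i) (by omega)]
    · simp [S.cutoff i h]
  have h2 := sum_Icc_reflect (N - 1) 1 fun i : ℤ => C i 0 0 * C (N - i) 1 1
  have e2 : ∀ i ∈ Finset.Icc (N - 1) 1, C (N - 1 + 1 - i) 0 0 * C (N - (N - 1 + 1 - i)) 1 1
      = C i 1 1 * C (N - i) 0 0 := by
    intro i _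
    rw [show N - 1 + 1 - i = N - i by ring, sub_sub_cancel, mul_comm]
  rw [Finset.sum_congr rfl e2] at h2
  rw [sugawaraConst, h]
  simp only [S.symm _ 1 0, Finset.sum_sub_distrib, ← Finset.mul_sum, h2]
  ring

/-- Commuting `T m` through the antisymmetrized pairs of `T n` pairs modes twice. The symplectic
terms add up to the sum of `i * (m + i)`, the central term; the connection terms give a double sum
quadratic in `C`, which is `m - n` times the Sugawara constant. Mixed contributions cancel. -/
theorem τ_T_T_vac {m n : ℤ} (hm : 1 ≤ m) (hn : n ≤ 0) :
    S.τ (S.T m (S.T n S.v)) = ((m : ℂ) - n) * sugawaraConst C (m + n)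
      + (-2) * (if m + n = 0 then ((m : ℂ) ^ 3 - m) / 12 else 0) := by
  set F : ℤ → ℂ := fun k => 2 * (C k 0 1 * C (m + n - k) 0 1)
      - C k 1 1 * C (m + n - k) 0 0 - C k 0 0 * C (m + n - k) 1 1 with hF
  have h1 : ∀ i ∈ Finset.Icc n 0, S.τ (S.T m (anti (S.ψ 1 i) (S.ψ 0 (n - i)) S.v))
      = S.τ (anti (S.T m * S.ψ 1 i - S.ψ 1 i * S.T m) (S.ψ 0 (n - i)) S.v)
        - S.τ (anti (S.T m * S.ψ 0 (n - i) - S.ψ 0 (n - i) * S.T m) (S.ψ 1 i) S.v) := by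
    intro i _
    have h := congrArg (fun Z : Module.End ℂ M => Z S.v)
      (anti_commutator (S.T m) (S.ψ 1 i) (S.ψ 0 (n - i)))
    rw [anti_swap (S.ψ 1 i) (S.T m * _ - _)] at h
    simp only [LinearMap.sub_apply, LinearMap.add_apply, Module.End.mul_apply,
      LinearMap.neg_apply] at h
    rw [S.T_vac_of_pos hm, map_zero, sub_zero] at h
    rw [h, map_add, map_neg, ← sub_eq_add_neg]
  have h2 := sum_Icc_reflect n 0 fun i : ℤ =>
    S.τ (anti (S.T m * S.ψ 0 i - S.ψ 0 i * S.T m) (S.ψ 1 (n - i)) S.v)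
  simp only [add_zero, sub_sub_cancel] at h2
  rw [S.T_vac_of_nonpos hn, map_sum, map_sum, Finset.sum_congr rfl h1, Finset.sum_sub_distrib, h2,
    ← Finset.sum_sub_distrib]
  have h3 : ∀ i ∈ Finset.Icc n 0,
      S.τ (anti (S.T m * S.ψ 1 i - S.ψ 1 i * S.T m) (S.ψ 0 (n - i)) S.v)
        - S.τ (anti (S.T m * S.ψ 0 i - S.ψ 0 i * S.T m) (S.ψ 1 (n - i)) S.v)
      = (if m + n = 0 then (i : ℂ) * (m + i) else 0)
        + 1 / 2 * ∑ p ∈ Finset.Icc 1 (1 - n + i), F (m + i - p) := by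
    intro i hi
    rw [Finset.mem_Icc] at hi
    rw [S.τ_anti_commutator m 1 i 0 (by omega), S.τ_anti_commutator m 0 i 1 (by omega),
      add_sub_add_comm, ← Finset.sum_sub_distrib, Finset.mul_sum,
      show 1 - (n - i) = 1 - n + i by ring]
    congr 1
    · simp only [modePairing, show m + i + (n - i) = m + n by ring, S.symm _ 1 0]
      by_cases h0 : m + n = 0
      · rw [if_pos h0, if_pos h0, if_pos h0]
        split_ifs with h4
        · simp [sympl]; ring
        · have : m + i = 0 := by omega
          have h5 : (m : ℂ) + i = 0 := by exact_mod_cast this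
          rw [h5]; ring
      · rw [if_neg h0, if_neg h0, if_neg h0]
        ring
    · refine Finset.sum_congr rfl fun p _ => ?_
      have e5 : m + n - (m + i - p) = p + (n - i) := by ring
      simp only [hF, modePairing, S.symm _ 1 0, e5]
      split_ifs <;> simp [sympl] <;> ring
  rw [Finset.sum_congr rfl h3, Finset.sum_add_distrib, ← Finset.mul_sum,
    sum_sum_reflect hm (F := F) (fun k => ?_) (fun k hk => ?_), S.sugawaraConst_eq]
  · have e6 : (∑ i ∈ Finset.Icc n 0, if m + n = 0 then (i : ℂ) * (m + i) else 0)
        = (-2) * (if m + n = 0 then ((m : ℂ) ^ 3 - m) / 12 else 0) := by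
      split_ifs with h0
      · obtain ⟨N, rfl⟩ : ∃ N : ℕ, m = N := ⟨m.toNat, by omega⟩
        obtain rfl : n = -(N : ℤ) := by omega
        rw [sum_Icc_mul_add]
        push_cast
        ring
      · simp
    rw [e6]
    ring
  · simp only [hF, sub_sub_cancel]; ring
  · simp only [hF, S.cutoff k hk]; simp

/-- The Sugawara operators. -/
noncomputable def sug (n : ℤ) : Module.End ℂ M :=
  S.T n + sugawaraConst C n • (1 : Module.End ℂ M)

theorem sug_commutator (n : ℤ) (z : Module.End ℂ M) :
    S.sug n * z - z * S.sug n = S.T n * z - z * S.T n := by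
  rw [sug, add_mul, mul_add, smul_mul_assoc, mul_smul_comm, one_mul, mul_one]
  abel

theorem sugawaraConst_eq_zero (S : FermionRep C M) {n : ℤ} (hn : 3 ≤ n) : sugawaraConst C n = 0 := by
  rw [S.sugawaraConst_eq, Finset.Icc_eq_empty (by omega)]; simp

theorem sug_vac {n : ℤ} (hn : 1 ≤ n) : S.sug n S.v = sugawaraConst C n • S.v := by
  rw [sug, LinearMap.add_apply, S.T_vac_of_pos hn, zero_add]; rfl

/-- The Virasoro relations for the Sugawara operators. -/
theorem virasoro_relation {ξ ε : ℂ} (B : BCSystem M)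
    (hc : ∀ n m, S.sug n * B.c m - B.c m * S.sug n
      = -((m : ℂ) + ε) • B.c (n + m) - ξ • B.c (n + m - 1))
    (hd : ∀ n m, S.sug n * B.d m - B.d m * S.sug n
      = (ε - (n + m - 1)) • B.d (n + m) + ξ • B.d (n + m - 1)) (m n : ℤ) :
    S.sug m * S.sug n - S.sug n * S.sug m = ((m : ℂ) - n) • S.sug (m + n)
      + ((-2) * (if m + n = 0 then ((m : ℂ) ^ 3 - m) / 12 else 0)) • (1 : Module.End ℂ M) := by
  set γ : ℤ → ℤ → ℂ := fun m n => (-2) * (if m + n = 0 then ((m : ℂ) ^ 3 - m) / 12 else 0) with hγ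
  -- The relation holds on commutators with the modes, so the defect is a scalar.
  have hschur : ∀ m n : ℤ, ∃ t : ℂ, S.sug m * S.sug n - S.sug n * S.sug m
      = ((m : ℂ) - n) • S.sug (m + n) + t • (1 : Module.End ℂ M) := by
    intro m n
    have e : ∀ z, (S.sug m * S.sug n - S.sug n * S.sug m - ((m : ℂ) - n) • S.sug (m + n)) * z
        - z * (S.sug m * S.sug n - S.sug n * S.sug m - ((m : ℂ) - n) • S.sug (m + n))
        = (S.sug m * (S.sug n * z - z * S.sug n) - (S.sug n * z - z * S.sug n) * S.sug m)
          - (S.sug n * (S.sug m * z - z * S.sug m) - (S.sug m * z - z * S.sug m) * S.sug n)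
          - ((m : ℂ) - n) • (S.sug (m + n) * z - z * S.sug (m + n)) := by
      intro z
      rw [← BCSystem.commutator_commutator, sub_mul _ (((m : ℂ) - n) • _), mul_sub z,
        smul_mul_assoc, mul_smul_comm, smul_sub]
      abel
    have lin2 : ∀ (X x y : Module.End ℂ M) (s t : ℂ), X * (s • x - t • y) - (s • x - t • y) * X
        = s • (X * x - x * X) - t • (X * y - y * X) := by
      intro X x y s t
      simp only [mul_sub, sub_mul, mul_smul_comm, smul_mul_assoc, smul_sub]
      abel
    have lin3 : ∀ (X x y : Module.End ℂ M) (s t : ℂ), X * (s • x + t • y) - (s • x + t • y) * X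
        = s • (X * x - x * X) + t • (X * y - y * X) := by
      intro X x y s t
      simp only [mul_add, add_mul, mul_smul_comm, smul_mul_assoc, smul_sub]
      abel
    obtain ⟨t, ht⟩ := B.schur
      (X := S.sug m * S.sug n - S.sug n * S.sug m - ((m : ℂ) - n) • S.sug (m + n))
      (fun p => by
        rw [e]
        simp only [hc, lin2]
        rw [show n + (m + p) = m + n + p by ring, show n + (m + p - 1) = m + n + p - 1 by ring,
          show m + (n + p) = m + n + p by ring, show m + (n + p - 1) = m + n + p - 1 by ring]
        push_cast
        module)
      (fun p => by
        rw [e]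
        simp only [hd, lin3]
        rw [show n + (m + p) = m + n + p by ring, show n + (m + p - 1) = m + n + p - 1 by ring,
          show m + (n + p) = m + n + p by ring, show m + (n + p - 1) = m + n + p - 1 by ring]
        push_cast
        module)
    exact ⟨t, by rw [← ht]; abel⟩
  -- For `m ≥ 1` the operator `T m` kills the vacuum, and `τ` of the relation at the vacuum gives
  -- the scalar.
  have hpos : ∀ m n : ℤ, 1 ≤ m → S.sug m * S.sug n - S.sug n * S.sug m
      = ((m : ℂ) - n) • S.sug (m + n) + γ m n • (1 : Module.End ℂ M) := by
    intro m n hm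
    obtain ⟨t, ht⟩ := hschur m n
    have h := congrArg (fun Z : Module.End ℂ M => S.τ (Z S.v)) ht
    have e : S.sug m * S.sug n - S.sug n * S.sug m = S.T m * S.T n - S.T n * S.T m := by
      rw [sug_commutator, sug, mul_add, add_mul, mul_smul_comm, smul_mul_assoc, mul_one, one_mul]
      abel
    rw [e] at h
    simp only [sug, LinearMap.sub_apply, LinearMap.add_apply, Module.End.mul_apply,
      LinearMap.smul_apply, Module.End.one_apply, map_add, map_smul, S.τ_T_vac, S.τ_vac,
      S.T_vac_of_pos hm, map_zero, smul_eq_mul, mul_one, zero_add, sub_zero] at h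
    rw [ht]
    congr 2
    rcases le_or_gt n 0 with hn | hn
    · rw [S.τ_T_T_vac hm hn] at h
      linear_combination -h
    · rw [S.T_vac_of_pos hn, map_zero, map_zero] at h
      have h0 : ((m : ℂ) - n) * sugawaraConst C (m + n) = 0 := by
        rcases eq_or_ne m n with rfl | hmn
        · rw [sub_self, zero_mul]
        · rw [S.sugawaraConst_eq_zero (by omega), mul_zero]
      rw [hγ]
      simp only
      rw [if_neg (by omega), mul_zero]
      linear_combination -h - h0
  have hγswap : ∀ m n : ℤ, γ m n = -γ n m := by
    intro m n
    simp only [hγ, add_comm n m]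
    split_ifs with h
    · obtain rfl : n = -m := by omega
      push_cast; ring
    · simp
  have hpos' : ∀ m n : ℤ, 1 ≤ n → S.sug m * S.sug n - S.sug n * S.sug m
      = ((m : ℂ) - n) • S.sug (m + n) + γ m n • (1 : Module.End ℂ M) := by
    intro m n hn
    rw [← neg_sub, hpos n m hn, hγswap m n, add_comm n m]
    module
  rcases le_or_gt 1 n with hn | hn
  · exact hpos' m n hn
  rcases le_or_gt 1 m with hm | hm
  · exact hpos m n hm
  -- When both indices are nonpositive, `sug m` is obtained from `[sug p, sug q]` with `p + q = m`,
  -- and the Jacobi identity is used. With `p = 1 - n` both `p` and `p + n = 1` are positive, so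
  -- every needed scalar is known or drops out; moreover `p ≠ q`.
  obtain ⟨p, hp⟩ : ∃ p : ℤ, p = 1 - n := ⟨_, rfl⟩
  obtain ⟨q, hq⟩ : ∃ q : ℤ, q = m - p := ⟨_, rfl⟩
  have hpq := hpos p q (by omega)
  obtain ⟨s, hs⟩ := hschur q n
  have h1 := hpos p n (by omega)
  have h2 := hpos p (q + n) (by omega)
  have h3 := hpos' q (p + n) (by omega)
  have hcc := BCSystem.commutator_commutator (S.sug p) (S.sug q) (S.sug n)
  rw [hs, h1, hpq] at hcc
  have e1 : ∀ (X Y : Module.End ℂ M) (a b : ℂ), (a • X + b • (1 : Module.End ℂ M)) * Y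
      - Y * (a • X + b • (1 : Module.End ℂ M)) = a • (X * Y - Y * X) := by
    intro X Y a b
    simp only [add_mul, mul_add, smul_mul_assoc, mul_smul_comm, one_mul, mul_one, smul_sub]
    abel
  have e2 : ∀ (X Y : Module.End ℂ M) (a b : ℂ), Y * (a • X + b • (1 : Module.End ℂ M))
      - (a • X + b • (1 : Module.End ℂ M)) * Y = a • (Y * X - X * Y) := by
    intro X Y a b
    simp only [add_mul, mul_add, smul_mul_assoc, mul_smul_comm, one_mul, mul_one, smul_sub]
    abel
  rw [e1, e2, e2, h2, h3, show p + q = m by omega, show p + (q + n) = m + n by omega,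
    show q + (p + n) = m + n by omega] at hcc
  have hne : ((p : ℂ) - q) ≠ 0 := by
    have : p - q ≠ 0 := by omega
    exact_mod_cast this
  have hm' : (m : ℂ) = p + q := by rw [hq]; push_cast; ring
  have hγ3 : ((q : ℂ) - n) * γ p (q + n) - ((p : ℂ) - n) * γ q (p + n) = ((p : ℂ) - q) * γ m n := by
    simp only [hγ, show p + (q + n) = m + n by omega, show q + (p + n) = m + n by omega]
    split_ifs with h
    · have hn' : (n : ℂ) = -(p + q) := by
        rw [← hm', eq_neg_iff_add_eq_zero, add_comm]
        exact_mod_cast h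
      rw [hn', hm']
      ring
    · ring
  have hfin : ((p : ℂ) - q) • (S.sug m * S.sug n - S.sug n * S.sug m)
      = ((p : ℂ) - q) • (((m : ℂ) - n) • S.sug (m + n) + γ m n • (1 : Module.End ℂ M)) := by
    have h4 : ((p : ℂ) - q) • γ m n • (1 : Module.End ℂ M)
        = (((q : ℂ) - n) * γ p (q + n) - ((p : ℂ) - n) * γ q (p + n)) • (1 : Module.End ℂ M) := by
      rw [smul_smul, ← hγ3]
    rw [hcc, smul_add _ _ (γ m n • (1 : Module.End ℂ M)), h4, hm']
    push_cast
    module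
  exact smul_right_injective _ hne hfin

end FermionRep

/-! ### The induced module as a Clifford module -/

/-- A vector killed by a set `s` under a representation of `A` defines a linear map on the
quotient of `A` by the left ideal generated by `s`. -/
theorem exists_quotient_span_lift {A N : Type*} [Ring A] [Algebra ℂ A] [AddCommGroup N]
    [Module ℂ N] (s : Set A) (ρ : A →ₐ[ℂ] Module.End ℂ N) (x : N) (h : ∀ a ∈ s, ρ a x = 0) :
    ∃ f : (A ⧸ Submodule.span A s) →ₗ[ℂ] N, ∀ a, f (Submodule.Quotient.mk a) = ρ a x := by
  let f₀ : A →ₗ[ℂ] N := LinearMap.applyₗ x ∘ₗ ρ.toLinearMap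
  have h₀ : (Submodule.span A s).restrictScalars ℂ ≤ LinearMap.ker f₀ := by
    intro a ha
    rw [Submodule.restrictScalars_mem] at ha
    change ρ a x = 0
    induction ha using Submodule.span_induction with
    | mem a ha => exact h a ha
    | zero => rw [map_zero]; rfl
    | add a b _ _ ha hb => rw [map_add, LinearMap.add_apply, ha, hb, add_zero]
    | smul t a _ ha => rw [smul_eq_mul, map_mul, Module.End.mul_apply, ha, map_zero]
  refine ⟨(Submodule.liftQ _ f₀ h₀) ∘ₗ
    (Submodule.Quotient.restrictScalarsEquiv ℂ (Submodule.span A s)).symm.toLinearMap, fun a => ?_⟩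
  rfl

namespace SymplecticFermion

variable {C : ℤ → Matrix (Fin 2) (Fin 2) ℂ}

theorem psi_anticomm (a : Fin 2) (m : ℤ) (b : Fin 2) (n : ℤ) :
    psi C a m * psi C b n + psi C b n * psi C a m
      = algebraMap ℂ (ModeAlgebra C) (modePairing C a m b n) := by
  have h := RingQuot.mkAlgHom_rel ℂ (Rel.anticomm (C := C) a b m n)
  rw [AlgHom.commutes, map_add, map_mul, map_mul] at h
  exact h

theorem adjoin_psi :
    Algebra.adjoin ℂ (Set.range fun p : Fin 2 × ℤ => psi C p.1 p.2) = ⊤ := by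
  have h := FreeAlgebra.adjoin_range_ι ℂ (Fin 2 × ℤ)
  apply_fun Subalgebra.map (RingQuot.mkAlgHom ℂ (Rel C)) at h
  rw [AlgHom.map_adjoin, ← Set.range_comp, Algebra.map_top,
    (AlgHom.range_eq_top _).mpr (RingQuot.mkAlgHom_surjective ℂ (Rel C))] at h
  exact h

theorem exists_modeAlgebra_lift {R : Type*} [Ring R] [Algebra ℂ R] (f : Fin 2 → ℤ → R)
    (hf : ∀ a m b n, f a m * f b n + f b n * f a m = algebraMap ℂ R (modePairing C a m b n)) :
    ∃ F : ModeAlgebra C →ₐ[ℂ] R, ∀ a n, F (psi C a n) = f a n := by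
  refine ⟨RingQuot.liftAlgHom ℂ ⟨FreeAlgebra.lift ℂ fun p => f p.1 p.2, ?_⟩, fun a n => ?_⟩
  · rintro _ _ ⟨a, b, m, n⟩
    rw [map_add, map_mul, map_mul, AlgHom.commutes, FreeAlgebra.lift_ι_apply,
      FreeAlgebra.lift_ι_apply]
    exact hf a m b n
  · rw [psi, RingQuot.liftAlgHom_mkAlgHom_apply, FreeAlgebra.lift_ι_apply]

theorem smul_mem_of_psi_smul_mem {M : Type*} [AddCommGroup M] [Module ℂ M]
    [Module (ModeAlgebra C) M] [IsScalarTower ℂ (ModeAlgebra C) M] (W : Submodule ℂ M)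
    (hW : ∀ a n, ∀ u ∈ W, psi C a n • u ∈ W) (x : ModeAlgebra C) : ∀ u ∈ W, x • u ∈ W := by
  have hx : x ∈ Algebra.adjoin ℂ (Set.range fun p : Fin 2 × ℤ => psi C p.1 p.2) := by
    rw [adjoin_psi]; trivial
  induction hx using Algebra.adjoin_induction with
  | mem x hx => obtain ⟨p, rfl⟩ := hx; exact hW _ _
  | algebraMap r => intro u hu; rw [algebraMap_smul]; exact W.smul_mem _ hu
  | add x y _ _ hx hy => intro u hu; rw [add_smul]; exact W.add_mem (hx u hu) (hy u hu)
  | mul x y _ _ hx hy => intro u hu; rw [mul_smul]; exact hx _ (hy u hu)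

variable (C) in
/-- Half of the pairing of nonpositive modes; `(a, n)` indexes `ψ^a_{-n}`. -/
noncomputable def halfForm : LinearMap.BilinForm ℂ (Fin 2 × ℕ →₀ ℂ) :=
  Finsupp.linearCombination ℂ fun p : Fin 2 × ℕ => Finsupp.linearCombination ℂ
    fun q : Fin 2 × ℕ => 1 / 2 * modePairing C p.1 (-(p.2 : ℤ)) q.1 (-(q.2 : ℤ))

theorem halfForm_single (p q : Fin 2 × ℕ) (s t : ℂ) :
    halfForm C (Finsupp.single p s) (Finsupp.single q t)
      = s * (t * (1 / 2 * modePairing C p.1 (-(p.2 : ℤ)) q.1 (-(q.2 : ℤ)))) := by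
  simp [halfForm, Finsupp.linearCombination_single]

variable (C) in
/-- The Clifford algebra of the nonpositive modes. -/
abbrev FockAlgebra : Type := CliffordAlgebra (halfForm C).toQuadraticMap

variable (C) in
/-- The functional pairing the mode `ψ^a_n` with nonpositive modes. -/
noncomputable def modeDual (a : Fin 2) (n : ℤ) : Module.Dual ℂ (Fin 2 × ℕ →₀ ℂ) :=
  Finsupp.linearCombination ℂ fun q : Fin 2 × ℕ => modePairing C a n q.1 (-(q.2 : ℤ))

variable (C) in
/-- The nonpositive mode `ψ^a_{-n}` in the Clifford algebra. -/
noncomputable def fockVec (p : Fin 2 × ℕ) : FockAlgebra C :=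
  CliffordAlgebra.ι _ (Finsupp.single p 1)

variable (C) in
/-- The action of `ψ^a_n` on the Clifford algebra of the nonpositive modes: multiplication for
`n ≤ 0` and contraction for `n ≥ 1`. -/
noncomputable def fockMode (a : Fin 2) (n : ℤ) : Module.End ℂ (FockAlgebra C) :=
  if n ≤ 0 then Algebra.lmul ℂ _ (fockVec C (a, (-n).toNat))
  else CliffordAlgebra.contractLeft (modeDual C a n)

theorem modePairing_swap (hsymm : ∀ k a b, C k a b = C k b a) (a : Fin 2) (m : ℤ) (b : Fin 2)
    (n : ℤ) : modePairing C a m b n = modePairing C b n a m := by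
  rw [modePairing, modePairing, add_comm n m, hsymm _ b a]
  congr 1
  split_ifs with h
  · have hm : (m : ℂ) = -n := by rw [eq_neg_iff_add_eq_zero]; exact_mod_cast h
    rw [hm]
    fin_cases a <;> fin_cases b <;> simp [sympl]
  · rfl

/-- The Clifford relation involves the polar form, which is twice `halfForm` by symmetry of the
pairing. -/
theorem fockVec_anticomm (hsymm : ∀ k a b, C k a b = C k b a) (p q : Fin 2 × ℕ) :
    fockVec C p * fockVec C q + fockVec C q * fockVec C p
      = algebraMap ℂ _ (modePairing C p.1 (-(p.2 : ℤ)) q.1 (-(q.2 : ℤ))) := by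
  rw [fockVec, fockVec, CliffordAlgebra.ι_mul_ι_add_swap, LinearMap.BilinMap.polar_toQuadraticMap,
    halfForm_single, halfForm_single, modePairing_swap hsymm q.1]
  congr 1
  ring

/-- Contraction is an antiderivation, which gives the mixed relation. Two contractions anticommute,
as they must: the pairing of two positive modes vanishes by the cutoff. -/
theorem fockMode_anticomm (hcut : ∀ k, 1 < k → C k = 0) (hsymm : ∀ k a b, C k a b = C k b a)
    (a : Fin 2) (m : ℤ) (b : Fin 2) (n : ℤ) :
    fockMode C a m * fockMode C b n + fockMode C b n * fockMode C a m
      = algebraMap ℂ _ (modePairing C a m b n) := by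
  have mixed : ∀ (a : Fin 2) (m : ℤ) (b : Fin 2) (n : ℤ), m ≤ 0 → 1 ≤ n →
      fockMode C a m * fockMode C b n + fockMode C b n * fockMode C a m
      = algebraMap ℂ _ (modePairing C b n a m) := by
    intro a m b n hm hn
    ext1 x
    rw [fockMode, fockMode, if_pos hm, if_neg (by omega)]
    simp only [LinearMap.add_apply, Module.End.mul_apply, Algebra.coe_lmul_eq_mul,
      LinearMap.mul_apply_apply]
    rw [fockVec, CliffordAlgebra.contractLeft_ι_mul, add_sub_cancel, modeDual,
      Finsupp.linearCombination_single, one_smul, Module.algebraMap_end_apply,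
      show -(((-m).toNat : ℕ) : ℤ) = m by omega]
  rcases le_or_gt m 0 with hm | hm <;> rcases le_or_gt n 0 with hn | hn
  · rw [fockMode, fockMode, if_pos hm, if_pos hn, ← map_mul, ← map_mul, ← map_add,
      fockVec_anticomm hsymm, AlgHom.commutes, show -(((-m).toNat : ℕ) : ℤ) = m by omega,
      show -(((-n).toNat : ℕ) : ℤ) = n by omega]
  · rw [mixed a m b n hm (by omega), modePairing_swap hsymm]
  · rw [add_comm, mixed b n a m hn (by omega)]
  · rw [fockMode, fockMode, if_neg (by omega), if_neg (by omega), modePairing, if_neg (by omega),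
      hcut _ (by omega)]
    ext1 x
    simp only [LinearMap.add_apply, Module.End.mul_apply]
    rw [CliffordAlgebra.contractLeft_comm, neg_add_cancel]
    simp

theorem exists_fockRep (hcut : ∀ k, 1 < k → C k = 0) (hsymm : ∀ k a b, C k a b = C k b a) :
    ∃ ρ : ModeAlgebra C →ₐ[ℂ] Module.End ℂ (FockAlgebra C),
      ∀ a n, ρ (psi C a n) = fockMode C a n :=
  exists_modeAlgebra_lift _ (fockMode_anticomm hcut hsymm)

/-- Contractions kill `1`, so the induced module maps to the Clifford algebra. This comparison map
detects that nothing collapses in the quotient. -/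
theorem exists_inducedModule_fock (hcut : ∀ k, 1 < k → C k = 0)
    (hsymm : ∀ k a b, C k a b = C k b a) :
    ∃ (ρ : ModeAlgebra C →ₐ[ℂ] Module.End ℂ (FockAlgebra C)) (f : InducedModule C →ₗ[ℂ] FockAlgebra C),
      (∀ a n, ρ (psi C a n) = fockMode C a n) ∧ ∀ x, f (x • vac C) = ρ x 1 := by
  obtain ⟨ρ, hρ⟩ := exists_fockRep hcut hsymm
  obtain ⟨f, hf⟩ := exists_quotient_span_lift
    {x : ModeAlgebra C | ∃ (a : Fin 2) (n : ℤ), 1 ≤ n ∧ x = psi C a n} ρ 1 (by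
      rintro _ ⟨a, n, hn, rfl⟩
      rw [hρ, fockMode, if_neg (by omega), CliffordAlgebra.contractLeft_one])
  refine ⟨ρ, f, hρ, fun x => ?_⟩
  rw [vac, ← Submodule.Quotient.mk_smul, smul_eq_mul, mul_one]
  exact hf x

-- The Clifford algebra is deformed linearly to the exterior algebra, whose degree zero part is the
-- expectation. Using `-halfForm` for the deformation makes the expectation of a product of two
-- vectors equal to `halfForm`.
variable (C) in
theorem exists_fock_expectation : ∃ τ : FockAlgebra C →ₗ[ℂ] ℂ, τ 1 = 1 ∧
    ∀ x y, τ (CliffordAlgebra.ι _ x * CliffordAlgebra.ι _ y) = halfForm C x y := by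
  have h : (-halfForm C).toQuadraticMap = 0 - (halfForm C).toQuadraticMap := by
    ext x
    simp
  refine ⟨(ExteriorAlgebra.algebraMapInv).toLinearMap ∘ₗ CliffordAlgebra.changeForm h, ?_,
    fun x y => ?_⟩
  · rw [LinearMap.comp_apply, CliffordAlgebra.changeForm_one]
    exact map_one (ExteriorAlgebra.algebraMapInv (R := ℂ))
  · rw [LinearMap.comp_apply, CliffordAlgebra.changeForm_ι_mul_ι]
    change ExteriorAlgebra.algebraMapInv (ExteriorAlgebra.ι ℂ x * ExteriorAlgebra.ι ℂ y
      - algebraMap ℂ (ExteriorAlgebra ℂ _) ((-halfForm C) x y)) = _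
    rw [map_sub, map_mul, AlgHom.commutes]
    simp [ExteriorAlgebra.algebraMapInv]

/-- The induced module as a vacuum representation of the deformed symplectic fermions. -/
theorem exists_fermionRep (hcut : ∀ k, 1 < k → C k = 0) (hsymm : ∀ k a b, C k a b = C k b a) :
    ∃ S : FermionRep C (InducedModule C), S.v = vac C ∧ ∀ a n u, S.ψ a n u = psi C a n • u := by
  obtain ⟨ρ, f, hρ, hf⟩ := exists_inducedModule_fock hcut hsymm
  obtain ⟨τ, hτ1, hτ⟩ := exists_fock_expectation C
  refine ⟨
    { cutoff := hcut
      symm := hsymm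
      ψ := fun a n => Algebra.lsmul ℂ ℂ (InducedModule C) (psi C a n)
      anticomm := fun a m b n => ?_
      v := vac C
      vac := fun a n hn => ?_
      gen := fun W hv hW => ?_
      τ := τ ∘ₗ f
      τ_vac := ?_
      τ_two := fun a m b n hm hn => ?_ }, rfl, fun a n u => rfl⟩
  · rw [← map_mul, ← map_mul, ← map_add, psi_anticomm, AlgHom.commutes,
      Algebra.algebraMap_eq_smul_one]
  · change psi C a n • vac C = 0
    rw [vac, ← Submodule.Quotient.mk_smul, Submodule.Quotient.mk_eq_zero,
      smul_eq_mul, mul_one]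
    exact Submodule.subset_span ⟨a, n, hn, rfl⟩
  · rw [eq_top_iff]
    rintro u -
    obtain ⟨x, rfl⟩ := Submodule.Quotient.mk_surjective _ u
    have h := smul_mem_of_psi_smul_mem W hW x _ hv
    rwa [vac, ← Submodule.Quotient.mk_smul, smul_eq_mul, mul_one] at h
  · have h := hf 1
    rw [one_smul, map_one ρ, Module.End.one_apply] at h
    rw [LinearMap.comp_apply, h]
    exact hτ1
  · change τ (f (psi C a m • psi C b n • vac C)) = _
    rw [← mul_smul, hf, map_mul ρ, hρ, hρ,
      Module.End.mul_apply, fockMode, fockMode, if_pos hm, if_pos hn]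
    simp only [Algebra.coe_lmul_eq_mul, LinearMap.mul_apply_apply, mul_one]
    rw [fockVec, fockVec, hτ, halfForm_single, one_mul, one_mul,
      show -(((-m).toNat : ℕ) : ℤ) = m by omega, show -(((-n).toNat : ℕ) : ℤ) = n by omega]

/-- The nonpositive modes satisfy the Clifford relations of `halfForm`; polarization reduces this to
the relations between generators. -/
theorem exists_fockAlgebra_hom (hsymm : ∀ k a b, C k a b = C k b a) :
    ∃ Φ : FockAlgebra C →ₐ[ℂ] ModeAlgebra C, ∀ p, Φ (fockVec C p) = psi C p.1 (-(p.2 : ℤ)) := by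
  let f : (Fin 2 × ℕ →₀ ℂ) →ₗ[ℂ] ModeAlgebra C :=
    Finsupp.linearCombination ℂ fun p : Fin 2 × ℕ => psi C p.1 (-(p.2 : ℤ))
  have h : ∀ x y, f x * f y + f y * f x
      = algebraMap ℂ (ModeAlgebra C) (halfForm C x y + halfForm C y x) := by
    intro x y
    induction x using Finsupp.induction_linear with
    | zero => simp
    | add x x' hx hx' =>
      calc f (x + x') * f y + f y * f (x + x')
          = (f x * f y + f y * f x) + (f x' * f y + f y * f x') := by
            rw [map_add, add_mul, mul_add]; abel
        _ = _ := by
            rw [hx, hx', ← map_add]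
            congr 1
            simp only [map_add, LinearMap.add_apply]
            ring
    | single p s =>
      induction y using Finsupp.induction_linear with
      | zero => simp
      | add y y' hy hy' =>
        calc f (Finsupp.single p s) * f (y + y') + f (y + y') * f (Finsupp.single p s)
            = (f (Finsupp.single p s) * f y + f y * f (Finsupp.single p s))
              + (f (Finsupp.single p s) * f y' + f y' * f (Finsupp.single p s)) := by
              rw [map_add, add_mul, mul_add]; abel
          _ = _ := by
              rw [hy, hy', ← map_add]
              congr 1
              simp only [map_add, LinearMap.add_apply]
              ring
      | single q t =>
        have e : ∀ (p : Fin 2 × ℕ) (s : ℂ), f (Finsupp.single p s) = s • psi C p.1 (-(p.2 : ℤ)) :=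
          fun p s => Finsupp.linearCombination_single ℂ s p
        rw [e, e, halfForm_single, halfForm_single, smul_mul_smul_comm, smul_mul_smul_comm,
          mul_comm t s, ← smul_add, psi_anticomm, Algebra.smul_def, ← map_mul,
          modePairing_swap hsymm q.1]
        congr 1
        ring
  refine ⟨CliffordAlgebra.lift _ ⟨f, fun x => ?_⟩, fun p => ?_⟩
  · have h2 := h x x
    rw [← two_smul ℂ, ← two_smul ℂ (halfForm C x x), smul_eq_mul, map_mul, ← Algebra.smul_def] at h2
    exact smul_right_injective _ (two_ne_zero (α := ℂ)) h2
  · rw [fockVec, CliffordAlgebra.lift_ι_apply]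
    exact (Finsupp.linearCombination_single ℂ 1 p).trans (one_smul _ _)

/-- The Poincaré–Birkhoff–Witt property of the induced module. -/
theorem bijective_smul_vac (hcut : ∀ k, 1 < k → C k = 0) (hsymm : ∀ k a b, C k a b = C k b a) :
    Function.Bijective (fun x : nonposSubalgebra C => (x : ModeAlgebra C) • vac C) := by
  constructor
  · obtain ⟨ρ, f, hρ, hf⟩ := exists_inducedModule_fock hcut hsymm
    obtain ⟨Φ, hΦ⟩ := exists_fockAlgebra_hom hsymm
    have hle : nonposSubalgebra C ≤ Φ.range := by
      refine Algebra.adjoin_le ?_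
      rintro _ ⟨a, n, hn, rfl⟩
      refine ⟨fockVec C (a, (-n).toNat), ?_⟩
      change Φ _ = _
      rw [hΦ]
      congr 1
      simp only
      omega
    have hcomp : ρ.comp Φ = Algebra.lmul ℂ (FockAlgebra C) := by
      ext1
      ext1 p
      ext1
      change ρ (Φ (fockVec C p)) = Algebra.lmul ℂ (FockAlgebra C) (fockVec C p)
      rw [hΦ, hρ, fockMode, if_pos (by omega)]
      simp
    -- In the model, `Φ z` acts as left multiplication by `z`, and the vacuum goes to `1`; so `z`
    -- can be recovered from its action on the vacuum.
    have hinv : ∀ z, f (Φ z • vac C) = z := by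
      intro z
      have h := congrArg (fun F : FockAlgebra C →ₐ[ℂ] Module.End ℂ (FockAlgebra C) => F z 1) hcomp
      rw [hf]
      simpa using h
    rintro ⟨x, hx⟩ ⟨y, hy⟩ hxy
    obtain ⟨z, rfl⟩ := hle hx
    obtain ⟨z', rfl⟩ := hle hy
    have h : f (Φ z • vac C) = f (Φ z' • vac C) := congrArg f hxy
    rw [hinv, hinv] at h
    subst h
    rfl
  · obtain ⟨S, hSv, hS⟩ := exists_fermionRep hcut hsymm
    let g : ModeAlgebra C →ₗ[ℂ] InducedModule C :=
      LinearMap.toSpanSingleton (ModeAlgebra C) (InducedModule C) (vac C) |>.restrictScalars ℂ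
    set W := (Subalgebra.toSubmodule (nonposSubalgebra C)).map g with hW
    have hmem : ∀ y ∈ nonposSubalgebra C, y • vac C ∈ W := fun y hy => ⟨y, hy, rfl⟩
    have hpsi : ∀ (b : Fin 2) (m : ℤ), m ≤ 0 → psi C b m ∈ nonposSubalgebra C :=
      fun b m hm => Algebra.subset_adjoin ⟨b, m, hm, rfl⟩
    have hmul : ∀ x ∈ nonposSubalgebra C, ∀ w ∈ W, x • w ∈ W := by
      rintro x hx _ ⟨y, hy, rfl⟩
      change x • y • vac C ∈ W
      rw [← mul_smul]
      exact hmem _ (mul_mem hx hy)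
    -- A positive mode can be moved to the right through any product of nonpositive modes at the
    -- cost of scalars, so it preserves the span `W` of what these create.
    have hpos : ∀ (a : Fin 2) (n : ℤ), ∀ x ∈ nonposSubalgebra C, ∀ w ∈ W, psi C a n • w ∈ W →
        psi C a n • x • w ∈ W := by
      intro a n x hx
      induction hx using Algebra.adjoin_induction with
      | mem x hx =>
        obtain ⟨b, m, hm, rfl⟩ := hx
        intro w hw hw'
        rw [← mul_smul, eq_sub_of_add_eq (psi_anticomm a n b m), sub_smul, mul_smul, algebraMap_smul]
        exact W.sub_mem (W.smul_mem _ hw) (hmul _ (hpsi b m hm) _ hw')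
      | algebraMap r =>
        intro w _ hw'
        rw [← mul_smul, ← Algebra.commutes, mul_smul, algebraMap_smul]
        exact W.smul_mem _ hw'
      | add x y _ _ hx hy =>
        intro w hw hw'
        rw [add_smul, smul_add]
        exact W.add_mem (hx w hw hw') (hy w hw hw')
      | mul x y _ hy' hx hy =>
        intro w hw hw'
        rw [mul_smul]
        exact hx _ (hmul y hy' w hw) (hy w hw hw')
    have hvac : vac C ∈ W := by
      have h := hmem 1 (one_mem _)
      rwa [one_smul] at h
    have htop : W = ⊤ := by
      refine S.gen W (by rw [hSv]; exact hvac) fun a n u hu => ?_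
      rw [hS]
      obtain ⟨y, hy, rfl⟩ := hu
      rcases le_or_gt n 0 with hn | hn
      · exact hmul _ (hpsi a n hn) _ (hmem y hy)
      · refine hpos a n y hy _ hvac ?_
        rw [← hS, ← hSv, S.vac a n (by omega)]
        exact W.zero_mem
    intro u
    have hu : u ∈ W := htop ▸ Submodule.mem_top
    obtain ⟨y, hy, rfl⟩ := hu
    exact ⟨⟨y, hy⟩, rfl⟩

end SymplecticFermion

/-! ### Simplicity -/

namespace FermionRep

variable {C : ℤ → Matrix (Fin 2) (Fin 2) ℂ} {M : Type*} [AddCommGroup M] [Module ℂ M]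
  (S : FermionRep C M)

/-- A nonzero subspace stable under all modes contains a nonzero vector killed by all positive
modes. -/
theorem exists_singular_mem (W : Submodule ℂ M) (hW : ∀ a n, ∀ u ∈ W, S.ψ a n u ∈ W) {u : M}
    (hu : u ∈ W) (hu0 : u ≠ 0) :
    ∃ w ∈ W, w ≠ 0 ∧ ∀ a n, 1 ≤ n → S.ψ a n w = 0 := by
  classical
  -- Induction on the finite set of positive modes not yet known to kill `u`. A mode that does not
  -- is applied: it squares to zero and anticommutes with the other positive modes, so the result is
  -- killed by it and keeps the vanishing already obtained.
  have key : ∀ (s : Finset (Fin 2 × ℤ)) (u : M), u ∈ W → u ≠ 0 →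
      (∀ p : Fin 2 × ℤ, 1 ≤ p.2 → p ∉ s → S.ψ p.1 p.2 u = 0) →
      ∃ w ∈ W, w ≠ 0 ∧ ∀ a n, 1 ≤ n → S.ψ a n w = 0 := by
    intro s
    induction s using Finset.induction_on with
    | empty => exact fun u hu hu0 h => ⟨u, hu, hu0, fun a n hn => h (a, n) hn (by simp)⟩
    | insert p s _ ih =>
      intro u hu hu0 h
      by_cases hp : 1 ≤ p.2 ∧ S.ψ p.1 p.2 u ≠ 0
      · refine ih _ (hW p.1 p.2 u hu) hp.2 fun q hq hqs => ?_
        have e := congrArg (fun Z : Module.End ℂ M => Z u) (S.anticomm q.1 q.2 p.1 p.2)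
        simp only [LinearMap.add_apply, Module.End.mul_apply] at e
        rw [S.modePairing_eq_zero (by omega), zero_smul, LinearMap.zero_apply] at e
        by_cases hqp : q = p
        · subst hqp
          rw [← two_smul ℂ] at e
          exact (smul_eq_zero.mp e).resolve_left two_ne_zero
        · rwa [h q hq (by simp [hqp, hqs]), map_zero, add_zero] at e
      · refine ih u hu hu0 fun q hq hqs => ?_
        by_cases hqp : q = p
        · subst hqp
          by_contra h0
          exact hp ⟨hq, h0⟩
        · exact h q hq (by simp [hqp, hqs])
  obtain ⟨K, hK⟩ := S.smooth u
  refine key (Finset.univ ×ˢ Finset.Icc 1 K) u hu hu0 fun p hp hps => hK _ _ ?_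
  simp only [Finset.mem_product, Finset.mem_univ, true_and, Finset.mem_Icc, not_and, not_le] at hps
  exact (hps hp).le

/-- If singular vectors are multiples of the vacuum, stable subspaces are trivial. -/
theorem eq_bot_or_eq_top (hvac : ∀ u, (∀ a n, 1 ≤ n → S.ψ a n u = 0) → ∃ t : ℂ, u = t • S.v)
    (W : Submodule ℂ M) (hW : ∀ a n, ∀ u ∈ W, S.ψ a n u ∈ W) : W = ⊥ ∨ W = ⊤ := by
  rw [or_iff_not_imp_left]
  intro h
  obtain ⟨u, hu, hu0⟩ := W.exists_mem_ne_zero_of_ne_bot h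
  obtain ⟨w, hw, hw0, hw1⟩ := S.exists_singular_mem W hW hu hu0
  obtain ⟨t, rfl⟩ := hvac w hw1
  refine S.gen W ?_ hW
  have ht : t ≠ 0 := fun h => hw0 (by rw [h, zero_smul])
  exact (W.smul_mem_iff ht).mp hw

end FermionRep

/-! ### Sorted monomials in Virasoro operators -/

section SortedMonomials

variable {N : Type*} [AddCommGroup N] [Module ℂ N] (X : ℤ → Module.End ℂ N) (g : N)

/-- The monomial `X (-l₁) X (-l₂) ⋯ g`. -/
def opMon (l : List ℕ) : N := l.foldr (fun (n : ℕ) u => X (-n) u) g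

@[simp] theorem opMon_nil : opMon X g [] = g := rfl

@[simp] theorem opMon_cons (n : ℕ) (l : List ℕ) : opMon X g (n :: l) = X (-n) (opMon X g l) := rfl

/-- The span of the monomials with `∑ (lᵢ + 1) < d`. -/
def opFlt (d : ℕ) : Submodule ℂ N :=
  Submodule.span ℂ (opMon X g '' {l | (l.map (· + 1)).sum < d})

theorem opFlt_mono {d e : ℕ} (h : d ≤ e) : opFlt X g d ≤ opFlt X g e :=
  Submodule.span_mono (Set.image_mono fun _ hl => lt_of_lt_of_le hl h)

theorem opMon_mem_opFlt {l : List ℕ} {d : ℕ} (h : (l.map (· + 1)).sum < d) :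
    opMon X g l ∈ opFlt X g d :=
  Submodule.subset_span ⟨l, h, rfl⟩

theorem apply_mem_opFlt {n d e : ℕ} (he : n + 1 + d ≤ e) {u : N} (hu : u ∈ opFlt X g d) :
    X (-n) u ∈ opFlt X g e := by
  have h : opFlt X g d ≤ (opFlt X g e).comap (X (-n)) := by
    refine Submodule.span_le.mpr ?_
    rintro _ ⟨l, hl, rfl⟩
    refine opMon_mem_opFlt X g (l := n :: l) ?_
    rw [List.map_cons, List.sum_cons]
    have : (l.map (· + 1)).sum < d := hl
    omega
  exact h hu

variable {X} {z : ℤ → ℤ → ℂ}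

/-- Each entry is weighted by `lᵢ + 1`, so the commutator term, which merges two entries into their
sum, lowers the weight by one, and the central term lowers it further. -/
theorem opMon_sub_mem_of_perm
    (hX : ∀ m n, X m * X n - X n * X m
    = ((m : ℂ) - n) • X (m + n) + z m n • (1 : Module.End ℂ N))
    {l l' : List ℕ} (h : l.Perm l') :
    opMon X g l - opMon X g l' ∈ opFlt X g (l.map (· + 1)).sum := by
  induction h with
  | nil => rw [sub_self]; exact Submodule.zero_mem _
  | @cons n l l' _ ih =>
    rw [opMon_cons, opMon_cons, ← map_sub]
    exact apply_mem_opFlt X g (by rw [List.map_cons, List.sum_cons]) ih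
  | swap x y l =>
    have e := congrArg (fun Z : Module.End ℂ N => Z (opMon X g l)) (hX (-y) (-x))
    simp only [LinearMap.sub_apply, LinearMap.add_apply, Module.End.mul_apply,
      LinearMap.smul_apply, Module.End.one_apply] at e
    simp only [opMon_cons]
    rw [e, show (-(y : ℤ) + -(x : ℤ)) = -((y + x : ℕ) : ℤ) by push_cast; ring, ← opMon_cons]
    refine Submodule.add_mem _ (Submodule.smul_mem _ _ (opMon_mem_opFlt X g ?_))
      (Submodule.smul_mem _ _ (opMon_mem_opFlt X g ?_)) <;>
    · simp only [List.map_cons, List.sum_cons]; omega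
  | @trans l₁ l₂ l₃ h₁ _ ih₁ ih₂ =>
    rw [← (h₁.map (· + 1)).sum_eq] at ih₂
    have := Submodule.add_mem _ ih₁ ih₂
    rwa [sub_add_sub_cancel] at this

/-- Induction on weight: a monomial differs from its sorted version by monomials of smaller weight.
-/
theorem opMon_mem_span_sorted
    (hX : ∀ m n, X m * X n - X n * X m
    = ((m : ℂ) - n) • X (m + n) + z m n • (1 : Module.End ℂ N))
    (l : List ℕ) : opMon X g l
    ∈ Submodule.span ℂ (Set.range fun s : Multiset ℕ => opMon X g (s.sort (· ≤ ·))) := by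
  set G := Submodule.span ℂ (Set.range fun s : Multiset ℕ => opMon X g (s.sort (· ≤ ·))) with hG
  have key : ∀ d, opFlt X g d ≤ G := by
    intro d
    induction d with
    | zero =>
      refine Submodule.span_le.mpr ?_
      rintro _ ⟨l, hl, rfl⟩
      exact absurd hl (Nat.not_lt_zero _)
    | succ d ih =>
      refine Submodule.span_le.mpr ?_
      rintro _ ⟨l, hl, rfl⟩
      have hl' : (l.map (· + 1)).sum < d + 1 := hl
      have hp : l.Perm ((l : Multiset ℕ).sort (· ≤ ·)) :=
        Multiset.coe_eq_coe.mp (Multiset.sort_eq _ _).symm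
      have h := ih (opFlt_mono X g (Nat.lt_succ_iff.mp hl') (opMon_sub_mem_of_perm g hX hp))
      have h' := G.add_mem h (Submodule.subset_span ⟨(l : Multiset ℕ), rfl⟩)
      rwa [sub_add_cancel] at h'
  exact key _ (opMon_mem_opFlt X g (Nat.lt_succ_self _))

/-- If the `X n` with `n ≥ 1` act on `g` by scalars, the sorted monomials span a subspace stable
under all `X n`. -/
theorem apply_mem_span_sorted
    (hX : ∀ m n, X m * X n - X n * X m
    = ((m : ℂ) - n) • X (m + n) + z m n • (1 : Module.End ℂ N))
    (hg : ∀ n : ℤ, 1 ≤ n → ∃ a : ℂ, X n g = a • g) (m : ℤ) {u : N}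
    (hu : u ∈ Submodule.span ℂ (Set.range fun s : Multiset ℕ => opMon X g (s.sort (· ≤ ·)))) :
    X m u ∈ Submodule.span ℂ (Set.range fun s : Multiset ℕ => opMon X g (s.sort (· ≤ ·))) := by
  set G := Submodule.span ℂ (Set.range fun s : Multiset ℕ => opMon X g (s.sort (· ≤ ·))) with hG
  have hnonpos : ∀ (n : ℕ), ∀ u ∈ G, X (-n) u ∈ G := by
    intro n u hu
    have h : G ≤ G.comap (X (-n)) := by
      refine Submodule.span_le.mpr ?_
      rintro _ ⟨s, rfl⟩
      exact opMon_mem_span_sorted g hX (n :: s.sort (· ≤ ·))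
    exact h hu
  have hmon : ∀ (l : List ℕ) (m : ℤ), X m (opMon X g l) ∈ G := by
    intro l
    induction l with
    | nil =>
      intro m
      rcases le_or_gt 1 m with hm | hm
      · obtain ⟨a, ha⟩ := hg m hm
        rw [opMon_nil, ha]
        exact G.smul_mem _ (opMon_mem_span_sorted g hX [])
      · obtain ⟨n, rfl⟩ : ∃ n : ℕ, m = -n := ⟨(-m).toNat, by omega⟩
        exact hnonpos n _ (opMon_mem_span_sorted g hX [])
    | cons n l ih =>
      intro m
      have e := congrArg (fun Z : Module.End ℂ N => Z (opMon X g l)) (hX m (-n))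
      simp only [LinearMap.sub_apply, LinearMap.add_apply, Module.End.mul_apply,
        LinearMap.smul_apply, Module.End.one_apply] at e
      rw [opMon_cons, eq_add_of_sub_eq e]
      exact G.add_mem (G.add_mem (G.smul_mem _ (ih _))
        (G.smul_mem _ (opMon_mem_span_sorted g hX l))) (hnonpos n _ (ih m))
  have h : G ≤ G.comap (X m) := by
    refine Submodule.span_le.mpr ?_
    rintro _ ⟨s, rfl⟩
    exact hmon _ m
  exact h hu

end SortedMonomials

/-! ### Universal Whittaker modules -/

namespace Virasoro

section

attribute [local instance 100] LieRing.ofAssociativeRing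

theorem ι_lie (X Y : Virasoro) : UniversalEnvelopingAlgebra.ι ℂ ⁅X, Y⁆
    = UniversalEnvelopingAlgebra.ι ℂ X * UniversalEnvelopingAlgebra.ι ℂ Y
      - UniversalEnvelopingAlgebra.ι ℂ Y * UniversalEnvelopingAlgebra.ι ℂ X := by
  rw [LieHom.map_lie, LieRing.of_associative_ring_bracket]

theorem exists_universalEnvelopingAlgebra_lift {R : Type*} [Ring R] [Algebra ℂ R]
    (ρ : Virasoro →ₗ[ℂ] R) (hρ : ∀ X Y : Virasoro, ρ ⁅X, Y⁆ = ρ X * ρ Y - ρ Y * ρ X) :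
    ∃ F : UniversalEnvelopingAlgebra ℂ Virasoro →ₐ[ℂ] R,
      ∀ X, F (UniversalEnvelopingAlgebra.ι ℂ X) = ρ X := by
  let f : Virasoro →ₗ⁅ℂ⁆ R :=
    { ρ with
      map_lie' := fun {X Y} => by
        rw [LieRing.of_associative_ring_bracket]
        exact hρ X Y }
  exact ⟨UniversalEnvelopingAlgebra.lift ℂ f, fun X => UniversalEnvelopingAlgebra.lift_ι_apply ℂ f X⟩

/-- The inclusion of the generators lifts to a homomorphism into the subalgebra they generate;
followed by the inclusion it is the identity, by uniqueness in the universal property. -/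
theorem adjoin_ι : Algebra.adjoin ℂ (Set.range (UniversalEnvelopingAlgebra.ι ℂ (L := Virasoro)))
    = ⊤ := by
  set A := Algebra.adjoin ℂ (Set.range (UniversalEnvelopingAlgebra.ι ℂ (L := Virasoro))) with hA
  have hmem : ∀ X, UniversalEnvelopingAlgebra.ι ℂ X ∈ A := fun X => Algebra.subset_adjoin ⟨X, rfl⟩
  obtain ⟨F, hF⟩ := exists_universalEnvelopingAlgebra_lift
    (R := A) ((UniversalEnvelopingAlgebra.ι ℂ (L := Virasoro) : Virasoro →ₗ[ℂ] _).codRestrict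
      (Subalgebra.toSubmodule A) hmem) fun X Y => by
        refine Subtype.ext ?_
        exact ι_lie X Y
  have hid : A.val.comp F = AlgHom.id ℂ _ := by
    refine UniversalEnvelopingAlgebra.hom_ext (R := ℂ) (LieHom.ext fun X => ?_)
    exact congrArg Subtype.val (hF X)
  rw [eq_top_iff]
  rintro x -
  have h := DFunLike.congr_fun hid x
  simp only [AlgHom.comp_apply, AlgHom.id_apply] at h
  rw [← h]
  exact (F x).2

end

theorem eq_sum_L_add_central (X : Virasoro) :
    X = (Finsupp.linearCombination ℂ L X.1 : Virasoro) + X.2 • central := by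
  have h : ∀ f : ℤ →₀ ℂ, Finsupp.linearCombination ℂ L f = ((f, 0) : (ℤ →₀ ℂ) × ℂ) := by
    intro f
    induction f using Finsupp.induction_linear with
    | zero => rw [map_zero]; rfl
    | add f g hf hg =>
      rw [map_add, hf, hg]
      exact Prod.ext rfl (add_zero (0 : ℂ))
    | single n a =>
      rw [Finsupp.linearCombination_single]
      refine Prod.ext ?_ (smul_zero a)
      exact (Finsupp.smul_single_one n a)
  rw [h]
  refine Prod.ext ?_ ?_
  · exact (show X.1 = X.1 + X.2 • (0 : ℤ →₀ ℂ) by rw [smul_zero, add_zero])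
  · exact (show X.2 = 0 + X.2 • (1 : ℂ) by rw [zero_add, smul_eq_mul, mul_one])

theorem central_lie (X : Virasoro) : ⁅central, X⁆ = 0 :=
  Prod.ext (wittBracket_zero_left X.1) (cocycle_zero_left X.1)

theorem ι_central_mul (x : UniversalEnvelopingAlgebra ℂ Virasoro) :
    UniversalEnvelopingAlgebra.ι ℂ central * x = x * UniversalEnvelopingAlgebra.ι ℂ central := by
  have hx : x ∈ Algebra.adjoin ℂ (Set.range (UniversalEnvelopingAlgebra.ι ℂ (L := Virasoro))) := by
    rw [adjoin_ι]; trivial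
  induction hx using Algebra.adjoin_induction with
  | mem x hx =>
    obtain ⟨X, rfl⟩ := hx
    rw [← sub_eq_zero, ← ι_lie, central_lie, map_zero]
  | algebraMap r => exact (Algebra.commutes r _).symm
  | add x y _ _ hx hy => rw [mul_add, add_mul, hx, hy]
  | mul x y _ _ hx hy => rw [← mul_assoc, hx, mul_assoc, hy, mul_assoc]

variable (c a₁ a₂ : ℂ)

theorem UniversalWhittaker.mk_eq_smul_gen (x : UniversalEnvelopingAlgebra ℂ Virasoro) :
    (Submodule.Quotient.mk x : UniversalWhittaker c a₁ a₂) = x • gen c a₁ a₂ := by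
  rw [gen, ← Submodule.Quotient.mk_smul, smul_eq_mul, mul_one]

theorem UniversalWhittaker.smul_gen_eq {x : UniversalEnvelopingAlgebra ℂ Virasoro} {t : ℂ}
    (h : x - algebraMap ℂ _ t ∈ whittakerIdeal c a₁ a₂) :
    x • gen c a₁ a₂ = t • gen c a₁ a₂ := by
  rw [← Submodule.Quotient.mk_eq_zero, mk_eq_smul_gen, sub_smul, algebraMap_smul] at h
  exact sub_eq_zero.mp h

theorem UniversalWhittaker.central_smul (x : UniversalWhittaker c a₁ a₂) :
    UniversalEnvelopingAlgebra.ι ℂ central • x = c • x := by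
  obtain ⟨x, rfl⟩ := Submodule.Quotient.mk_surjective _ x
  rw [mk_eq_smul_gen, ← mul_smul, ι_central_mul, mul_smul,
    smul_gen_eq c a₁ a₂ (t := c) (Submodule.subset_span (Or.inl (Or.inl rfl))), smul_comm]

theorem UniversalWhittaker.L_smul_gen {n : ℤ} (hn : 1 ≤ n) :
    ∃ a : ℂ, UniversalEnvelopingAlgebra.ι ℂ (L n) • gen c a₁ a₂ = a • gen c a₁ a₂ := by
  rcases (by omega : n = 1 ∨ n = 2 ∨ 3 ≤ n) with rfl | rfl | h
  · exact ⟨a₁, smul_gen_eq c a₁ a₂ (Submodule.subset_span (Or.inl (Or.inr (Or.inl rfl))))⟩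
  · exact ⟨a₂, smul_gen_eq c a₁ a₂ (Submodule.subset_span (Or.inl (Or.inr (Or.inr rfl))))⟩
  · refine ⟨0, smul_gen_eq c a₁ a₂ ?_⟩
    rw [map_zero, sub_zero]
    exact Submodule.subset_span (Or.inr ⟨n, h, rfl⟩)

/-- A cyclic `U(Vir)`-module on which the central element acts as a scalar, generated by an
eigenvector of the `L n` with `n ≥ 1`, is spanned by sorted monomials in the `L (-n)`, `n ≥ 0`. -/
theorem span_sorted_eq_top {N : Type*} [AddCommGroup N] [Module ℂ N]
    [Module (UniversalEnvelopingAlgebra ℂ Virasoro) N]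
    [IsScalarTower ℂ (UniversalEnvelopingAlgebra ℂ Virasoro) N] {c : ℂ} {g : N}
    (hc : ∀ x : N, UniversalEnvelopingAlgebra.ι ℂ central • x = c • x)
    (hg : ∀ n : ℤ, 1 ≤ n → ∃ a : ℂ, UniversalEnvelopingAlgebra.ι ℂ (L n) • g = a • g)
    (hgen : ∀ u : N, ∃ x : UniversalEnvelopingAlgebra ℂ Virasoro, u = x • g)
    (X : ℤ → Module.End ℂ N) (hX : ∀ n u, X n u = UniversalEnvelopingAlgebra.ι ℂ (L n) • u) :
    Submodule.span ℂ (Set.range fun s : Multiset ℕ => opMon X g (s.sort (· ≤ ·))) = ⊤ := by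
  set G := Submodule.span ℂ (Set.range fun s : Multiset ℕ => opMon X g (s.sort (· ≤ ·))) with hG
  have hrel : ∀ m n, X m * X n - X n * X m = ((m : ℂ) - n) • X (m + n)
        + ((if m + n = 0 then ((m : ℂ) ^ 3 - m) / 12 else 0) * c) • 1 := by
    intro m n
    ext1 x
    simp only [LinearMap.sub_apply, LinearMap.add_apply, Module.End.mul_apply,
      LinearMap.smul_apply, Module.End.one_apply, hX]
    rw [← mul_smul, ← mul_smul, ← sub_smul, ← ι_lie, L_lie_L, map_add, map_smul, map_smul, add_smul,
      smul_assoc, smul_assoc, hc, mul_smul]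
  have hL : ∀ n, ∀ u ∈ G, UniversalEnvelopingAlgebra.ι ℂ (L n) • u ∈ G := fun n u hu => by
    rw [← hX]
    exact apply_mem_span_sorted g hrel (fun n hn => by rw [hX]; exact hg n hn) n hu
  have hι : ∀ X : Virasoro, ∀ u ∈ G, UniversalEnvelopingAlgebra.ι ℂ X • u ∈ G := by
    intro X u hu
    rw [eq_sum_L_add_central X, map_add, map_smul, add_smul, smul_assoc, hc]
    refine G.add_mem ?_ (G.smul_mem _ (G.smul_mem _ hu))
    generalize X.1 = f
    induction f using Finsupp.induction_linear with
    | zero => rw [map_zero, map_zero, zero_smul]; exact G.zero_mem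
    | add f g hf hg => rw [map_add, map_add, add_smul]; exact G.add_mem hf hg
    | single n a =>
      rw [Finsupp.linearCombination_single, map_smul, smul_assoc]
      exact G.smul_mem _ (hL n u hu)
  have hU : ∀ x : UniversalEnvelopingAlgebra ℂ Virasoro, ∀ u ∈ G, x • u ∈ G := by
    intro x
    have hx : x ∈ Algebra.adjoin ℂ
        (Set.range (UniversalEnvelopingAlgebra.ι ℂ (L := Virasoro))) := by
      rw [adjoin_ι]; trivial
    induction hx using Algebra.adjoin_induction with
    | mem x hx => obtain ⟨X, rfl⟩ := hx; exact hι X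
    | algebraMap r => intro u hu; rw [algebraMap_smul]; exact G.smul_mem _ hu
    | add x y _ _ hx hy => intro u hu; rw [add_smul]; exact G.add_mem (hx u hu) (hy u hu)
    | mul x y _ _ hx hy => intro u hu; rw [mul_smul]; exact hx _ (hy u hu)
  rw [eq_top_iff]
  rintro u -
  obtain ⟨x, rfl⟩ := hgen u
  exact hU x _ (opMon_mem_span_sorted g hrel [])

/-- The operator `L n` on the universal Whittaker module. -/
noncomputable def whittakerOp (n : ℤ) : Module.End ℂ (UniversalWhittaker c a₁ a₂) :=
  Algebra.lsmul ℂ ℂ _ (UniversalEnvelopingAlgebra.ι ℂ (L n))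

theorem whittakerOp_apply (n : ℤ) (x : UniversalWhittaker c a₁ a₂) :
    whittakerOp c a₁ a₂ n x = UniversalEnvelopingAlgebra.ι ℂ (L n) • x := rfl

theorem UniversalWhittaker.span_sorted_eq_top :
    Submodule.span ℂ (Set.range fun s : Multiset ℕ =>
      opMon (whittakerOp c a₁ a₂) (gen c a₁ a₂) (s.sort (· ≤ ·))) = ⊤ :=
  Virasoro.span_sorted_eq_top (central_smul c a₁ a₂) (fun _ hn => L_smul_gen c a₁ a₂ hn)
    (fun u => by
      obtain ⟨x, rfl⟩ := Submodule.Quotient.mk_surjective _ u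
      exact ⟨x, mk_eq_smul_gen c a₁ a₂ x⟩) _ (whittakerOp_apply c a₁ a₂)

/-- The universal property of the universal Whittaker module. -/
theorem UniversalWhittaker.exists_hom {M : Type*} [AddCommGroup M] [Module ℂ M]
    (ρ : Virasoro →ₗ[ℂ] Module.End ℂ M)
    (hρ : ∀ X Y : Virasoro, ρ ⁅X, Y⁆ = ρ X * ρ Y - ρ Y * ρ X) {w : M} (hc : ρ central w = c • w)
    (h₁ : ρ (L 1) w = a₁ • w) (h₂ : ρ (L 2) w = a₂ • w) (h₃ : ∀ n, 3 ≤ n → ρ (L n) w = 0) :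
    ∃ f : UniversalWhittaker c a₁ a₂ →ₗ[ℂ] M, f (gen c a₁ a₂) = w ∧
      ∀ X x, f (UniversalEnvelopingAlgebra.ι ℂ X • x) = ρ X (f x) := by
  obtain ⟨F, hF⟩ := exists_universalEnvelopingAlgebra_lift ρ hρ
  obtain ⟨f, hf⟩ := exists_quotient_span_lift
    ({UniversalEnvelopingAlgebra.ι ℂ central - algebraMap ℂ _ c,
      UniversalEnvelopingAlgebra.ι ℂ (L 1) - algebraMap ℂ _ a₁,
      UniversalEnvelopingAlgebra.ι ℂ (L 2) - algebraMap ℂ _ a₂} ∪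
     {x | ∃ n : ℤ, 3 ≤ n ∧ x = UniversalEnvelopingAlgebra.ι ℂ (L n)}) F w (by
      have h : ∀ X t, ρ X w = t • w →
          F (UniversalEnvelopingAlgebra.ι ℂ X - algebraMap ℂ _ t) w = 0 := by
        intro X t h
        rw [map_sub, hF, AlgHom.commutes, LinearMap.sub_apply, h, Module.algebraMap_end_apply,
          sub_self]
      rintro _ ((rfl | rfl | rfl) | ⟨n, hn, rfl⟩)
      · exact h _ _ hc
      · exact h _ _ h₁
      · exact h _ _ h₂
      · rw [hF, h₃ n hn])
  refine ⟨f, ?_, fun X x => ?_⟩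
  · exact (hf 1).trans (by rw [map_one, Module.End.one_apply])
  · obtain ⟨x, rfl⟩ := Submodule.Quotient.mk_surjective _ x
    rw [← Submodule.Quotient.mk_smul, smul_eq_mul]
    erw [hf, hf]
    rw [map_mul, hF, Module.End.mul_apply]

/-- Operators satisfying the Virasoro relations define a representation. -/
theorem exists_representation {M : Type*} [AddCommGroup M] [Module ℂ M] (X : ℤ → Module.End ℂ M)
    (hX : ∀ m n, X m * X n - X n * X m = ((m : ℂ) - n) • X (m + n)
      + (c * (if m + n = 0 then ((m : ℂ) ^ 3 - m) / 12 else 0)) • (1 : Module.End ℂ M)) :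
    ∃ ρ : Virasoro →ₗ[ℂ] Module.End ℂ M,
      (∀ Y Z : Virasoro, ρ ⁅Y, Z⁆ = ρ Y * ρ Z - ρ Z * ρ Y) ∧ (∀ n, ρ (L n) = X n) ∧
      ρ central = c • (1 : Module.End ℂ M) := by
  let ρ₀ : ((ℤ →₀ ℂ) × ℂ) →ₗ[ℂ] Module.End ℂ M :=
    (Finsupp.linearCombination ℂ X).coprod (LinearMap.toSpanSingleton ℂ _ (c • 1))
  have hρ₀ : ∀ f t, ρ₀ (f, t) = Finsupp.linearCombination ℂ X f + t • c • 1 := fun f t => rfl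
  have key : ∀ f g : ℤ →₀ ℂ, Finsupp.linearCombination ℂ X f * Finsupp.linearCombination ℂ X g
      - Finsupp.linearCombination ℂ X g * Finsupp.linearCombination ℂ X f
      = ρ₀ (wittBracket f g, cocycle f g) := by
    intro f g
    induction f using Finsupp.induction_linear with
    | zero =>
      rw [wittBracket_zero_left, cocycle_zero_left, map_zero, zero_mul, mul_zero, sub_zero]
      exact (map_zero ρ₀).symm
    | add f f' hf hf' =>
      rw [wittBracket_add_left, cocycle_add_left, ← Prod.mk_add_mk, map_add, map_add, ← hf, ← hf',
        add_mul, mul_add]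
      abel
    | single m a =>
      induction g using Finsupp.induction_linear with
      | zero =>
        rw [wittBracket_zero_right, cocycle_zero_right, map_zero, zero_mul, mul_zero, sub_zero]
        exact (map_zero ρ₀).symm
      | add g g' hg hg' =>
        rw [wittBracket_add_right, cocycle_add_right, ← Prod.mk_add_mk, map_add, map_add, ← hg,
          ← hg', add_mul, mul_add]
        abel
      | single n b =>
        rw [wittBracket_single, cocycle_single, hρ₀, Finsupp.linearCombination_single,
          Finsupp.linearCombination_single, Finsupp.linearCombination_single, smul_mul_smul_comm,
          smul_mul_smul_comm, mul_comm b a, ← smul_sub, hX, smul_add, smul_smul, smul_smul,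
          smul_smul]
        congr 2
        · ring
        · split_ifs <;> ring
  refine ⟨ρ₀, fun Y Z => ?_, fun n => ?_, ?_⟩
  · change ρ₀ (wittBracket Y.1 Z.1, cocycle Y.1 Z.1)
      = ρ₀ (Y.1, Y.2) * ρ₀ (Z.1, Z.2) - ρ₀ (Z.1, Z.2) * ρ₀ (Y.1, Y.2)
    rw [← key, hρ₀ Y.1, hρ₀ Z.1]
    simp only [add_mul, mul_add, smul_mul_assoc, mul_smul_comm, one_mul, mul_one]
    module
  · change ρ₀ (Finsupp.single n 1, 0) = X n
    rw [hρ₀, Finsupp.linearCombination_single, one_smul, zero_smul, add_zero]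
  · change ρ₀ (0, 1) = _
    rw [hρ₀, map_zero, one_smul, zero_add]

end Virasoro

/-- A linear map sending a spanning family to a basis is bijective. -/
theorem bijective_of_span_of_linearIndependent {ι N M : Type*} [AddCommGroup N] [Module ℂ N]
    [AddCommGroup M] [Module ℂ M] (e : N →ₗ[ℂ] M) (b : ι → N)
    (hb : Submodule.span ℂ (Set.range b) = ⊤) (hli : LinearIndependent ℂ fun i => e (b i))
    (hsp : Submodule.span ℂ (Set.range fun i => e (b i)) = ⊤) : Function.Bijective e := by
  constructor
  · rw [← LinearMap.ker_eq_bot, LinearMap.ker_eq_bot']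
    intro x hx
    have hx' : x ∈ Submodule.span ℂ (Set.range b) := hb ▸ Submodule.mem_top
    obtain ⟨s, rfl⟩ := (Finsupp.mem_span_range_iff_exists_finsupp).mp hx'
    have h0 : s = 0 := by
      refine linearIndependent_iff.mp hli s ?_
      rw [Finsupp.linearCombination_apply, ← hx, map_finsuppSum]
      simp only [map_smul]
    rw [h0, Finsupp.sum_zero_index]
  · rw [← LinearMap.range_eq_top, eq_top_iff, ← hsp]
    refine Submodule.span_le.mpr ?_
    rintro _ ⟨i, rfl⟩
    exact ⟨b i, rfl⟩

/-! ### Eigen-sections of a connection with diagonalizable irregular term -/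

section Connection

theorem cliffordParam_eq (A : ℤ → LieAlgebra.SpecialLinear.sl (Fin 2) ℂ) (k : ℤ) :
    cliffordParam A k = !![-(A k).val 1 0, -(A k).val 1 1; (A k).val 0 0, (A k).val 0 1] := by
  ext i j
  fin_cases i <;> fin_cases j <;> simp [cliffordParam, Matrix.mul_apply, Fin.sum_univ_two]

theorem sl_apply_one_one (X : LieAlgebra.SpecialLinear.sl (Fin 2) ℂ) : X.val 1 1 = -X.val 0 0 := by
  have h : Matrix.trace X.val = 0 := X.2
  rw [Matrix.trace_fin_two] at h
  exact eq_neg_of_add_eq_zero_right h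

/-- Symmetry after multiplication by the symplectic matrix is the same as having trace zero. -/
theorem cliffordParam_symm (A : ℤ → LieAlgebra.SpecialLinear.sl (Fin 2) ℂ) (k : ℤ) (a b : Fin 2) :
    cliffordParam A k a b = cliffordParam A k b a := by
  rw [cliffordParam_eq]
  fin_cases a <;> fin_cases b <;> simp [sl_apply_one_one]

theorem cliffordParam_eq_zero {A : ℤ → LieAlgebra.SpecialLinear.sl (Fin 2) ℂ} {k : ℤ}
    (h : A k = 0) : cliffordParam A k = 0 := by
  rw [cliffordParam, h]; simp

theorem connCoeff_cliffordParam (A : ℤ → LieAlgebra.SpecialLinear.sl (Fin 2) ℂ) (l : ℕ) :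
    connCoeff (cliffordParam A) l = (A (1 - l)).val := by
  rw [connCoeff, cliffordParam, ← Matrix.mul_assoc]
  ext i j
  fin_cases i <;> fin_cases j <;> simp [Matrix.mul_apply, Fin.sum_univ_two]

theorem FermionRep.IsEigenSection.smul {C : ℤ → Matrix (Fin 2) (Fin 2) ℂ} {ξ ε : ℂ}
    {f : ℕ → Fin 2 → ℂ} (hf : FermionRep.IsEigenSection C ξ ε f) (t : ℂ) :
    FermionRep.IsEigenSection C ξ ε fun s => t • f s := by
  intro s
  simp only [Matrix.mulVec_smul]
  rw [← Finset.smul_sum, hf s, smul_add, smul_comm t]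
  congr 1
  split_ifs
  · rw [smul_zero]
  · rw [smul_comm t]

variable {A : ℤ → LieAlgebra.SpecialLinear.sl (Fin 2) ℂ} {P Q : Matrix (Fin 2) (Fin 2) ℂ} {ξ ε : ℂ}

theorem exists_isEigenSection (hPQ : P * Q = 1) {η : ℂ} (hξ : ξ ≠ η)
    (h₁ : Q * (A 1).val * P = !![ξ, 0; 0, η]) (h₀ : (Q * (A 0).val * P) 0 0 = ε) :
    ∃ f, f 0 = P.mulVec ![1, 0] ∧ FermionRep.IsEigenSection (cliffordParam A) ξ ε f :=
  exists_formal_solution (connCoeff (cliffordParam A)) P Q hPQ ξ η ε hξ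
    (by rw [connCoeff_cliffordParam]; exact h₁) (by rw [connCoeff_cliffordParam]; exact h₀)

theorem conj_sl_apply_one_one (hPQ : P * Q = 1) (X : LieAlgebra.SpecialLinear.sl (Fin 2) ℂ) :
    (Q * X.val * P) 1 1 = -(Q * X.val * P) 0 0 := by
  have h : Matrix.trace (Q * X.val * P) = 0 := by
    rw [Matrix.trace_mul_comm, ← Matrix.mul_assoc, hPQ, Matrix.one_mul]
    exact X.2
  rw [Matrix.trace_fin_two] at h
  exact eq_neg_of_add_eq_zero_right h

/-- A pair of eigen-sections with opposite eigenvalues, normalized for the symplectic form. -/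
theorem exists_isEigenSection_pair (hPQ : P * Q = 1) (hξ : ξ ≠ 0)
    (h₁ : Q * (A 1).val * P = !![ξ, 0; 0, -ξ]) (h₀ : (Q * (A 0).val * P) 0 0 = ε) :
    ∃ f g, FermionRep.IsEigenSection (cliffordParam A) ξ ε f ∧
      FermionRep.IsEigenSection (cliffordParam A) (-ξ) (-ε) g ∧
      FermionRep.leadPairing (cliffordParam A) (g 0) (f 0) = ξ ∧
      ∀ y : Fin 2 → ℂ, ∃ s t : ℂ, y = s • f 0 + t • g 0 := by
  have hξ' : ξ ≠ -ξ := fun h => hξ (self_eq_neg.mp h)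
  obtain ⟨f, hf0, hf⟩ := exists_isEigenSection hPQ hξ' h₁ h₀
  have hσ : (!![0, 1; 1, 0] : Matrix (Fin 2) (Fin 2) ℂ) * !![0, 1; 1, 0] = 1 := by
    ext i j
    fin_cases i <;> fin_cases j <;> simp
  have hswap : ∀ X : Matrix (Fin 2) (Fin 2) ℂ, (!![0, 1; 1, 0] * Q) * X * (P * !![0, 1; 1, 0])
      = !![(Q * X * P) 1 1, (Q * X * P) 1 0; (Q * X * P) 0 1, (Q * X * P) 0 0] := by
    intro X
    have e : (!![0, 1; 1, 0] * Q) * X * (P * !![0, 1; 1, 0])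
        = !![0, 1; 1, 0] * (Q * X * P) * !![0, 1; 1, 0] := by
      simp only [Matrix.mul_assoc]
    rw [e]
    generalize Q * X * P = Y
    ext i j
    fin_cases i <;> fin_cases j <;> simp [Matrix.mul_apply, Fin.sum_univ_two, Matrix.vecMul, dotProduct]
  -- Exchanging the two columns of `P` exchanges the eigenvalues; the exponent becomes `-ε` because
  -- `A 0` has trace zero.
  obtain ⟨g, hg0, hg⟩ := exists_isEigenSection (A := A) (P := P * !![0, 1; 1, 0])
    (Q := !![0, 1; 1, 0] * Q) (ξ := -ξ) (η := ξ) (ε := -ε)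
    (by rw [Matrix.mul_assoc, ← Matrix.mul_assoc !![0, 1; 1, 0] _ Q, hσ, Matrix.one_mul, hPQ])
    hξ'.symm (by rw [hswap, h₁]; simp)
    (by rw [hswap, ← h₀, ← conj_sl_apply_one_one hPQ]; rfl)
  have hdet : P.det ≠ 0 := by
    have h := congrArg Matrix.det hPQ
    rw [Matrix.det_mul, Matrix.det_one] at h
    exact left_ne_zero_of_mul_eq_one h
  have hf0' : f 0 = ![P 0 0, P 1 0] := by
    rw [hf0]; ext i; fin_cases i <;> simp [Matrix.mulVec, dotProduct]
  have hg0' : g 0 = ![P 0 1, P 1 1] := by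
    rw [hg0]; ext i; fin_cases i <;> simp [Matrix.mulVec, dotProduct, Matrix.mul_apply]
  have heig : (A 1).val * P = P * !![ξ, 0; 0, -ξ] := by
    rw [← h₁, ← Matrix.mul_assoc, ← Matrix.mul_assoc, hPQ, Matrix.one_mul]
  have e0 : (A 1).val 0 0 * P 0 0 + (A 1).val 0 1 * P 1 0 = P 0 0 * ξ := by
    have h := congrFun (congrFun heig 0) 0
    simpa [Matrix.mul_apply, Fin.sum_univ_two] using h
  have e1 : (A 1).val 1 0 * P 0 0 + (A 1).val 1 1 * P 1 0 = P 1 0 * ξ := by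
    have h := congrFun (congrFun heig 1) 0
    simpa [Matrix.mul_apply, Fin.sum_univ_two] using h
  -- The leading coefficients are the columns of `P`, and their pairing through `A 1` is `P.det *
  -- ξ`, whence the normalization.
  refine ⟨f, fun s => P.det⁻¹ • g s, hf, hg.smul _, ?_, fun y => ?_⟩
  · have e : FermionRep.leadPairing (cliffordParam A) (P.det⁻¹ • g 0) (f 0)
        = P.det⁻¹ * (P.det * ξ) := by
      rw [FermionRep.leadPairing, smul_dotProduct, smul_eq_mul, hf0', hg0', cliffordParam_eq,
        Matrix.det_fin_two]
      simp only [dotProduct, Matrix.mulVec, Fin.sum_univ_two, Matrix.of_apply, Matrix.cons_val_zero,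
        Matrix.cons_val_one, Matrix.cons_val', Matrix.cons_val_fin_one]
      congr 1
      linear_combination P 1 1 * e0 - P 0 1 * e1
    rw [e, inv_mul_cancel_left₀ hdet]
  · refine ⟨Q.mulVec y 0, P.det * Q.mulVec y 1, ?_⟩
    have h : y = P.mulVec (Q.mulVec y) := by rw [Matrix.mulVec_mulVec, hPQ, Matrix.one_mulVec]
    rw [smul_smul, mul_assoc, mul_comm (Q.mulVec y 1), mul_inv_cancel_left₀ hdet, hf0', hg0']
    conv_lhs => rw [h]
    generalize Q.mulVec y = w
    ext i
    fin_cases i <;> simp [Matrix.mulVec, dotProduct, Fin.sum_univ_two] <;> ring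

/-- Only `A 1` enters, and the constant is `-det (A 1) / 2`, which is invariant under conjugation.
-/
theorem sugawaraConst_cliffordParam_two {M : Type*} [AddCommGroup M] [Module ℂ M]
    (S : FermionRep (cliffordParam A) M) (hPQ : P * Q = 1)
    (h₁ : Q * (A 1).val * P = !![ξ, 0; 0, -ξ]) :
    sugawaraConst (cliffordParam A) 2 = ξ ^ 2 / 2 := by
  have hdet : (A 1).val.det = -ξ ^ 2 := by
    have h := congrArg Matrix.det h₁
    rw [Matrix.det_mul, Matrix.det_mul, mul_right_comm, ← Matrix.det_mul,
      mul_eq_one_comm.mp hPQ, Matrix.det_one, one_mul, Matrix.det_fin_two_of] at h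
    rw [h]
    ring
  rw [Matrix.det_fin_two, sl_apply_one_one] at hdet
  rw [S.sugawaraConst_eq, show Finset.Icc ((2 : ℤ) - 1) 1 = {1} from rfl, Finset.sum_singleton,
    show (2 : ℤ) - 1 = 1 from rfl]
  simp only [cliffordParam_eq, sl_apply_one_one, Matrix.of_apply, Matrix.cons_val_zero,
    Matrix.cons_val_one, Matrix.cons_val', Matrix.cons_val_fin_one]
  linear_combination (-1 / 2) * hdet

/-- The constant is half the trace of `A 1 * A 0`. In the eigenbasis of `A 1` only the diagonal of
the conjugate of `A 0` matters, and it is `ε`, `-ε`. -/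
theorem sugawaraConst_cliffordParam_one {M : Type*} [AddCommGroup M] [Module ℂ M]
    (S : FermionRep (cliffordParam A) M) (hPQ : P * Q = 1)
    (h₁ : Q * (A 1).val * P = !![ξ, 0; 0, -ξ]) (h₀ : (Q * (A 0).val * P) 0 0 = ε) :
    sugawaraConst (cliffordParam A) 1 = ξ * ε := by
  have htr : Matrix.trace ((A 1).val * (A 0).val) = 2 * (ξ * ε) := by
    have e : P * ((Q * (A 1).val * P) * (Q * (A 0).val * P)) * Q = (A 1).val * (A 0).val := by
      have : P * ((Q * (A 1).val * P) * (Q * (A 0).val * P)) * Q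
          = (P * Q) * (A 1).val * (P * Q) * (A 0).val * (P * Q) := by
        simp only [Matrix.mul_assoc]
      rw [this, hPQ, Matrix.one_mul, Matrix.mul_one, Matrix.mul_one]
    rw [← e, Matrix.trace_mul_comm, ← Matrix.mul_assoc, mul_eq_one_comm.mp hPQ,
      Matrix.one_mul, h₁]
    have h11 := conj_sl_apply_one_one hPQ (A 0)
    rw [h₀] at h11
    rw [Matrix.trace_fin_two, Matrix.mul_apply, Matrix.mul_apply, Fin.sum_univ_two,
      Fin.sum_univ_two, h₀, h11]
    simp
    ring
  rw [Matrix.trace_fin_two, Matrix.mul_apply, Matrix.mul_apply, Fin.sum_univ_two,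
    Fin.sum_univ_two, sl_apply_one_one, sl_apply_one_one] at htr
  rw [S.sugawaraConst_eq, show Finset.Icc ((1 : ℤ) - 1) 1 = {0, 1} from rfl,
    Finset.sum_pair zero_ne_one, show (1 : ℤ) - 0 = 1 from rfl, show (1 : ℤ) - 1 = 0 from rfl]
  simp only [cliffordParam_eq, sl_apply_one_one, Matrix.of_apply, Matrix.cons_val_zero,
    Matrix.cons_val_one, Matrix.cons_val', Matrix.cons_val_fin_one]
  linear_combination (1 / 2) * htr

end Connection

/-! ### The Sugawara representation -/

theorem DirectSum.span_of_eq_top {ι κ : Type*} [DecidableEq ι] {N : ι → Type*}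
    [∀ i, AddCommGroup (N i)] [∀ i, Module ℂ (N i)] (b : ∀ i, κ → N i)
    (hb : ∀ i, Submodule.span ℂ (Set.range (b i)) = ⊤) :
    Submodule.span ℂ (Set.range fun p : ι × κ => DirectSum.lof ℂ ι N p.1 (b p.1 p.2)) = ⊤ := by
  rw [eq_top_iff]
  rintro x -
  induction x using DirectSum.induction_on with
  | zero => exact Submodule.zero_mem _
  | add x y hx hy => exact Submodule.add_mem _ hx hy
  | of i y =>
    have h : Submodule.span ℂ (Set.range (b i)) ≤ (Submodule.span ℂ
        (Set.range fun p : ι × κ => DirectSum.lof ℂ ι N p.1 (b p.1 p.2))).comap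
        (DirectSum.lof ℂ ι N i) := by
      refine Submodule.span_le.mpr ?_
      rintro _ ⟨k, rfl⟩
      exact Submodule.subset_span ⟨(i, k), rfl⟩
    rw [hb i] at h
    exact h (Submodule.mem_top (x := y))

namespace Virasoro

/-- A representation of the Virasoro algebra with a basis of sorted monomials on Whittaker vectors
is a direct sum of universal Whittaker modules. -/
theorem exists_whittaker_decomposition {ι M : Type*} [DecidableEq ι] [AddCommGroup M] [Module ℂ M]
    (ρ : Virasoro →ₗ[ℂ] Module.End ℂ M)
    (hρ : ∀ X Y : Virasoro, ρ ⁅X, Y⁆ = ρ X * ρ Y - ρ Y * ρ X) (c : ℂ) (a₁ a₂ : ι → ℂ) (w : ι → M)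
    (hc : ∀ i, ρ central (w i) = c • w i) (h₁ : ∀ i, ρ (L 1) (w i) = a₁ i • w i)
    (h₂ : ∀ i, ρ (L 2) (w i) = a₂ i • w i) (h₃ : ∀ i n, 3 ≤ n → ρ (L n) (w i) = 0)
    (hli : LinearIndependent ℂ fun p : ι × Multiset ℕ =>
      opMon (fun n => ρ (L n)) (w p.1) (p.2.sort (· ≤ ·)))
    (hsp : Submodule.span ℂ (Set.range fun p : ι × Multiset ℕ =>
      opMon (fun n => ρ (L n)) (w p.1) (p.2.sort (· ≤ ·))) = ⊤) :
    ∃ e : (⨁ i, UniversalWhittaker c (a₁ i) (a₂ i)) ≃ₗ[ℂ] M,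
      (∀ (X : Virasoro) (x : ⨁ i, UniversalWhittaker c (a₁ i) (a₂ i)),
        e (UniversalEnvelopingAlgebra.ι ℂ X • x) = ρ X (e x)) ∧
      ∀ i, e (DirectSum.of (fun i => UniversalWhittaker c (a₁ i) (a₂ i)) i
        (UniversalWhittaker.gen c (a₁ i) (a₂ i))) = w i := by
  choose f hfg hf using fun i => UniversalWhittaker.exists_hom c (a₁ i) (a₂ i) ρ hρ (hc i) (h₁ i)
    (h₂ i) (h₃ i)
  let F : (⨁ i, UniversalWhittaker c (a₁ i) (a₂ i)) →ₗ[ℂ] M := DirectSum.toModule ℂ ι M f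
  have hFof : ∀ i x, F (DirectSum.of (fun i => UniversalWhittaker c (a₁ i) (a₂ i)) i x) = f i x :=
    fun i x => DirectSum.toModule_lof (φ := f) ℂ i x
  have hmon : ∀ i l, f i (opMon (whittakerOp c (a₁ i) (a₂ i))
      (UniversalWhittaker.gen c (a₁ i) (a₂ i)) l) = opMon (fun n => ρ (L n)) (w i) l := by
    intro i l
    induction l with
    | nil => exact hfg i
    | cons n l ih => rw [opMon_cons, opMon_cons, whittakerOp_apply, hf, ih]
  have hb := DirectSum.span_of_eq_top (fun i (s : Multiset ℕ) =>
      opMon (whittakerOp c (a₁ i) (a₂ i)) (UniversalWhittaker.gen c (a₁ i) (a₂ i))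
        (s.sort (· ≤ ·))) fun i => UniversalWhittaker.span_sorted_eq_top c (a₁ i) (a₂ i)
  have hFb : (fun p : ι × Multiset ℕ => F (DirectSum.lof ℂ ι _ p.1
      (opMon (whittakerOp c (a₁ p.1) (a₂ p.1)) (UniversalWhittaker.gen c (a₁ p.1) (a₂ p.1))
        (p.2.sort (· ≤ ·))))) = fun p : ι × Multiset ℕ =>
      opMon (fun n => ρ (L n)) (w p.1) (p.2.sort (· ≤ ·)) :=
    funext fun p => (hFof p.1 _).trans (hmon p.1 _)
  have hbij := bijective_of_span_of_linearIndependent F _ hb (by rw [hFb]; exact hli)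
    (by rw [hFb]; exact hsp)
  refine ⟨LinearEquiv.ofBijective F hbij, fun X x => ?_, fun i => ?_⟩
  · change F _ = ρ X (F x)
    induction x using DirectSum.induction_on with
    | zero => rw [smul_zero, map_zero, map_zero]
    | add x y hx hy => rw [smul_add, map_add, map_add, map_add, hx, hy]
    | of i y =>
      have e : UniversalEnvelopingAlgebra.ι ℂ X
          • DirectSum.of (fun i => UniversalWhittaker c (a₁ i) (a₂ i)) i y
          = DirectSum.of (fun i => UniversalWhittaker c (a₁ i) (a₂ i)) i
            (UniversalEnvelopingAlgebra.ι ℂ X • y) :=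
        ((DirectSum.lof (UniversalEnvelopingAlgebra ℂ Virasoro) ι
          (fun i => UniversalWhittaker c (a₁ i) (a₂ i)) i).map_smul _ y).symm
      rw [e, hFof, hFof, hf]
  · exact (hFof i _).trans (hfg i)

end Virasoro

open Virasoro SymplecticFermion in
theorem mainTheorem1
    (A : ℤ → LieAlgebra.SpecialLinear.sl (Fin 2) ℂ)
    (hA : ∀ k : ℤ, 1 < k → A k = 0)
    (P : GL (Fin 2) ℂ) (ξ ε : ℂ) (hξ : ξ ≠ 0)
    (hP : ((P⁻¹ : GL (Fin 2) ℂ) : Matrix (Fin 2) (Fin 2) ℂ) * (A 1).val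
      * (P : Matrix (Fin 2) (Fin 2) ℂ) = !![ξ, 0; 0, -ξ])
    (hε : (((P⁻¹ : GL (Fin 2) ℂ) : Matrix (Fin 2) (Fin 2) ℂ) * (A 0).val
      * (P : Matrix (Fin 2) (Fin 2) ℂ)) 0 0 = ε) :
    IsSimpleModule (ModeAlgebra (cliffordParam A)) (InducedModule (cliffordParam A)) ∧
    Function.Bijective (fun x : nonposSubalgebra (cliffordParam A) =>
      (x : ModeAlgebra (cliffordParam A)) • vac (cliffordParam A)) ∧
    (∀ (n : ℤ) (u : InducedModule (cliffordParam A)),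
      {i : ℤ | normOrd (cliffordParam A) 1 i 0 (n - i) • u ≠ 0}.Finite) ∧
    ∃ ρ : Virasoro →ₗ[ℂ] Module.End ℂ (InducedModule (cliffordParam A)),
      (∀ X Y : Virasoro, ρ ⁅X, Y⁆ = ρ X * ρ Y - ρ Y * ρ X) ∧
      (∀ (n : ℤ) (u : InducedModule (cliffordParam A)),
        ρ (L n) u = sugawara (cliffordParam A) n u) ∧
      (∀ u : InducedModule (cliffordParam A), ρ central u = (-2 : ℂ) • u) ∧
      ∃ (w : ℤ → InducedModule (cliffordParam A))
        (e : (⨁ k : ℤ, UniversalWhittaker (-2) (ξ * (k + ε)) (ξ ^ 2 / 2))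
          ≃ₗ[ℂ] InducedModule (cliffordParam A)),
        (∀ (X : Virasoro)
          (x : ⨁ k : ℤ, UniversalWhittaker (-2) (ξ * (k + ε)) (ξ ^ 2 / 2)),
          e (UniversalEnvelopingAlgebra.ι ℂ X • x) = ρ X (e x)) ∧
        ∀ k : ℤ,
          e (DirectSum.of (fun k : ℤ => UniversalWhittaker (-2) (ξ * (k + ε)) (ξ ^ 2 / 2)) k
            (UniversalWhittaker.gen (-2) (ξ * (k + ε)) (ξ ^ 2 / 2))) = w k ∧
          (∀ n : ℤ, 3 ≤ n → sugawara (cliffordParam A) n (w k) = 0) ∧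
          sugawara (cliffordParam A) 2 (w k) = (1 / 2 * ξ ^ 2) • w k ∧
          sugawara (cliffordParam A) 1 (w k) = (ξ * (k + ε)) • w k := by
  have hPQ : (P : Matrix (Fin 2) (Fin 2) ℂ) * ((P⁻¹ : GL (Fin 2) ℂ) : Matrix (Fin 2) (Fin 2) ℂ)
      = 1 := Units.mul_inv P
  have hcut : ∀ k, 1 < k → cliffordParam A k = 0 := fun k hk => cliffordParam_eq_zero (hA k hk)
  have hsymm := cliffordParam_symm A
  obtain ⟨f, g, hf, hg, hlead, hbasis⟩ := exists_isEigenSection_pair hPQ hξ hP hε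
  obtain ⟨S, hSv, hS⟩ := exists_fermionRep hcut hsymm
  obtain ⟨B, hBv, hTc, hTd, hBvac⟩ := S.exists_bcSystem hξ hf hg hlead hbasis
  have hno : ∀ (n i : ℤ) (u : InducedModule (cliffordParam A)),
      S.no 1 i 0 (n - i) u = normOrd (cliffordParam A) 1 i 0 (n - i) • u := by
    intro n i u
    rw [FermionRep.no, normOrd]
    split_ifs
    · rw [Module.End.mul_apply, hS, hS, mul_smul]
    · rw [LinearMap.neg_apply, Module.End.mul_apply, hS, hS, neg_smul, mul_smul]
    · rw [LinearMap.sub_apply, LinearMap.smul_apply, LinearMap.smul_apply, Module.End.mul_apply,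
        Module.End.mul_apply, hS, hS, hS, hS, sub_smul, smul_assoc, smul_assoc, mul_smul, mul_smul]
  have hsug : ∀ (n : ℤ) (u : InducedModule (cliffordParam A)),
      S.sug n u = sugawara (cliffordParam A) n u := by
    intro n u
    rw [FermionRep.sug, sugawara, LinearMap.add_apply, FermionRep.T, lfsum_apply (S.locFin_no n)]
    simp only [hno]
    rfl
  have hc : ∀ n m, S.sug n * B.c m - B.c m * S.sug n
      = -((m : ℂ) + ε) • B.c (n + m) - ξ • B.c (n + m - 1) := fun n m => by
    rw [S.sug_commutator, hTc]
  have hd : ∀ n m, S.sug n * B.d m - B.d m * S.sug n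
      = (ε - (n + m - 1)) • B.d (n + m) + ξ • B.d (n + m - 1) := fun n m => by
    rw [S.sug_commutator, hTd]
  obtain ⟨ρ, hρ, hρL, hρc⟩ := exists_representation (-2) S.sug fun m n =>
    S.virasoro_relation B hc hd m n
  obtain ⟨hli, hsp⟩ := B.linearIndependent_and_span_lmon hξ fun n => B.eq_current_add hc hd n
  -- Since the eigenvalue of `L 1` falls by `ξ` per unit of charge, the Whittaker vector with label
  -- `k` is the vacuum of charge `-k`.
  have heig : ∀ n : ℤ, 1 ≤ n → ∀ k : ℤ, S.sug n (B.cv (-k))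
      = (sugawaraConst (cliffordParam A) n - if n = 1 then ξ * ((-k : ℤ) : ℂ) else 0)
        • B.cv (-k) := fun n hn k =>
    B.L_pos_cv hc hd hn (by rw [hBv]; exact S.sug_vac hn) (-k)
  have heig₁ : ∀ k : ℤ, S.sug 1 (B.cv (-k)) = (ξ * (k + ε)) • B.cv (-k) := by
    intro k
    rw [heig 1 le_rfl, if_pos rfl, sugawaraConst_cliffordParam_one S hPQ hP hε]
    congr 1
    push_cast
    ring
  have heig₂ : ∀ k : ℤ, S.sug 2 (B.cv (-k)) = (ξ ^ 2 / 2) • B.cv (-k) := by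
    intro k
    rw [heig 2 (by norm_num), if_neg (by norm_num), sub_zero,
      sugawaraConst_cliffordParam_two S hPQ hP]
  have heig₃ : ∀ (k n : ℤ), 3 ≤ n → S.sug n (B.cv (-k)) = 0 := by
    intro k n hn
    rw [heig n (by omega), if_neg (by omega), S.sugawaraConst_eq_zero hn, sub_zero]
    exact zero_smul ℂ (B.cv (-k))
  have hmon : (fun p : ℤ × Multiset ℕ => opMon (fun n => ρ (L n)) (B.cv (-p.1))
      (p.2.sort (· ≤ ·))) = (fun i : ℤ × Multiset ℕ => B.lmon S.sug i.1 (i.2.sort (· ≤ ·)))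
        ∘ Equiv.prodCongr (Equiv.neg ℤ) (Equiv.refl _) := by
    rw [show (fun n => ρ (L n)) = S.sug from funext hρL]
    rfl
  obtain ⟨e, he, hew⟩ := exists_whittaker_decomposition ρ hρ (-2) (fun k : ℤ => ξ * (k + ε))
    (fun _ => ξ ^ 2 / 2) (fun k => B.cv (-k)) (fun k => by rw [hρc]; rfl)
    (fun k => by rw [hρL]; exact heig₁ k) (fun k => by rw [hρL]; exact heig₂ k)
    (fun k n hn => by rw [hρL]; exact heig₃ k n hn)
    (by rw [hmon]; exact hli.comp _ (Equiv.injective _))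
    (by rw [hmon, EquivLike.range_comp]; exact hsp)
  refine ⟨?_, bijective_smul_vac hcut hsymm, fun n u => ?_, ρ, hρ, fun n u => ?_, fun u => ?_,
    fun k => B.cv (-k), e, he, fun k => ⟨hew k, fun n hn => ?_, ?_, ?_⟩⟩
  · have hvac : ∀ u, (∀ a n, 1 ≤ n → S.ψ a n u = 0) → ∃ t : ℂ, u = t • S.v := fun u hu => by
      rw [← hBv]
      exact B.vac_unique (fun n hn => (hBvac u hu n hn).1) fun n hn => (hBvac u hu n hn).2
    have : Nontrivial (InducedModule (cliffordParam A)) := ⟨S.v, 0, S.v_ne⟩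
    have : IsSimpleOrder (Submodule (ModeAlgebra (cliffordParam A))
        (InducedModule (cliffordParam A))) :=
      { eq_bot_or_eq_top := fun W => by
          have h := S.eq_bot_or_eq_top hvac (W.restrictScalars ℂ) fun a n u hu => by
            rw [hS]
            exact W.smul_mem _ hu
          rwa [Submodule.restrictScalars_eq_bot_iff, Submodule.restrictScalars_eq_top_iff] at h }
    exact ⟨⟩
  · refine (S.locFin_no n u).subset fun i hi => ?_
    rw [Function.mem_support, hno]
    exact hi
  · rw [hρL, hsug]
  · rw [hρc]; rfl
  · rw [← hsug, heig₃ k n hn]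
  · rw [← hsug, heig₂]
    congr 1
    ring
  · rw [← hsug, heig₁]
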